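/- Let $G$ be a compact (Hausdorff) Abelian group, written additively, with normalised Haar measure $\mu_G$ and dual group $\widehat{G}$ of continuous homomorphisms $\gamma:G\to S^1$. For $f\in L^1(G)$ put $\widehat{f}(\gamma)=\int f\,\overline{\gamma}\,d\mu_G$, and let $A(G)=\{f\in L^1(G):\|f\|_{A(G)}:=\sum_{\gamma\in\widehat{G}}|\widehat{f}(\gamma)|<\infty\}$. For $z\in S^1$ let $\|z\|:=\frac{1}{2\pi}\inf_{n\in\mathbb{Z}}|2\pi n+\arg z|$. For a non-empty finite set $\Gamma\subset\widehat{G}$ and $\delta\in(0,1]$, the Bohr set is $B(\Gamma,\delta):=\{x\in G:\|\gamma(x)\|\le\delta\text{ for all }\gamma\in\Gamma\}$; it has positive measure. Write $d:=|\Gamma|$ and let $\beta_{\Gamma,\delta}$ be the probability measure $\mu_G(B(\Gamma,\delta))^{-1}\mu_G|_{B(\Gamma,\delta)}$. For $x\in G$ let $f*\beta_{\Gamma,\delta}(x):=\int f(x-y)\,d\beta_{\Gamma,\delta}(y)$, and for $1\le p\le\infty$ let $\|\cdot\|_{L^p(x+B(\Gamma,\delta))}$ be the $L^p$ norm with respect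 to the translated measure $x+\beta_{\Gamma,\delta}$ (the essential supremum if $p=\infty$). There are absolute constants $C,c>0$ such that the following holds for every such $G$, every $f\in A(G)$ that is not almost everywhere zero, and every $\epsilon\in(0,1]$. Write $A_f:=\|f\|_{A(G)}\|f\|_{L^\infty(G)}^{-1}$. There are a non-empty finite set $\Gamma\subset\widehat{G}$, with $d=|\Gamma|$, and a $\delta\in(0,1]$ such that, with $\beta=\beta_{\Gamma,\delta}$, $$d\le C\,\epsilon^{-2}A_f(1+\log A_f)(1+\log(\epsilon^{-1}A_f))\quad\text{and}\quad \log\delta^{-1}\le C\,\epsilon^{-2}A_f(1+\log(\epsilon^{-1}A_f)),$$ and a $\delta'$ with $0<\delta'<\delta$ and $\delta'\ge c\,\epsilon\delta/d$ such that $$\sup_{x\in G}\|f*\beta-f*\beta(x)\|_{L^\infty(x+B(\Gamma,\delta'))}\le\epsilon\|f\|_{L^\infty(G)}$$ and $$\sup_{x\in G}\|f-f*\beta\|_{L^2(x+B(\Gamma,\delta'))}\le\epsilon\|f\|_{L^\infty(G)}.$$ -/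

import Mathlib

open MeasureTheory
open scoped ENNReal ComplexConjugate

noncomputable section

namespace BohrApprox

/-- The valuation `‖z‖ = (1/2π) inf_{n ∈ ℤ} |2πn + arg z|` on the unit circle. -/
def circleVal (z : Circle) : ℝ :=
  (1 / (2 * Real.pi)) * ⨅ n : ℤ, |2 * Real.pi * (n : ℝ) + Complex.arg (z : ℂ)|

/-- The set `B(Γ, δ)` of all `x` with `‖γ(x)‖ ≤ δ` for every `γ ∈ Γ`. -/
def bohrSet {G : Type*} [CommGroup G] [TopologicalSpace G]
    (Γ : Finset (PontryaginDual G)) (δ : ℝ) : Set G :=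
  {x | ∀ γ ∈ Γ, circleVal (γ x) ≤ δ}

/-- The normalised Bohr cutoff `β_{Γ,δ}`: the probability measure induced by `μ` on `B(Γ, δ)`. -/
def bohrMeasure {G : Type*} [CommGroup G] [TopologicalSpace G] [MeasurableSpace G]
    (μ : Measure G) (Γ : Finset (PontryaginDual G)) (δ : ℝ) : Measure G :=
  ProbabilityTheory.cond μ (bohrSet Γ δ)

/-- The translate `x + β_{Γ,δ}` (the group is written multiplicatively), carried by the
Bohr neighbourhood `x + B(Γ, δ)`. -/
def bohrNhdMeasure {G : Type*} [CommGroup G] [TopologicalSpace G] [MeasurableSpace G]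
    (μ : Measure G) (x : G) (Γ : Finset (PontryaginDual G)) (δ : ℝ) : Measure G :=
  (bohrMeasure μ Γ δ).map (fun y => x * y)

/-- The convolution `(f ∗ ν)(x) = ∫ f(x - y) dν(y)` of a function with a measure. -/
def convMeasure {G : Type*} [CommGroup G] [MeasurableSpace G]
    (f : G → ℂ) (ν : Measure G) (x : G) : ℂ :=
  ∫ y, f (x / y) ∂ν

/-- The Fourier transform `γ ↦ ∫ f(x) conj(γ(x)) dμ(x)`. -/
def fourierCoeff {G : Type*} [CommGroup G] [TopologicalSpace G] [MeasurableSpace G]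
    (μ : Measure G) (f : G → ℂ) (γ : PontryaginDual G) : ℂ :=
  ∫ x, f x * conj ((γ x : Circle) : ℂ) ∂μ

/-- Membership in `A(G)`: `f ∈ L¹(G)` with absolutely summable Fourier transform. -/
def MemA {G : Type*} [CommGroup G] [TopologicalSpace G] [MeasurableSpace G]
    (μ : Measure G) (f : G → ℂ) : Prop :=
  Integrable f μ ∧ Summable (fun γ : PontryaginDual G => ‖fourierCoeff μ f γ‖)

/-- The norm of `A(G)`, the `ℓ¹` norm of the Fourier transform. -/
def normA {G : Type*} [CommGroup G] [TopologicalSpace G] [MeasurableSpace G]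
    (μ : Measure G) (f : G → ℂ) : ℝ :=
  ∑' γ : PontryaginDual G, ‖fourierCoeff μ f γ‖

/-- The norm of `L^∞(μ)` as a real number (an element of `A(G)` is essentially bounded). -/
def normLinfty {G : Type*} [MeasurableSpace G] (μ : Measure G) (f : G → ℂ) : ℝ :=
  (eLpNorm f ∞ μ).toReal

/-- The quantity `A_f = ‖f‖_{A(G)} / ‖f‖_∞`. -/
def ratioA {G : Type*} [CommGroup G] [TopologicalSpace G] [MeasurableSpace G]
    (μ : Measure G) (f : G → ℂ) : ℝ :=
  normA μ f / normLinfty μ f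

end BohrApprox

end

/-!
Rank and width of the Bohr set are found by iteration. Write `f` as its uniformly convergent
Fourier series `∑ a γ • γ`, normalised to `sup |f| = 1`, so that `A = ∑ |a γ| ≥ 1`. A state is a
Bohr set `B(Γ, δ₀)`; a character is *captured* by it if it is constant on it up to `ν`, where `ν`
is of order `ε² / A`, and the *uncaptured mass* is the part of `∑ |a γ|` carried by the other
characters. It is at most `A` at the start.

**Increment step** (`approx_or_increment`). Regularity of Bohr sets (`exists_regular_width`) gives
a width `δ` close to `δ₀` for which `f ∗ β` is nearly constant on translates of a narrower
`B(Γ, δ')`. Suppose that `g = f - f ∗ β` has `L²` norm more than `ε` on a translate of `B(Γ, δ')`.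
Smoothing that translate gives a positive functional `I` with `I (|g|²) ≥ ε² / 2`. Expanding one of
the two factors, captured characters contribute little, so the uncaptured ones correlate with `g`:
`∑ |a γ| |I (conj g γ)| ≥ ε² / 5` (`le_tsum_uncaptured`). By dyadic pigeonholing
(`exists_dyadic_scale`) there is a scale `2 ^ (-j)` such that the set `S` of all `γ` with
`|I (conj g γ)| ≥ 2 ^ (-j)` carries uncaptured mass of order `ε² (2 ^ j / n + 1)`, with `n`
logarithmic in `A / ε`.

**Few new characters capture `S`.** Let `Λ` be a maximal subset of `S` which is dissociated
relative to the spectrum of the smoothing measure. Every element of `S` is a product of elements of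
`Λ`, up to a character with a large coefficient in the spectrum, which is nearly constant on a
narrow Bohr set; so adjoining `Λ` to `Γ` and shrinking the width polynomially captures `S`. The
size of `Λ` is `O(2 ^ j (1 + log A))`, *linear* in `2 ^ j`, in contrast to the quadratic bound from
Chang's inequality for general bounded functions: the Riesz product `∏ (1 + t Re (ω λ))` pairs with
`conj g` to a polynomial in `t` which is bounded on `[-1, 1]` and has coefficients `O(A)`, because
`g` lies in `A(G)`. By Bernstein's inequality, after truncation, the linear coefficient of such a
polynomial is `O(1 + log A)` (`norm_coeff_one_le`), and this coefficient is `∑ |I (conj g λ)|` for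
suitable phases `ω` (`sum_norm_apply_mul_chi_le`).

**Counting.** Each step spends mass of order `ε² 2 ^ j / n` for `2 ^ j (1 + log A)` new characters,
and mass at least `ε² / 60` for one polynomial shrinking of the width. The total mass `A` thus pays
for a rank of `O(ε⁻² A n (1 + log A))`, and for `O(ε⁻² A)` steps, each of which costs
`O(log (A / ε))` in `log δ⁻¹`. The two terms of the weight in the dyadic pigeonholing are what
saves a logarithm in the bound for the width (`exists_isApprox_of_budget`, `exists_isApprox`).

**Fourier uniqueness.** That `f` agrees almost everywhere with its Fourier series needs the
characters to separate the points of `G`. They are obtained from Gelfand theory for the commutative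
algebra of operators on `C(G, ℂ)` generated by the translations and a convolution operator
(`exists_character_apply_ne_one`); uniqueness then follows by the Stone–Weierstrass theorem and the
regularity of `μ` (`ae_eq_zero_of_fourierCoeff_eq_zero`).
-/

set_option linter.unusedSectionVars false

namespace BohrApprox

/-! ### The valuation on the circle -/

lemma circleVal_eq_abs_arg (z : Circle) :
    circleVal z = |Complex.arg (z : ℂ)| / (2 * Real.pi) := by
  have hpi := Real.pi_pos
  have hz := abs_le.1 (Complex.abs_arg_le_pi (z : ℂ))
  have key : ⨅ n : ℤ, |2 * Real.pi * (n : ℝ) + Complex.arg (z : ℂ)|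
      = |Complex.arg (z : ℂ)| := by
    apply le_antisymm
    · refine (ciInf_le ⟨0, ?_⟩ (0 : ℤ)).trans (by simp)
      rintro _ ⟨n, rfl⟩
      exact abs_nonneg _
    · refine le_ciInf fun n => ?_
      rcases lt_trichotomy n 0 with h | h | h
      · have h1 : (n : ℝ) ≤ -1 := by exact_mod_cast Int.le_sub_one_of_lt h
        have h2 : 2 * Real.pi * (n : ℝ) ≤ -(2 * Real.pi) := by nlinarith
        exact (Complex.abs_arg_le_pi _).trans (le_abs.2 (Or.inr (by linarith)))
      · simp [h]
      · have h1 : (1 : ℝ) ≤ n := by exact_mod_cast h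
        have h2 : 2 * Real.pi ≤ 2 * Real.pi * (n : ℝ) := by nlinarith
        exact (Complex.abs_arg_le_pi _).trans (le_abs.2 (Or.inl (by linarith)))
  rw [circleVal, key]
  ring

lemma circleVal_nonneg (z : Circle) : 0 ≤ circleVal z := by
  rw [circleVal_eq_abs_arg]; positivity

lemma circleVal_one : circleVal 1 = 0 := by
  simp [circleVal_eq_abs_arg]

lemma circleVal_le_of_exp {z : Circle} {t : ℝ} (h : Circle.exp t = z) :
    circleVal z ≤ |t| / (2 * Real.pi) := by
  have hz : (z : ℂ) = Complex.exp (t * Complex.I) := by rw [← h]; simp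
  have hpi := Real.pi_pos
  obtain ⟨n, hn⟩ : ∃ n : ℤ, t = 2 * Real.pi * n + Complex.arg (z : ℂ) := by
    refine ⟨toIocDiv Real.two_pi_pos (-Real.pi) t, ?_⟩
    rw [hz, Complex.arg_exp_mul_I, ← self_sub_toIocDiv_zsmul Real.two_pi_pos (-Real.pi) t]
    simp only [zsmul_eq_mul]
    ring
  rw [circleVal, one_div_mul_eq_div, hn]
  refine div_le_div_of_nonneg_right (ciInf_le ⟨0, ?_⟩ n) (by positivity)
  rintro _ ⟨m, rfl⟩
  exact abs_nonneg _

lemma circleVal_mul_le (z w : Circle) : circleVal (z * w) ≤ circleVal z + circleVal w := by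
  have h := circleVal_le_of_exp (z := z * w)
    (t := Complex.arg (z : ℂ) + Complex.arg (w : ℂ)) (by simp [Circle.exp_add])
  rw [circleVal_eq_abs_arg z, circleVal_eq_abs_arg w, ← add_div]
  refine h.trans ?_
  have hpi := Real.pi_pos
  exact div_le_div_of_nonneg_right (abs_add_le _ _) (by positivity)

lemma circleVal_inv (z : Circle) : circleVal z⁻¹ = circleVal z := by
  have key (w : Circle) : circleVal w⁻¹ ≤ circleVal w := by
    have h := circleVal_le_of_exp (z := w⁻¹) (t := -Complex.arg (w : ℂ)) (by simp [Circle.exp_neg])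
    rwa [abs_neg, ← circleVal_eq_abs_arg] at h
  exact le_antisymm (key z) (by simpa using key z⁻¹)

lemma norm_one_sub_le_circleVal (z : Circle) :
    ‖(1 : ℂ) - z‖ ≤ 2 * Real.pi * circleVal z := by
  have hpi := Real.pi_pos
  have h1 : (z : ℂ) = Complex.exp (Complex.I * (Complex.arg (z : ℂ) : ℝ)) := by
    rw [mul_comm]
    have := Circle.exp_arg z
    rw [← Circle.coe_exp, this]
  rw [circleVal_eq_abs_arg, norm_sub_rev]
  have h2 := Real.norm_exp_I_mul_ofReal_sub_one_le (x := Complex.arg (z : ℂ))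
  rw [← h1] at h2
  refine h2.trans (le_of_eq ?_)
  rw [Real.norm_eq_abs]
  field_simp

lemma continuous_circleVal : Continuous circleVal := by
  have h : circleVal = fun z : Circle => Real.arccos ((z : ℂ).re) / (2 * Real.pi) := by
    funext z
    have h1 := Complex.cos_arg (Circle.coe_ne_zero z)
    rw [Circle.norm_coe, div_one] at h1
    rw [circleVal_eq_abs_arg, ← h1, ← Real.cos_abs,
      Real.arccos_cos (abs_nonneg _) (Complex.abs_arg_le_pi _)]
  rw [h]
  fun_prop

/-! ### Bohr sets -/

section BohrSet

variable {G : Type*} [CommGroup G] [TopologicalSpace G]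

lemma one_mem_bohrSet (Γ : Finset (PontryaginDual G)) {r : ℝ} (hr : 0 ≤ r) :
    (1 : G) ∈ bohrSet Γ r := by
  intro γ _
  rw [map_one, circleVal_one]
  exact hr

lemma bohrSet_mono {Γ Γ' : Finset (PontryaginDual G)} {r r' : ℝ} (hΓ : Γ' ⊆ Γ) (hr : r ≤ r') :
    bohrSet Γ r ⊆ bohrSet Γ' r' :=
  fun _ hx γ hγ => (hx γ (hΓ hγ)).trans hr

lemma mul_mem_bohrSet {Γ : Finset (PontryaginDual G)} {r s t : ℝ} {x y : G}
    (hx : x ∈ bohrSet Γ r) (hy : y ∈ bohrSet Γ s) (h : r + s ≤ t) : x * y ∈ bohrSet Γ t := by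
  intro γ hγ
  rw [map_mul]
  exact (circleVal_mul_le _ _).trans ((add_le_add (hx γ hγ) (hy γ hγ)).trans h)

lemma inv_mem_bohrSet {Γ : Finset (PontryaginDual G)} {r : ℝ} {x : G}
    (hx : x ∈ bohrSet Γ r) : x⁻¹ ∈ bohrSet Γ r := by
  intro γ hγ
  rw [map_inv, circleVal_inv]
  exact hx γ hγ

lemma isClosed_bohrSet (Γ : Finset (PontryaginDual G)) (r : ℝ) : IsClosed (bohrSet Γ r) := by
  have : bohrSet Γ r = ⋂ γ ∈ Γ, {x : G | circleVal (γ x) ≤ r} := by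
    ext x; simp [bohrSet]
  rw [this]
  refine isClosed_biInter fun γ _ => isClosed_le ?_ continuous_const
  exact continuous_circleVal.comp (map_continuous γ)

lemma bohrSet_mem_nhds (Γ : Finset (PontryaginDual G)) {r : ℝ} (hr : 0 < r) :
    bohrSet Γ r ∈ nhds (1 : G) := by
  have : (⋂ γ ∈ Γ, {x : G | circleVal (γ x) < r}) ⊆ bohrSet Γ r := by
    intro x hx γ hγ
    simp only [Set.mem_iInter] at hx
    exact (hx γ hγ).le
  refine Filter.mem_of_superset ?_ this
  refine IsOpen.mem_nhds ?_ ?_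
  · refine isOpen_biInter_finset fun γ _ => isOpen_lt ?_ continuous_const
    exact continuous_circleVal.comp (map_continuous γ)
  · simp only [Set.mem_iInter]
    intro γ _
    simpa [circleVal_one] using hr

variable [MeasurableSpace G] [BorelSpace G]

lemma measurableSet_bohrSet (Γ : Finset (PontryaginDual G)) (r : ℝ) :
    MeasurableSet (bohrSet Γ r) := (isClosed_bohrSet Γ r).measurableSet

variable (μ : Measure G) [μ.IsHaarMeasure] [IsProbabilityMeasure μ]

lemma measureReal_bohrSet_pos (Γ : Finset (PontryaginDual G)) {r : ℝ} (hr : 0 < r) :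
    0 < μ.real (bohrSet Γ r) := by
  rw [measureReal_def]
  exact ENNReal.toReal_pos (Measure.measure_pos_of_mem_nhds μ (bohrSet_mem_nhds Γ hr)).ne'
    (measure_ne_top _ _)

variable [IsTopologicalGroup G]

/-- Bohr sets of rank `d` grow at most exponentially in `d`: the box of side `2r` in the torus
is cut into `5 ^ d` cells of side `r / 2`, and the points of one cell differ by elements of the
Bohr set of half the width. -/
lemma measureReal_bohrSet_le (Γ : Finset (PontryaginDual G)) {r : ℝ} (hr : 0 < r) :
    μ.real (bohrSet Γ r) ≤ 5 ^ Γ.card * μ.real (bohrSet Γ (r / 2)) := by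
  classical
  have hpi := Real.pi_pos
  -- the position of the argument of `γ x` in the interval `[-r, r]`, in units of `r / 2`
  let p : PontryaginDual G → G → ℝ := fun γ x =>
    (Complex.arg ((γ x : Circle) : ℂ) / (2 * Real.pi) + r) / (r / 2)
  have hp {γ : PontryaginDual G} (hγ : γ ∈ Γ) {x : G} (hx : x ∈ bohrSet Γ r) :
      0 ≤ p γ x ∧ p γ x < 5 := by
    have h1 := hx γ hγ
    rw [circleVal_eq_abs_arg, ← abs_of_pos (show 0 < 2 * Real.pi by positivity), ← abs_div,
      abs_le] at h1
    constructor
    · exact div_nonneg (by linarith [h1.1]) (by positivity)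
    · rw [div_lt_iff₀ (by positivity)]
      linarith [h1.2]
  let cell : (Γ → Fin 5) → Set G := fun c =>
    {x | x ∈ bohrSet Γ r ∧ ∀ γ : Γ, ⌊p γ x⌋₊ = c γ}
  have hcover : bohrSet Γ r ⊆ ⋃ c : Γ → Fin 5, cell c := by
    intro x hx
    rw [Set.mem_iUnion]
    refine ⟨fun γ => ⟨⌊p γ x⌋₊, ?_⟩, hx, fun γ => rfl⟩
    exact (Nat.floor_lt (hp γ.2 hx).1).2 (by exact_mod_cast (hp γ.2 hx).2)
  have hcell (c : Γ → Fin 5) : μ.real (cell c) ≤ μ.real (bohrSet Γ (r / 2)) := by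
    rcases (cell c).eq_empty_or_nonempty with h | ⟨y, hy⟩
    · rw [h]; simp
    · have hsub : cell c ⊆ (fun x => y⁻¹ * x) ⁻¹' bohrSet Γ (r / 2) := by
        intro x hx γ hγ
        have h1 := hx.2 ⟨γ, hγ⟩
        have h2 := hy.2 ⟨γ, hγ⟩
        have h3 := Nat.floor_eq_iff (hp hγ hx.1).1 |>.1 h1
        have h4 := Nat.floor_eq_iff (hp hγ hy.1).1 |>.1 h2
        have h5 : |p γ x - p γ y| ≤ 1 := abs_le.2 ⟨by linarith, by linarith⟩
        have h6 : p γ x - p γ y =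
            (Complex.arg ((γ x : Circle) : ℂ) - Complex.arg ((γ y : Circle) : ℂ))
              / (2 * Real.pi) / (r / 2) := by
          simp only [p]; ring
        rw [h6, abs_div, abs_of_pos (show 0 < r / 2 by positivity),
          div_le_one (by positivity), abs_div,
          abs_of_pos (show 0 < 2 * Real.pi by positivity)] at h5
        refine (circleVal_le_of_exp ?_).trans h5
        rw [map_mul, map_inv, sub_eq_add_neg, Circle.exp_add, Circle.exp_neg, Circle.exp_arg,
          Circle.exp_arg, mul_comm]
      refine (measureReal_mono hsub).trans (le_of_eq ?_)
      rw [measureReal_def, measureReal_def, measure_preimage_mul]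
  calc μ.real (bohrSet Γ r) ≤ μ.real (⋃ c : Γ → Fin 5, cell c) := measureReal_mono hcover
    _ ≤ ∑ c : Γ → Fin 5, μ.real (cell c) := measureReal_iUnion_fintype_le _
    _ ≤ ∑ _c : Γ → Fin 5, μ.real (bohrSet Γ (r / 2)) := Finset.sum_le_sum fun c _ => hcell c
    _ = 5 ^ Γ.card * μ.real (bohrSet Γ (r / 2)) := by simp

/-- Regularity of Bohr sets at one scale: by pigeonholing the growth between the widths `r / 2`
and `r`, some Bohr set grows by a factor of at most `1 + κ` when its width grows by
`κ r / (8 d)`. -/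
lemma exists_regular_width {Γ : Finset (PontryaginDual G)} (hΓ : Γ.Nonempty) {r κ : ℝ}
    (hr : 0 < r) (hκ : 0 < κ) (hκ1 : κ ≤ 1) :
    ∃ t, r / 2 ≤ t ∧ t + κ * r / (8 * Γ.card) ≤ r ∧
      μ.real (bohrSet Γ (t + κ * r / (8 * Γ.card))) ≤ (1 + κ) * μ.real (bohrSet Γ t) := by
  have hd : (1 : ℝ) ≤ Γ.card := by exact_mod_cast hΓ.card_pos
  set d : ℝ := (Γ.card : ℝ) with hd_def
  set s := κ * r / (8 * d) with hs_def
  set N := ⌈3 * d / κ⌉₊ with hN_def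
  have hN1 : 3 * d / κ ≤ N := Nat.le_ceil _
  have hN2 : (N : ℝ) ≤ 4 * d / κ := by
    have h1 : (N : ℝ) < 3 * d / κ + 1 := Nat.ceil_lt_add_one (by positivity)
    have h2 : 1 ≤ d / κ := by rw [le_div_iff₀ hκ]; linarith
    have h3 : 4 * d / κ = 3 * d / κ + d / κ := by ring
    linarith
  have hNs : N * s ≤ r / 2 := by
    calc N * s ≤ 4 * d / κ * s := by gcongr
      _ = r / 2 := by rw [hs_def]; field_simp; norm_num
  by_contra! hcon
  have hs : 0 < s := by positivity
  have hstep : ∀ i : ℕ, i ≤ N →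
      (1 + κ) ^ i * μ.real (bohrSet Γ (r / 2)) ≤ μ.real (bohrSet Γ (r / 2 + i * s)) := by
    intro i
    induction i with
    | zero => intro _; simp
    | succ i ih =>
      intro hi
      have h1 := ih (by omega)
      have h2 : ((i + 1 : ℕ) : ℝ) * s ≤ N * s := by gcongr
      push_cast at h2
      have h3 := hcon (r / 2 + i * s) (by linarith [show 0 ≤ (i : ℝ) * s by positivity])
        (by linarith)
      calc (1 + κ) ^ (i + 1) * μ.real (bohrSet Γ (r / 2))
          = (1 + κ) * ((1 + κ) ^ i * μ.real (bohrSet Γ (r / 2))) := by ring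
        _ ≤ (1 + κ) * μ.real (bohrSet Γ (r / 2 + i * s)) := by gcongr
        _ ≤ μ.real (bohrSet Γ (r / 2 + i * s + s)) := h3.le
        _ = μ.real (bohrSet Γ (r / 2 + (i + 1 : ℕ) * s)) := by push_cast; ring_nf
  have h1 := hstep N le_rfl
  have h2 : μ.real (bohrSet Γ (r / 2 + N * s)) ≤ μ.real (bohrSet Γ r) :=
    measureReal_mono (bohrSet_mono subset_rfl (by linarith))
  have h3 := measureReal_bohrSet_le μ Γ hr
  have h4 : 0 < μ.real (bohrSet Γ (r / 2)) := measureReal_bohrSet_pos μ Γ (by positivity)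
  have h5 : (1 + κ) ^ N ≤ 5 ^ Γ.card := by
    have := h1.trans (h2.trans h3)
    exact le_of_mul_le_mul_right this h4
  have h6 : (8 : ℝ) ^ Γ.card ≤ (1 + κ) ^ N := by
    have h7 : (2 : ℝ) ≤ (1 + κ) ^ (1 / κ) := by
      have := one_add_mul_self_le_rpow_one_add (s := κ) (by linarith) (p := 1 / κ)
        (by rw [le_div_iff₀ hκ]; linarith)
      rw [one_div_mul_cancel hκ.ne'] at this
      linarith
    calc (8 : ℝ) ^ Γ.card = (2 : ℝ) ^ (3 * d) := by
          rw [Real.rpow_mul (by norm_num), hd_def, Real.rpow_natCast]; norm_num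
      _ ≤ ((1 + κ) ^ (1 / κ)) ^ (3 * d) := by gcongr
      _ = (1 + κ) ^ (3 * d / κ) := by rw [← Real.rpow_mul (by linarith)]; ring_nf
      _ ≤ (1 + κ) ^ (N : ℝ) := Real.rpow_le_rpow_of_exponent_le (by linarith) hN1
      _ = (1 + κ) ^ N := Real.rpow_natCast _ _
  have h7 : (5 : ℝ) ^ Γ.card < 8 ^ Γ.card :=
    pow_lt_pow_left₀ (by norm_num) (by norm_num) hΓ.card_pos.ne'
  linarith

end BohrSet

/-! ### Characters as continuous functions, and averaging operators -/

section Averaging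

variable {G : Type*} [CommGroup G] [TopologicalSpace G]

/-- A character of `G`, regarded as a continuous complex-valued function. -/
noncomputable def chi (γ : PontryaginDual G) : C(G, ℂ) :=
  ⟨fun x => ((γ x : Circle) : ℂ), continuous_subtype_val.comp (map_continuous γ)⟩

@[simp]
lemma chi_apply (γ : PontryaginDual G) (x : G) : chi γ x = ((γ x : Circle) : ℂ) := rfl

variable [IsTopologicalGroup G]

@[simp]
lemma chi_one : chi (1 : PontryaginDual G) = 1 := by
  ext x; simp

lemma chi_mul (γ γ' : PontryaginDual G) : chi (γ * γ') = chi γ * chi γ' := by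
  ext x
  show ((γ x * γ' x : Circle) : ℂ) = _
  simp

lemma chi_inv (γ : PontryaginDual G) : chi γ⁻¹ = star (chi γ) := by
  ext x
  show (((γ x)⁻¹ : Circle) : ℂ) = _
  rw [Circle.coe_inv_eq_conj]
  rfl

lemma norm_chi_apply (γ : PontryaginDual G) (x : G) : ‖chi γ x‖ = 1 :=
  Circle.norm_coe _

variable [CompactSpace G] [MeasurableSpace G] [BorelSpace G]

lemma integrable_of_continuousMap (ν : Measure G) [IsFiniteMeasure ν] {φ : G → ℂ}
    (hφ : Continuous φ) : Integrable φ ν :=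
  hφ.integrable_of_hasCompactSupport (HasCompactSupport.of_compactSpace φ)

/-- The operator `φ ↦ (x ↦ ∫ φ (x z) dν(z))` on continuous functions. Iterating such operators
replaces convolution of measures, which would need the multiplication of `G` to be measurable for
the product of the Borel `σ`-algebras. -/
noncomputable def avg (ν : Measure G) [IsProbabilityMeasure ν] : C(G, ℂ) →L[ℂ] C(G, ℂ) :=
  LinearMap.mkContinuous
    { toFun := fun φ => ⟨fun x => ∫ z, φ (x * z) ∂ν, by
        rw [← continuousOn_univ]
        refine continuousOn_integral_of_compact_support (k := Set.univ) isCompact_univ ?_ ?_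
        · exact Continuous.continuousOn (by fun_prop)
        · intro p x _ hx
          exact absurd (Set.mem_univ x) hx⟩
      map_add' := fun φ ψ => by
        ext x
        exact integral_add (integrable_of_continuousMap ν (by fun_prop))
          (integrable_of_continuousMap ν (by fun_prop))
      map_smul' := fun c φ => by
        ext x
        exact integral_const_mul c _ } 1 (fun φ => by
    rw [one_mul, ContinuousMap.norm_le _ (norm_nonneg _)]
    intro x
    refine (norm_integral_le_of_norm_le_const (C := ‖φ‖) (ae_of_all _ fun z => ?_)).trans ?_
    · exact φ.norm_coe_le_norm _
    · simp)

variable (ν : Measure G) [IsProbabilityMeasure ν]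

lemma avg_apply (φ : C(G, ℂ)) (x : G) : avg ν φ x = ∫ z, φ (x * z) ∂ν := rfl

lemma avg_one : avg ν (1 : C(G, ℂ)) = 1 := by
  ext x; simp [avg_apply]

lemma avg_chi (γ : PontryaginDual G) : avg ν (chi γ) = (avg ν (chi γ) 1) • chi γ := by
  ext x
  simp only [avg_apply, ContinuousMap.smul_apply, chi_apply, map_mul, one_mul, Circle.coe_mul,
    smul_eq_mul]
  rw [integral_const_mul, mul_comm]

lemma norm_avg_le_re_avg {φ ψ : C(G, ℂ)} (h : ∀ x, ‖φ x‖ ≤ (ψ x).re) (x : G) :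
    ‖avg ν φ x‖ ≤ (avg ν ψ x).re := by
  have hψ : Integrable (fun z => ψ (x * z)) ν := integrable_of_continuousMap ν (by fun_prop)
  rw [avg_apply, avg_apply, ← RCLike.re_eq_complex_re, ← integral_re hψ]
  exact norm_integral_le_of_norm_le hψ.re (ae_of_all _ fun z => h _)

lemma norm_avg_pow_le_re {φ ψ : C(G, ℂ)} (n : ℕ) (h : ∀ x, ‖φ x‖ ≤ (ψ x).re) (x : G) :
    ‖(avg ν ^ n) φ x‖ ≤ ((avg ν ^ n) ψ x).re := by
  induction n generalizing φ ψ with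
  | zero => exact h x
  | succ n ih =>
    rw [pow_succ]
    exact ih fun y => norm_avg_le_re_avg ν h y

lemma avg_pow_chi (n : ℕ) (γ : PontryaginDual G) :
    (avg ν ^ n) (chi γ) = (avg ν (chi γ) 1) ^ n • chi γ := by
  induction n with
  | zero => simp
  | succ n ih =>
    rw [pow_succ, mul_apply_eq_comp, avg_chi, map_smul, ih, smul_smul, pow_succ']
    simp

lemma norm_avg_apply_le {φ : C(G, ℂ)} {M : ℝ} (h : ∀ x, ‖φ x‖ ≤ M) (x : G) :
    ‖avg ν φ x‖ ≤ M := by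
  rw [avg_apply]
  simpa using norm_integral_le_of_norm_le_const (μ := ν) (C := M) (ae_of_all _ fun z => h (x * z))

end Averaging

/-! ### Averages over Bohr sets -/

section BohrAverage

variable {G : Type*} [CommGroup G] [TopologicalSpace G] [IsTopologicalGroup G] [CompactSpace G]
  [MeasurableSpace G] [BorelSpace G] (μ : Measure G) [μ.IsHaarMeasure] [IsProbabilityMeasure μ]
  (Γ : Finset (PontryaginDual G))

lemma measure_bohrSet_ne_zero {r : ℝ} (hr : 0 < r) : μ (bohrSet Γ r) ≠ 0 :=
  (Measure.measure_pos_of_mem_nhds μ (bohrSet_mem_nhds Γ hr)).ne'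

lemma isProbabilityMeasure_bohrMeasure {r : ℝ} (hr : 0 < r) :
    IsProbabilityMeasure (bohrMeasure μ Γ r) :=
  ProbabilityTheory.cond_isProbabilityMeasure (measure_bohrSet_ne_zero μ Γ hr)

lemma integral_bohrMeasure {E : Type*} [NormedAddCommGroup E] [NormedSpace ℝ E] (r : ℝ)
    (F : G → E) :
    ∫ z, F z ∂(bohrMeasure μ Γ r) = (μ.real (bohrSet Γ r))⁻¹ • ∫ z in bohrSet Γ r, F z ∂μ := by
  rw [bohrMeasure, ProbabilityTheory.cond, integral_smul_measure, ENNReal.toReal_inv,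
    measureReal_def]

lemma bohrMeasure_ae_mem (r : ℝ) : ∀ᵐ z ∂(bohrMeasure μ Γ r), z ∈ bohrSet Γ r :=
  ProbabilityTheory.ae_cond_mem (measurableSet_bohrSet Γ r)

lemma bohrMeasure_absolutelyContinuous (r : ℝ) : bohrMeasure μ Γ r ≪ μ :=
  ProbabilityTheory.cond_absolutelyContinuous

/-- A translation by `u` moves the average over a Bohr set of width `t` by at most the relative
growth of the Bohr set when its width is increased by the width of `u`. -/
lemma norm_avg_mul_sub_le {s t κ : ℝ} (ht : 0 < t)
    (hreg : μ.real (bohrSet Γ (t + s)) ≤ (1 + κ) * μ.real (bohrSet Γ t)) {u : G}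
    (hu : u ∈ bohrSet Γ s) [IsProbabilityMeasure (bohrMeasure μ Γ t)] {φ : C(G, ℂ)}
    (hφ : ∀ x, ‖φ x‖ ≤ 1) (x : G) :
    ‖avg (bohrMeasure μ Γ t) φ (x * u) - avg (bohrMeasure μ Γ t) φ x‖ ≤ 2 * κ := by
  set B := bohrSet Γ t with hB
  have hBm : MeasurableSet B := measurableSet_bohrSet Γ t
  have hmpos : 0 < μ.real B := measureReal_bohrSet_pos μ Γ ht
  -- `u B` as a preimage
  set B' := (fun z => u⁻¹ * z) ⁻¹' B with hB'
  have hB'm : MeasurableSet B' := (measurable_const_mul u⁻¹) hBm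
  have hmeas : μ.real B' = μ.real B := by
    rw [measureReal_def, measureReal_def, measure_preimage_mul]
  have hint : Integrable (fun z => φ (x * z)) μ := integrable_of_continuousMap μ (by fun_prop)
  have hshift : ∫ z in B, φ (x * u * z) ∂μ = ∫ z in B', φ (x * z) ∂μ := by
    rw [← integral_indicator hBm, ← integral_indicator hB'm,
      ← integral_mul_left_eq_self (μ := μ) (B'.indicator fun z => φ (x * z)) u]
    congr 1
    funext z
    by_cases hz : z ∈ B
    · rw [Set.indicator_of_mem hz, Set.indicator_of_mem (by simpa [hB'] using hz), mul_assoc]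
    · rw [Set.indicator_of_notMem hz, Set.indicator_of_notMem (by simpa [hB'] using hz)]
  have hsub : B ∪ B' ⊆ bohrSet Γ (t + s) := by
    have hs0 : B ⊆ bohrSet Γ (t + s) := by
      rcases Γ.eq_empty_or_nonempty with h | ⟨γ, hγ⟩
      · intro z _ γ hγ; simp [h] at hγ
      · exact bohrSet_mono subset_rfl
          (by linarith [circleVal_nonneg (γ u), hu γ hγ])
    refine Set.union_subset hs0 fun z hz => ?_
    have := mul_mem_bohrSet hu (show u⁻¹ * z ∈ bohrSet Γ t from hz) (by rw [add_comm])
    rwa [mul_inv_cancel_left] at this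
  have hdiff (P Q : Set G) (hPm : MeasurableSet P) (hP : μ.real P = μ.real B)
      (hPs : P ⊆ bohrSet Γ (t + s)) (hQs : Q ⊆ bohrSet Γ (t + s)) :
      μ.real (Q \ P) ≤ κ * μ.real B := by
    have h1 : μ.real (Q \ P) ≤ μ.real (bohrSet Γ (t + s) \ P) :=
      measureReal_mono (Set.sdiff_subset_sdiff_left hQs)
    rw [measureReal_sdiff hPs hPm, hP] at h1
    linarith
  have h1 := hdiff B B' hBm rfl (Set.subset_union_left.trans hsub)
    (Set.subset_union_right.trans hsub)
  have h2 := hdiff B' B hB'm hmeas (Set.subset_union_right.trans hsub)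
    (Set.subset_union_left.trans hsub)
  have hsplit : ∫ z in B', φ (x * z) ∂μ - ∫ z in B, φ (x * z) ∂μ
      = ∫ z in B' \ B, φ (x * z) ∂μ - ∫ z in B \ B', φ (x * z) ∂μ := by
    rw [← integral_inter_add_sdiff hBm hint.integrableOn (s := B'),
      ← integral_inter_add_sdiff hB'm hint.integrableOn (s := B), Set.inter_comm B B']
    ring
  have hbound (P : Set G) : ‖∫ z in P, φ (x * z) ∂μ‖ ≤ μ.real P := by
    have := norm_setIntegral_le_of_norm_le_const (μ := μ) (s := P) (C := 1)
      (f := fun z => φ (x * z)) (measure_lt_top _ _) (fun z _ => hφ _)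
    simpa using this
  rw [avg_apply, avg_apply, integral_bohrMeasure, integral_bohrMeasure, ← smul_sub, hshift, hsplit,
    norm_smul, Real.norm_of_nonneg (by positivity), inv_mul_le_iff₀ hmpos]
  calc _ ≤ ‖∫ z in B' \ B, φ (x * z) ∂μ‖ + ‖∫ z in B \ B', φ (x * z) ∂μ‖ := norm_sub_le _ _
    _ ≤ κ * μ.real B + κ * μ.real B := add_le_add ((hbound _).trans h1) ((hbound _).trans h2)
    _ = μ.real B * (2 * κ) := by ring

/-- The Fourier transform of a Bohr set is real, as Bohr sets are symmetric. -/
lemma avg_bohrMeasure_chi_real {t : ℝ} [IsProbabilityMeasure (bohrMeasure μ Γ t)]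
    (γ : PontryaginDual G) :
    ((avg (bohrMeasure μ Γ t) (chi γ) 1).re : ℂ) = avg (bohrMeasure μ Γ t) (chi γ) 1 := by
  rw [← Complex.conj_eq_iff_re, avg_apply, ← integral_conj, integral_bohrMeasure,
    integral_bohrMeasure]
  congr 1
  rw [← integral_indicator (measurableSet_bohrSet Γ t),
    ← integral_indicator (measurableSet_bohrSet Γ t), ← integral_inv_eq_self]
  congr 1
  funext z
  by_cases hz : z ∈ bohrSet Γ t
  · rw [Set.indicator_of_mem hz, Set.indicator_of_mem (inv_mem_bohrSet hz)]
    rw [one_mul, one_mul, chi_apply, chi_apply, map_inv, Circle.coe_inv_eq_conj, Complex.conj_conj]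
  · rw [Set.indicator_of_notMem hz, Set.indicator_of_notMem]
    intro h
    exact hz (by simpa using inv_mem_bohrSet h)

/-- If the Bohr set of width `t` at most doubles when it is widened by `ρ`, then the average over
it is at most twice the average over any translate, by an element of width `ρ`, of the wider set. -/
lemma integral_bohrMeasure_le_two_mul {t ρ : ℝ} (ht : 0 < t) (hρ : 0 ≤ ρ)
    (hreg : μ.real (bohrSet Γ (t + ρ)) ≤ 2 * μ.real (bohrSet Γ t))
    {F : G → ℝ} (hF : Continuous F) (hF0 : ∀ z, 0 ≤ F z) {u : G} (hu : u ∈ bohrSet Γ ρ) :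
    ∫ z, F z ∂(bohrMeasure μ Γ t) ≤ 2 * ∫ z, F (u * z) ∂(bohrMeasure μ Γ (t + ρ)) := by
  have hm : 0 < μ.real (bohrSet Γ t) := measureReal_bohrSet_pos μ Γ ht
  have hm' : 0 < μ.real (bohrSet Γ (t + ρ)) := measureReal_bohrSet_pos μ Γ (by linarith)
  have hint : Integrable F μ :=
    hF.integrable_of_hasCompactSupport (HasCompactSupport.of_compactSpace F)
  have hint' : Integrable (fun z => F (u * z)) μ :=
    (hF.comp (continuous_const_mul u)).integrable_of_hasCompactSupport
      (HasCompactSupport.of_compactSpace _)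
  have key : ∫ z in bohrSet Γ t, F z ∂μ ≤ ∫ z in bohrSet Γ (t + ρ), F (u * z) ∂μ := by
    rw [← integral_indicator (measurableSet_bohrSet Γ _),
      ← integral_indicator (measurableSet_bohrSet Γ _), ← integral_mul_left_eq_self (μ := μ) _ u]
    refine integral_mono ?_ (hint'.indicator (measurableSet_bohrSet Γ _)) fun z => ?_
    · exact (hint.indicator (measurableSet_bohrSet Γ _)).comp_mul_left u
    · by_cases hz : u * z ∈ bohrSet Γ t
      · have hz' : z ∈ bohrSet Γ (t + ρ) := by
          have := mul_mem_bohrSet hz (inv_mem_bohrSet hu) le_rfl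
          rwa [mul_comm u z, mul_inv_cancel_right] at this
        simp only [Set.indicator_of_mem hz, Set.indicator_of_mem hz', le_refl]
      · simp only [Set.indicator_of_notMem hz]
        exact Set.indicator_nonneg (fun _ _ => hF0 _) _
  have h0 : 0 ≤ ∫ z in bohrSet Γ t, F z ∂μ := integral_nonneg fun z => hF0 z
  rw [integral_bohrMeasure, integral_bohrMeasure, smul_eq_mul, smul_eq_mul,
    inv_mul_le_iff₀ hm]
  calc ∫ z in bohrSet Γ t, F z ∂μ ≤ ∫ z in bohrSet Γ (t + ρ), F (u * z) ∂μ := key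
    _ = μ.real (bohrSet Γ (t + ρ)) *
        ((μ.real (bohrSet Γ (t + ρ)))⁻¹ * ∫ z in bohrSet Γ (t + ρ), F (u * z) ∂μ) := by
        rw [mul_inv_cancel_left₀ hm'.ne']
    _ ≤ (2 * μ.real (bohrSet Γ t)) *
        ((μ.real (bohrSet Γ (t + ρ)))⁻¹ * ∫ z in bohrSet Γ (t + ρ), F (u * z) ∂μ) := by
        gcongr
        exact mul_nonneg (by positivity) (h0.trans key)
    _ = _ := by ring

/-- Lower bounds for a function on a Bohr neighbourhood of `x` pass to its iterated averages over
correspondingly narrower Bohr sets. -/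
lemma le_re_avg_pow {r b : ℝ} [IsProbabilityMeasure (bohrMeasure μ Γ r)] (n : ℕ)
    {ψ : C(G, ℂ)} {x : G} (h : ∀ u ∈ bohrSet Γ (n * r), b ≤ (ψ (x * u)).re) :
    b ≤ ((avg (bohrMeasure μ Γ r) ^ n) ψ x).re := by
  induction n generalizing x with
  | zero => simpa using h 1 (one_mem_bohrSet Γ (by simp))
  | succ n ih =>
    rw [pow_succ', mul_apply_eq_comp, avg_apply, ← RCLike.re_eq_complex_re]
    have hψ : Integrable (fun z => ((avg (bohrMeasure μ Γ r) ^ n) ψ) (x * z))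
      (bohrMeasure μ Γ r) := integrable_of_continuousMap _ (by fun_prop)
    rw [← integral_re hψ]
    calc b = ∫ _z, b ∂(bohrMeasure μ Γ r) := by simp
      _ ≤ _ := by
        refine integral_mono_ae (integrable_const b) hψ.re ?_
        filter_upwards [bohrMeasure_ae_mem μ Γ r] with z hz
        refine ih fun u hu => ?_
        rw [mul_assoc]
        exact h _ (mul_mem_bohrSet hz hu (by push_cast; linarith))

end BohrAverage

/-! ### The linear coefficient of a bounded polynomial -/

lemma sum_odd_part (b : ℕ → ℝ) (m : ℕ) (t : ℝ) :
    ∑ k ∈ Finset.range (2 * m), b k * t ^ k - ∑ k ∈ Finset.range (2 * m), b k * (-t) ^ k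
      = 2 * t * ∑ j ∈ Finset.range m, b (2 * j + 1) * (t ^ 2) ^ j := by
  induction m with
  | zero => simp
  | succ m ih =>
    rw [show 2 * (m + 1) = 2 * m + 1 + 1 by ring]
    simp only [Finset.sum_range_succ, mul_add, ← ih]
    have h1 : (-t) ^ (2 * m) = t ^ (2 * m) := Even.neg_pow ⟨m, by ring⟩ t
    have h2 : (-t) ^ (2 * m + 1) = -t ^ (2 * m + 1) := Odd.neg_pow ⟨m, rfl⟩ t
    rw [h1, h2, ← pow_mul]
    ring

lemma one_add_sq_div_two_le_cosh (v : ℝ) : 1 + v ^ 2 / 2 ≤ Real.cosh v := by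
  have h := Real.cosh_two_mul (v / 2)
  rw [show 2 * (v / 2) = v by ring, Real.cosh_sq] at h
  have h1 : (v / 2) ^ 2 ≤ Real.sinh (v / 2) ^ 2 := by
    rw [sq_le_sq, Real.abs_sinh]
    exact Real.self_le_sinh_iff.2 (abs_nonneg _)
  rw [h]
  nlinarith

lemma cosh_one_le_two : Real.cosh 1 ≤ 2 := by
  rw [Real.cosh_eq]
  have h1 := Real.exp_one_lt_d9
  have h2 : Real.exp (-1) ≤ 1 := Real.exp_le_one_iff.2 (by norm_num)
  linarith

/-- A form of Bernstein's inequality at the centre of an interval. The odd part of the polynomial is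
`t * Q (t ^ 2)`, so that `Q` is bounded away from `0`, and the extremal growth of
Chebyshev polynomials bounds `Q 0`. -/
lemma coeff_one_le_of_bounded {b : ℕ → ℝ} {m : ℕ} (hm : 0 < m) {M : ℝ} (hM : 0 < M)
    (h : ∀ t ∈ Set.Icc (-1 : ℝ) 1, |∑ k ∈ Finset.range (2 * m), b k * t ^ k| ≤ M) :
    b 1 ≤ 6 * m * M := by
  open Polynomial in
  have hm' : (1 : ℝ) ≤ m := by exact_mod_cast hm
  set x₀ := Real.cosh (1 / m) with hx₀
  have hx1 : 1 + (1 / m : ℝ) ^ 2 / 2 ≤ x₀ := one_add_sq_div_two_le_cosh _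
  have hx2 : x₀ ≤ 2 := by
    refine le_trans (Real.cosh_le_cosh.2 ?_) cosh_one_le_two
    rw [abs_of_nonneg (by positivity), abs_one, div_le_one (by positivity)]
    exact hm'
  have hsq : 0 < (1 / m : ℝ) ^ 2 := by positivity
  set δ := (x₀ - 1) / (x₀ + 1) with hδ
  have hδ0 : (1 / (3 * m) : ℝ) ^ 2 ≤ δ := by
    rw [hδ, le_div_iff₀ (by linarith)]
    have : (1 / (3 * m) : ℝ) ^ 2 = (1 / m) ^ 2 / 9 := by field_simp; norm_num
    rw [this]
    nlinarith
  have hδ1 : δ ≤ 1 := by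
    rw [hδ, div_le_one (by linarith)]; linarith
  let Q : ℝ[X] := ∑ j ∈ Finset.range m, C (b (2 * j + 1)) * X ^ j
  have hQeval (s : ℝ) : Q.eval s = ∑ j ∈ Finset.range m, b (2 * j + 1) * s ^ j := by
    simp [Q, eval_finsetSum]
  have hQ (s : ℝ) (hs : δ ≤ s) (hs1 : s ≤ 1) : |Q.eval s| ≤ 3 * m * M := by
    have hs0 : 0 < s := lt_of_lt_of_le (by positivity) (hδ0.trans hs)
    set t := √s with ht
    have ht0 : 1 / (3 * m) ≤ t := Real.le_sqrt_of_sq_le (hδ0.trans hs)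
    have ht0' : 0 < t := Real.sqrt_pos.2 hs0
    have ht1 : t ≤ 1 := Real.sqrt_le_one.2 hs1
    have hts : t ^ 2 = s := Real.sq_sqrt hs0.le
    have h1 := sum_odd_part b m t
    rw [hts, ← hQeval] at h1
    have h2 := h t ⟨by linarith, ht1⟩
    have h3 := h (-t) ⟨by linarith, by linarith⟩
    have h4 : |2 * t * Q.eval s| ≤ 2 * M := by
      rw [← h1]
      exact (abs_sub _ _).trans (by linarith)
    rw [abs_mul, abs_of_pos (by positivity : 0 < 2 * t)] at h4
    have h5 : 1 ≤ 3 * m * t := by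
      rw [div_le_iff₀ (by positivity)] at ht0
      linarith
    calc |Q.eval s| = 1 * |Q.eval s| := (one_mul _).symm
      _ ≤ 3 * m * t * |Q.eval s| := by gcongr
      _ = 3 * m * (t * |Q.eval s|) := by ring
      _ ≤ 3 * m * M := by gcongr; linarith
  let R : ℝ[X] := C (1 / (3 * m * M)) * Q.comp (C ((1 + δ) / 2) - C ((1 - δ) / 2) * X)
  have hReval (x : ℝ) : R.eval x = Q.eval ((1 + δ) / 2 - (1 - δ) / 2 * x) / (3 * m * M) := by
    simp [R, eval_comp]
    ring
  have hRdeg : R.degree ≤ m := by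
    refine degree_le_of_natDegree_le ?_
    refine (natDegree_C_mul_le _ _).trans (natDegree_comp_le.trans ?_)
    have h1 : Q.natDegree ≤ m := by
      refine natDegree_sum_le_of_forall_le _ _ fun j hj => ?_
      exact (natDegree_C_mul_X_pow_le _ _).trans (Finset.mem_range.1 hj).le
    have h2 : (C ((1 + δ) / 2) - C ((1 - δ) / 2) * X : ℝ[X]).natDegree ≤ 1 := by
      compute_degree
    nlinarith
  have hRb (x : ℝ) (hx : x ∈ Set.Icc (-1 : ℝ) 1) : |R.eval x| ≤ 1 := by
    rw [hReval, abs_div, abs_of_pos (by positivity : 0 < 3 * m * M), div_le_one (by positivity)]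
    refine hQ _ ?_ ?_
    · nlinarith [hx.1, hx.2]
    · nlinarith [hx.1, hx.2]
  have key := Polynomial.Chebyshev.eval_iterate_derivative_le_of_forall_abs_le_one (k := 0)
    (x := x₀) (Real.one_le_cosh _) hRdeg hRb
  simp only [Function.iterate_zero, id_eq] at key
  rw [hReval, hx₀, Polynomial.Chebyshev.T_real_cosh, ← hx₀] at key
  have hzero : (1 + δ) / 2 - (1 - δ) / 2 * x₀ = 0 := by
    have : x₀ + 1 ≠ 0 := by linarith
    rw [hδ]; field_simp; ring
  have hQ0 : Q.eval 0 = b 1 := by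
    rw [hQeval, Finset.sum_eq_single_of_mem 0 (Finset.mem_range.2 hm)]
    · simp
    · intro j _ hj; simp [hj]
  rw [hzero, hQ0, div_le_iff₀ (by positivity)] at key
  have h1 : ((m : ℤ) : ℝ) * (1 / m) = 1 := by
    push_cast; field_simp
  rw [h1] at key
  calc b 1 ≤ Real.cosh 1 * (3 * m * M) := key
    _ ≤ 2 * (3 * m * M) := by gcongr; exact cosh_one_le_two
    _ = 6 * m * M := by ring

/-- If a polynomial is bounded on `[-1, 1]` and all its coefficients are at most `A`, then its
linear coefficient is `O (1 + log A)`: on `[-1/2, 1/2]` the terms of degree above `O (1 + log A)`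
are negligible, and Bernstein's inequality applies to what is left. -/
lemma norm_coeff_one_le {F : ℕ → ℂ} {N : ℕ} {M A : ℝ} (hM : 0 ≤ M) (hA : 1 ≤ A)
    (hN : ∀ k, N ≤ k → F k = 0) (hFA : ∀ k, ‖F k‖ ≤ A)
    (hF : ∀ t : ℝ, |t| ≤ 1 → ‖∑ k ∈ Finset.range N, (t : ℂ) ^ k * F k‖ ≤ M) :
    ‖F 1‖ ≤ 24 * (M + 1) * (1 + Real.log A) := by
  have hlog : 0 ≤ Real.log A := Real.log_nonneg hA
  set m := ⌈Real.log A⌉₊ + 1 with hm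
  have hm1 : Real.log A + 1 ≤ m := by
    rw [hm]; push_cast; linarith [Nat.le_ceil (Real.log A)]
  have hm2 : (m : ℝ) ≤ Real.log A + 2 := by
    rw [hm]; push_cast; linarith [Nat.ceil_lt_add_one hlog]
  have hA4 : 2 * A ≤ 4 ^ m := by
    calc 2 * A ≤ Real.exp 1 * A := by
          gcongr; linarith [Real.add_one_le_exp (1 : ℝ)]
      _ = Real.exp (Real.log A + 1) := by
          rw [Real.exp_add, Real.exp_log (by linarith), mul_comm]
      _ ≤ Real.exp m := Real.exp_le_exp.2 hm1
      _ = Real.exp 1 ^ m := by rw [← Real.exp_nat_mul, mul_one]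
      _ ≤ 4 ^ m := by
          gcongr
          linarith [Real.exp_one_lt_d9]
  obtain ⟨w, hw, hwF⟩ : ∃ w : ℂ, ‖w‖ = 1 ∧ w * F 1 = ‖F 1‖ := by
    by_cases h : F 1 = 0
    · exact ⟨1, by simp, by simp [h]⟩
    · have hn : (‖F 1‖ : ℂ) ≠ 0 := by simpa using h
      refine ⟨conj (F 1) / ‖F 1‖, ?_, ?_⟩
      · rw [norm_div, RCLike.norm_conj, Complex.norm_real, norm_norm, div_self (by simpa using h)]
      · rw [div_mul_eq_mul_div, Complex.conj_mul', sq, mul_div_assoc, div_self hn, mul_one]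
  let b : ℕ → ℝ := fun k => (w * F k).re * (1 / 2) ^ k
  have hb : b 1 ≤ 6 * m * (M + 1) := by
    refine coeff_one_le_of_bounded (by omega) (by linarith) fun t ht => ?_
    have ht1 : |t| ≤ 1 := abs_le.2 ht
    have hbre : ∑ k ∈ Finset.range (2 * m), b k * t ^ k
        = (w * ∑ k ∈ Finset.range (2 * m), ((t / 2 : ℝ) : ℂ) ^ k * F k).re := by
      rw [Finset.mul_sum, Complex.re_sum]
      refine Finset.sum_congr rfl fun k _ => ?_
      rw [mul_left_comm, ← Complex.ofReal_pow, Complex.re_ofReal_mul]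
      simp only [b]
      rw [show (t / 2) ^ k = (1 / 2) ^ k * t ^ k by rw [← mul_pow]; ring]
      ring
    have htail : ‖∑ i ∈ Finset.range N, ((t / 2 : ℝ) : ℂ) ^ (2 * m + i) * F (2 * m + i)‖ ≤ 1 := by
      calc _ ≤ ∑ i ∈ Finset.range N, (1 / 4 : ℝ) ^ m * A * (1 / 2) ^ i := by
            refine norm_sum_le_of_le _ fun i _ => ?_
            rw [norm_mul, norm_pow, Complex.norm_real, Real.norm_eq_abs, pow_add, pow_mul]
            have h1 : |t / 2| ≤ 1 / 2 := by rw [abs_div, abs_two]; linarith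
            have h2 : |t / 2| ^ 2 ≤ 1 / 4 := by nlinarith [abs_nonneg (t / 2)]
            calc (|t / 2| ^ 2) ^ m * |t / 2| ^ i * ‖F (2 * m + i)‖
                ≤ (1 / 4) ^ m * (1 / 2) ^ i * A := by gcongr; exact hFA _
              _ = _ := by ring
        _ = (1 / 4 : ℝ) ^ m * A * ∑ i ∈ Finset.range N, (1 / 2 : ℝ) ^ i := by
            rw [Finset.mul_sum]
        _ ≤ (1 / 4 : ℝ) ^ m * A * 2 := by
            gcongr
            exact sum_geometric_two_le N
        _ = 2 * A / 4 ^ m := by rw [one_div, inv_pow]; ring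
        _ ≤ 1 := by rw [div_le_one (by positivity)]; exact hA4
    have hfull : ‖∑ k ∈ Finset.range (2 * m + N), ((t / 2 : ℝ) : ℂ) ^ k * F k‖ ≤ M := by
      have : ∑ k ∈ Finset.range (2 * m + N), ((t / 2 : ℝ) : ℂ) ^ k * F k
          = ∑ k ∈ Finset.range N, ((t / 2 : ℝ) : ℂ) ^ k * F k := by
        symm
        refine Finset.sum_subset (Finset.range_mono (by omega)) fun k _ hk => ?_
        rw [hN k (by simpa using hk), mul_zero]
      rw [this]
      exact hF _ (by rw [abs_div, abs_two]; linarith)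
    rw [Finset.sum_range_add] at hfull
    rw [hbre]
    refine (Complex.abs_re_le_norm _).trans ?_
    rw [norm_mul, hw, one_mul]
    have := norm_le_norm_add_norm_sub'
      (∑ k ∈ Finset.range (2 * m), ((t / 2 : ℝ) : ℂ) ^ k * F k)
      (∑ k ∈ Finset.range (2 * m), ((t / 2 : ℝ) : ℂ) ^ k * F k +
        ∑ i ∈ Finset.range N, ((t / 2 : ℝ) : ℂ) ^ (2 * m + i) * F (2 * m + i))
    rw [norm_sub_rev, add_sub_cancel_left] at this
    linarith
  have hb1 : b 1 = ‖F 1‖ / 2 := by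
    simp only [b, hwF, Complex.ofReal_re]
    ring
  rw [hb1] at hb
  have : 12 * m * (M + 1) ≤ 24 * (M + 1) * (1 + Real.log A) := by
    have : (m : ℝ) * (M + 1) ≤ (2 + 2 * Real.log A) * (M + 1) := by gcongr; linarith
    linarith
  linarith

/-! ### Riesz products and dissociated sets of characters -/

section Riesz

variable {G : Type*} [CommGroup G] [TopologicalSpace G] [IsTopologicalGroup G] [CompactSpace G]

/-- `h` has norm at most `A` in `A(G)`, expressed by duality: a functional bounded by `b` on
characters is bounded by `A * b` at `h`. -/
def ANormLE (h : C(G, ℂ)) (A : ℝ) : Prop :=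
  ∀ (ℓ : C(G, ℂ) →L[ℂ] ℂ) (b : ℝ), (∀ γ : PontryaginDual G, ‖ℓ (chi γ)‖ ≤ b) → ‖ℓ h‖ ≤ A * b

/-- Positivity of a functional, in the form: it preserves domination of a function by another
function with nonnegative real part. -/
def Dominating (I : C(G, ℂ) → ℂ) : Prop :=
  ∀ φ ψ : C(G, ℂ), (∀ x, ‖φ x‖ ≤ (ψ x).re) → ‖I φ‖ ≤ (I ψ).re

/-- A finite set `Λ` of characters is dissociated relative to `s` and `τ` if `s` is at most `τ` at
every product of powers `λ ^ m` with exponents `m ∈ {-1, 0, 1}`, not all zero. -/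
def Dissociated (s : PontryaginDual G → ℝ) (τ : ℝ) (Λ : Finset (PontryaginDual G)) : Prop :=
  ∀ m : PontryaginDual G → ℤ, (∀ l, |m l| ≤ 1) → (∃ l ∈ Λ, m l ≠ 0) → s (∏ l ∈ Λ, l ^ m l) ≤ τ

lemma Dissociated.subset {s : PontryaginDual G → ℝ} {τ : ℝ} {Λ Λ' : Finset (PontryaginDual G)}
    (h : Dissociated s τ Λ) (hsub : Λ' ⊆ Λ) : Dissociated s τ Λ' := by
  classical
  intro m hm ⟨l, hl, hml⟩
  have := h (fun l => if l ∈ Λ' then m l else 0)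
    (fun l => by split_ifs; exacts [hm l, by simp]) ⟨l, hsub hl, by simp [hl, hml]⟩
  rwa [← Finset.prod_subset hsub (fun l _ hl => by simp [hl]),
    Finset.prod_congr rfl (g := fun l => l ^ m l) (fun l hl => by simp [hl])] at this

/-- The function `x ↦ Re (ω γ(x))`, written as a combination of the characters `γ` and `γ⁻¹`. -/
noncomputable def cosChi (ω : ℂ) (γ : PontryaginDual G) : C(G, ℂ) :=
  (1 / 2 : ℂ) • (ω • chi γ + conj ω • chi γ⁻¹)

lemma cosChi_apply (ω : ℂ) (γ : PontryaginDual G) (x : G) :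
    cosChi ω γ x = ((ω * chi γ x).re : ℂ) := by
  rw [Complex.re_eq_add_conj, map_mul]
  simp only [cosChi, chi_inv, ContinuousMap.smul_apply, ContinuousMap.add_apply,
    ContinuousMap.star_apply, smul_eq_mul, Complex.star_def]
  ring

lemma chi_mul_cosChi_mul (ω : ℂ) (γ l : PontryaginDual G) (φ : C(G, ℂ)) :
    chi γ * (cosChi ω l * φ)
      = (ω / 2) • (chi (γ * l) * φ) + (conj ω / 2) • (chi (γ * l⁻¹) * φ) := by
  ext x
  simp only [cosChi, chi_mul, ContinuousMap.smul_apply, ContinuousMap.add_apply,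
    ContinuousMap.mul_apply, smul_eq_mul]
  ring

/-- The hypothesis that `J` dominates `I` on characters passes to the terms of Riesz products,
whatever the phases `ω` on the side of `I`. -/
lemma norm_apply_prod_cosChi_le {I J : C(G, ℂ) →L[ℂ] ℂ}
    (hIJ : ∀ γ : PontryaginDual G, ‖I (chi γ)‖ ≤ (J (chi γ)).re) {ω : PontryaginDual G → ℂ}
    (hω : ∀ l, ‖ω l‖ = 1) (Λ : Finset (PontryaginDual G)) (γ : PontryaginDual G) :
    ‖I (chi γ * ∏ l ∈ Λ, cosChi (ω l) l)‖ ≤ (J (chi γ * ∏ l ∈ Λ, cosChi 1 l)).re := by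
  classical
  induction Λ using Finset.induction_on generalizing γ with
  | empty => simpa using hIJ γ
  | insert l Λ hl ih =>
    rw [Finset.prod_insert hl, Finset.prod_insert hl, chi_mul_cosChi_mul, chi_mul_cosChi_mul,
      map_add, map_add, map_smul, map_smul, map_smul, map_smul, Complex.add_re]
    have h1 : ((1 : ℂ) / 2) = ((1 / 2 : ℝ) : ℂ) := by norm_num
    rw [map_one, h1, smul_eq_mul, smul_eq_mul, smul_eq_mul, smul_eq_mul, Complex.re_ofReal_mul,
      Complex.re_ofReal_mul]
    refine (norm_add_le _ _).trans (add_le_add ?_ ?_)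
    · rw [norm_mul, norm_div, hω, Complex.norm_ofNat]
      exact mul_le_mul_of_nonneg_left (ih _) (by norm_num)
    · rw [norm_mul, norm_div, RCLike.norm_conj, hω, Complex.norm_ofNat]
      exact mul_le_mul_of_nonneg_left (ih _) (by norm_num)

lemma chi_mul_one_add_cosChi_mul (γ l : PontryaginDual G) (φ : C(G, ℂ)) :
    chi γ * ((1 + cosChi 1 l) * φ)
      = chi γ * φ + ((1 / 2 : ℂ) • (chi (γ * l) * φ) + (1 / 2 : ℂ) • (chi (γ * l⁻¹) * φ)) := by
  rw [add_mul, one_mul, mul_add, chi_mul_cosChi_mul, map_one]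

lemma re_apply_chi_mul_insert {J : C(G, ℂ) →L[ℂ] ℂ} (γ l : PontryaginDual G) (φ : C(G, ℂ)) :
    (J (chi γ * ((1 + cosChi 1 l) * φ))).re
      = (J (chi γ * φ)).re
        + (1 / 2 * (J (chi (γ * l) * φ)).re + 1 / 2 * (J (chi (γ * l⁻¹) * φ)).re) := by
  have h1 : ((1 : ℂ) / 2) = ((1 / 2 : ℝ) : ℂ) := by norm_num
  rw [chi_mul_one_add_cosChi_mul, map_add, map_add, map_smul, map_smul, h1, smul_eq_mul,
    smul_eq_mul, Complex.add_re, Complex.add_re, Complex.re_ofReal_mul, Complex.re_ofReal_mul]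

lemma prod_insert_update {Λ : Finset (PontryaginDual G)} [DecidableEq (PontryaginDual G)]
    {l : PontryaginDual G} (hl : l ∉ Λ) (m : PontryaginDual G → ℤ) (e : ℤ) :
    ∏ k ∈ insert l Λ, k ^ (Function.update m l e) k = l ^ e * ∏ k ∈ Λ, k ^ m k := by
  rw [Finset.prod_insert hl, Function.update_self]
  congr 1
  refine Finset.prod_congr rfl fun k hk => ?_
  rw [Function.update_of_ne (by rintro rfl; exact hl hk)]

lemma abs_update_le [DecidableEq (PontryaginDual G)] {m : PontryaginDual G → ℤ}
    (hm : ∀ k, |m k| ≤ 1) (l : PontryaginDual G) {e : ℤ} (he : |e| ≤ 1) (k : PontryaginDual G) :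
    |Function.update m l e k| ≤ 1 := by
  by_cases h : k = l
  · rw [h, Function.update_self]; exact he
  · rw [Function.update_of_ne h]; exact hm k

lemma re_apply_chi_mul_prod_le {J : C(G, ℂ) →L[ℂ] ℂ} {s : PontryaginDual G → ℝ}
    (hJs : ∀ γ, (J (chi γ)).re = s γ) {τ : ℝ} (Λ : Finset (PontryaginDual G))
    (γ : PontryaginDual G)
    (h : ∀ m : PontryaginDual G → ℤ, (∀ l, |m l| ≤ 1) → s (γ * ∏ l ∈ Λ, l ^ m l) ≤ τ) :
    (J (chi γ * ∏ l ∈ Λ, (1 + cosChi 1 l))).re ≤ 2 ^ Λ.card * τ := by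
  classical
  induction Λ using Finset.induction_on generalizing γ with
  | empty =>
    have := h 0 (by simp)
    simpa [hJs] using this
  | insert l Λ hl ih =>
    rw [Finset.prod_insert hl, re_apply_chi_mul_insert, Finset.card_insert_of_notMem hl]
    have key (e : ℤ) (he : |e| ≤ 1) :
        (J (chi (γ * l ^ e) * ∏ l ∈ Λ, (1 + cosChi 1 l))).re ≤ 2 ^ Λ.card * τ := by
      refine ih _ fun m hm => ?_
      have := h (Function.update m l e) (abs_update_le hm l he)
      rwa [prod_insert_update hl, ← mul_assoc] at this
    have h0 := key 0 (by simp)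
    have h1 := key 1 (by simp)
    have h2 := key (-1) (by simp)
    rw [zpow_zero, mul_one] at h0
    rw [zpow_one] at h1
    rw [zpow_neg_one] at h2
    rw [pow_succ]
    linarith

/-- The mass of the Riesz product over a dissociated set is at most `1` up to the contribution of
its nonconstant terms, each of which is at most `τ`. -/
lemma re_apply_prod_one_add_cosChi_le {J : C(G, ℂ) →L[ℂ] ℂ} {s : PontryaginDual G → ℝ}
    (hJs : ∀ γ, (J (chi γ)).re = s γ) (hs1 : s 1 = 1) {τ : ℝ} (Λ : Finset (PontryaginDual G))
    (hΛ : Dissociated s τ Λ) :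
    (J (∏ l ∈ Λ, (1 + cosChi 1 l))).re ≤ 1 + (2 ^ Λ.card - 1) * τ := by
  classical
  induction Λ using Finset.induction_on with
  | empty =>
    have := hJs 1
    simp only [chi_one] at this
    simp [this, hs1]
  | insert l Λ hl ih =>
    have h0 := ih (hΛ.subset (Finset.subset_insert l Λ))
    have key (e : ℤ) (he : |e| ≤ 1) (he0 : e ≠ 0) :
        (J (chi (l ^ e) * ∏ l ∈ Λ, (1 + cosChi 1 l))).re ≤ 2 ^ Λ.card * τ := by
      refine re_apply_chi_mul_prod_le hJs Λ _ fun m hm => ?_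
      have := hΛ (Function.update m l e) (abs_update_le hm l he)
        ⟨l, Finset.mem_insert_self _ _, by simpa using he0⟩
      rwa [prod_insert_update hl] at this
    have h1 := key 1 (by simp) (by simp)
    have h2 := key (-1) (by simp) (by simp)
    rw [zpow_one] at h1
    rw [zpow_neg_one] at h2
    have h3 := re_apply_chi_mul_insert (J := J) 1 l (∏ l ∈ Λ, (1 + cosChi 1 l))
    rw [chi_one, one_mul, one_mul, one_mul, one_mul] at h3
    rw [Finset.prod_insert hl, h3, Finset.card_insert_of_notMem hl, pow_succ]
    linarith

lemma prod_one_add_smul_cosChi_apply (t : ℝ) (ω : PontryaginDual G → ℂ)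
    (Λ : Finset (PontryaginDual G)) (x : G) :
    (∏ l ∈ Λ, (1 + (t : ℂ) • cosChi (ω l) l)) x
      = ((∏ l ∈ Λ, (1 + t * (ω l * chi l x).re) : ℝ) : ℂ) := by
  rw [ContinuousMap.prod_apply, Complex.ofReal_prod]
  refine Finset.prod_congr rfl fun l _ => ?_
  rw [ContinuousMap.add_apply, ContinuousMap.smul_apply, cosChi_apply]
  simp

lemma riesz_nonneg {t : ℝ} (ht : |t| ≤ 1) {ω : PontryaginDual G → ℂ} (hω : ∀ l, ‖ω l‖ = 1)
    (Λ : Finset (PontryaginDual G)) (x : G) : 0 ≤ ∏ l ∈ Λ, (1 + t * (ω l * chi l x).re) := by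
  refine Finset.prod_nonneg fun l _ => ?_
  have h1 : |(ω l * chi l x).re| ≤ 1 := by
    refine (Complex.abs_re_le_norm _).trans ?_
    rw [norm_mul, hω, norm_chi_apply, one_mul]
  have h2 : |t * (ω l * chi l x).re| ≤ 1 := by
    rw [abs_mul]; exact mul_le_one₀ ht (abs_nonneg _) h1
  linarith [(abs_le.1 h2).1]

lemma apply_mul_prod_eq_sum (I : C(G, ℂ) →L[ℂ] ℂ) (h : C(G, ℂ)) (t : ℂ)
    (ω : PontryaginDual G → ℂ) (Λ : Finset (PontryaginDual G)) :
    I (h * ∏ l ∈ Λ, (1 + t • cosChi (ω l) l))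
      = ∑ k ∈ Finset.range (Λ.card + 1), t ^ k *
          ∑ Λ' ∈ Λ.powersetCard k, I (h * ∏ l ∈ Λ', cosChi (ω l) l) := by
  rw [Finset.prod_one_add, Finset.mul_sum, map_sum, Finset.sum_powerset]
  refine Finset.sum_congr rfl fun k _ => ?_
  rw [Finset.mul_sum]
  refine Finset.sum_congr rfl fun Λ' hΛ' => ?_
  rw [Finset.prod_smul, Finset.prod_const, (Finset.mem_powersetCard.1 hΛ').2, mul_smul_comm,
    map_smul, smul_eq_mul]

/-- All homogeneous parts of a Riesz product together are `O(1)` against any character. -/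
lemma sum_powerset_norm_le {I J : C(G, ℂ) →L[ℂ] ℂ} (hJ : Dominating J)
    (hIJ : ∀ γ : PontryaginDual G, ‖I (chi γ)‖ ≤ (J (chi γ)).re)
    {Λ : Finset (PontryaginDual G)} (hΛ : (J (∏ l ∈ Λ, (1 + cosChi 1 l))).re ≤ 2)
    {ω : PontryaginDual G → ℂ} (hω : ∀ l, ‖ω l‖ = 1)
    (γ : PontryaginDual G) :
    ∑ Λ' ∈ Λ.powerset, ‖I (chi γ * ∏ l ∈ Λ', cosChi (ω l) l)‖ ≤ 2 := by
  calc _ ≤ ∑ Λ' ∈ Λ.powerset, (J (chi γ * ∏ l ∈ Λ', cosChi 1 l)).re :=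
        Finset.sum_le_sum fun Λ' _ => norm_apply_prod_cosChi_le hIJ hω Λ' γ
    _ = (J (chi γ * ∏ l ∈ Λ, (1 + cosChi 1 l))).re := by
        rw [Finset.prod_one_add, Finset.mul_sum, map_sum, Complex.re_sum]
    _ ≤ ‖J (chi γ * ∏ l ∈ Λ, (1 + cosChi 1 l))‖ := Complex.re_le_norm _
    _ ≤ (J (∏ l ∈ Λ, (1 + cosChi 1 l))).re := by
        refine hJ _ _ fun x => ?_
        have h := prod_one_add_smul_cosChi_apply 1 (fun _ => 1) Λ x
        simp only [Complex.ofReal_one, one_smul] at h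
        rw [ContinuousMap.mul_apply, norm_mul, norm_chi_apply, one_mul, h, Complex.norm_real,
          Complex.ofReal_re, Real.norm_of_nonneg]
        exact riesz_nonneg (by simp) (by simp) Λ x
    _ ≤ 2 := hΛ

/-- The linear part of a Riesz product over a dissociated set pairs with a bounded function of
`A`-norm `A` to `O(1 + log A)`. -/
lemma norm_sum_apply_mul_cosChi_le {I J : C(G, ℂ) →L[ℂ] ℂ} (hI : Dominating I) (hJ : Dominating J)
    (hIJ : ∀ γ : PontryaginDual G, ‖I (chi γ)‖ ≤ (J (chi γ)).re)
    {Λ : Finset (PontryaginDual G)} (hΛ : (J (∏ l ∈ Λ, (1 + cosChi 1 l))).re ≤ 2)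
    {ω : PontryaginDual G → ℂ} (hω : ∀ l, ‖ω l‖ = 1)
    {h : C(G, ℂ)} (hh : ∀ x, ‖h x‖ ≤ 2) {A : ℝ} (hA : 1 ≤ A)
    (hhA : ANormLE h A) :
    ‖∑ l ∈ Λ, I (h * cosChi (ω l) l)‖ ≤ 120 * (1 + Real.log (2 * A)) := by
  set F : ℕ → ℂ := fun k => ∑ Λ' ∈ Λ.powersetCard k, I (h * ∏ l ∈ Λ', cosChi (ω l) l) with hFdef
  have hF1 : F 1 = ∑ l ∈ Λ, I (h * cosChi (ω l) l) := by
    simp only [hFdef, Finset.powersetCard_one, Finset.sum_map]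
    simp
  have hN : ∀ k, Λ.card + 1 ≤ k → F k = 0 := fun k hk => by
    simp only [hFdef]
    rw [Finset.powersetCard_eq_empty.2 (by omega), Finset.sum_empty]
  have hFA : ∀ k, ‖F k‖ ≤ 2 * A := by
    intro k
    let ℓ : C(G, ℂ) →L[ℂ] ℂ := ∑ Λ' ∈ Λ.powersetCard k,
      I.comp ((ContinuousLinearMap.mul ℂ C(G, ℂ)).flip (∏ l ∈ Λ', cosChi (ω l) l))
    have hℓ (φ : C(G, ℂ)) : ℓ φ
        = ∑ Λ' ∈ Λ.powersetCard k, I (φ * ∏ l ∈ Λ', cosChi (ω l) l) := by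
      simp [ℓ, mul_comm φ]
    have := hhA ℓ 2 fun γ => by
      rw [hℓ]
      refine (norm_sum_le _ _).trans
        (le_trans ?_ (sum_powerset_norm_le hJ hIJ hΛ hω γ))
      refine Finset.sum_le_sum_of_subset_of_nonneg ?_ fun _ _ _ => norm_nonneg _
      intro Λ' hΛ'
      exact Finset.mem_powerset.2 (Finset.mem_powersetCard.1 hΛ').1
    rw [hℓ] at this
    linarith
  have hFt : ∀ t : ℝ, |t| ≤ 1 →
      ‖∑ k ∈ Finset.range (Λ.card + 1), (t : ℂ) ^ k * F k‖ ≤ 4 := by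
    intro t ht
    rw [← apply_mul_prod_eq_sum I h t ω Λ]
    set p : C(G, ℂ) := ∏ l ∈ Λ, (1 + (t : ℂ) • cosChi (ω l) l) with hp
    have h1 : ‖I (h * p)‖ ≤ (I ((2 : ℂ) • p)).re := by
      refine hI _ _ fun x => ?_
      have hpos := riesz_nonneg ht hω Λ x
      rw [ContinuousMap.mul_apply, norm_mul, ContinuousMap.smul_apply, hp,
        prod_one_add_smul_cosChi_apply, Complex.norm_real, Real.norm_of_nonneg hpos, smul_eq_mul,
        show (2 : ℂ) = ((2 : ℝ) : ℂ) by norm_num, Complex.re_ofReal_mul, Complex.ofReal_re]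
      exact mul_le_mul_of_nonneg_right (hh x) hpos
    have h2 : ‖I p‖ ≤ 2 := by
      have h3 := apply_mul_prod_eq_sum I 1 t ω Λ
      rw [one_mul, ← hp] at h3
      have h4 := sum_powerset_norm_le hJ hIJ hΛ hω 1
      rw [Finset.sum_powerset] at h4
      refine le_trans ?_ h4
      rw [h3, chi_one]
      refine norm_sum_le_of_le _ fun k _ => ?_
      rw [norm_mul, norm_pow, Complex.norm_real, Real.norm_eq_abs]
      calc |t| ^ k * _ ≤ 1 * _ := by
            gcongr
            exact pow_le_one₀ (abs_nonneg t) ht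
        _ ≤ _ := by
            rw [one_mul]
            exact norm_sum_le _ _
    rw [map_smul, smul_eq_mul, show (2 : ℂ) = ((2 : ℝ) : ℂ) by norm_num,
      Complex.re_ofReal_mul] at h1
    linarith [Complex.re_le_norm (I p)]
  have := norm_coeff_one_le (by norm_num) (by linarith) hN hFA hFt
  rw [hF1] at this
  linarith

/-- The coefficients, relative to `I`, of a bounded function at the characters of a dissociated set
have a sum of order `1 + log A`, where `A` bounds the norm of the function in `A(G)`. In particular,
at most `O(η⁻¹ (1 + log A))` of them are larger than `η`. -/
lemma sum_norm_apply_mul_chi_le {I J : C(G, ℂ) →L[ℂ] ℂ} (hI : Dominating I) (hJ : Dominating J)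
    (hIJ : ∀ γ : PontryaginDual G, ‖I (chi γ)‖ ≤ (J (chi γ)).re)
    {Λ : Finset (PontryaginDual G)} (hΛ : (J (∏ l ∈ Λ, (1 + cosChi 1 l))).re ≤ 2)
    {h : C(G, ℂ)} (hh : ∀ x, ‖h x‖ ≤ 2) {A : ℝ} (hA : 1 ≤ A) (hhA : ANormLE h A) :
    ∑ l ∈ Λ, ‖I (h * chi l)‖ ≤ 240 * (1 + Real.log (2 * A)) := by
  have hex (l : PontryaginDual G) : ∃ w : ℂ, ‖w‖ = 1 ∧ w * I (h * chi l) = ‖I (h * chi l)‖ := by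
    by_cases h0 : I (h * chi l) = 0
    · exact ⟨1, by simp, by simp [h0]⟩
    · have hn : (‖I (h * chi l)‖ : ℂ) ≠ 0 := by simpa using h0
      refine ⟨conj (I (h * chi l)) / ‖I (h * chi l)‖, ?_, ?_⟩
      · rw [norm_div, RCLike.norm_conj, Complex.norm_real, norm_norm, div_self (by simpa using h0)]
      · rw [div_mul_eq_mul_div, Complex.conj_mul', sq, mul_div_assoc, div_self hn, mul_one]
  choose ω hω hωI using hex
  have h1 := norm_sum_apply_mul_cosChi_le hI hJ hIJ hΛ hω hh hA hhA
  have h2 := norm_sum_apply_mul_cosChi_le hI hJ hIJ hΛ (ω := fun l => Complex.I * ω l)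
    (fun l => by simp [hω]) hh hA hhA
  -- the phases `ω` and `i ω` together isolate the coefficients at `λ` from those at `λ⁻¹`
  have key : ((∑ l ∈ Λ, ‖I (h * chi l)‖ : ℝ) : ℂ) = ∑ l ∈ Λ, I (h * cosChi (ω l) l)
      - Complex.I * ∑ l ∈ Λ, I (h * cosChi (Complex.I * ω l) l) := by
    rw [Complex.ofReal_sum, Finset.mul_sum, ← Finset.sum_sub_distrib]
    refine Finset.sum_congr rfl fun l _ => ?_
    rw [← hωI l]
    simp only [cosChi, mul_smul_comm, mul_add, map_smul, map_add, smul_eq_mul, map_mul,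
      Complex.conj_I]
    linear_combination ((1 / 2) * ω l * I (h * chi l)
      - (1 / 2) * conj (ω l) * I (h * chi l⁻¹)) * Complex.I_sq
  have h3 : ∑ l ∈ Λ, ‖I (h * chi l)‖ = ‖((∑ l ∈ Λ, ‖I (h * chi l)‖ : ℝ) : ℂ)‖ := by
    rw [Complex.norm_real, Real.norm_of_nonneg (Finset.sum_nonneg fun _ _ => norm_nonneg _)]
  rw [h3, key]
  refine (norm_sub_le _ _).trans ?_
  rw [norm_mul, Complex.norm_I, one_mul]
  linarith

end Riesz

/-! ### Choice of a dyadic scale -/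

/-- Dyadic pigeonholing with unequal weights. The weight `2 ^ j / n + 1` of the scale `2 ^ (-j)`
charges the number of scales only to the first term: the second one, which is summable over `j`
after division by `2 ^ j`, will bound the number of iterations without a logarithmic loss. -/
lemma exists_dyadic_scale {ι : Type*} {m u : ι → ℝ} {U : Set ι} {A e : ℝ} {n : ℕ} (hn : 0 < n)
    (hm : ∀ i, 0 ≤ m i) (hms : Summable m) (hmA : ∑' i, m i ≤ A) (hu : ∀ i, 0 ≤ u i)
    (hu2 : ∀ i, u i ≤ 2) (he : 0 < e) (hnA : 4 * A ≤ e * 2 ^ n)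
    (h : e ≤ ∑' i, U.indicator (fun i => m i * u i) i) :
    ∃ j < n, e / 12 * (2 ^ j / n + 1) ≤ ∑' i, (U ∩ {i | 1 ≤ 2 ^ j * u i}).indicator m i := by
  by_contra! hcon
  have hsum (V : Set ι) : Summable (V.indicator m) := hms.indicator V
  -- a dyadic upper bound for `u`
  have hpt (i : ι) : U.indicator (fun i => m i * u i) i ≤ m i * (2 * (1 / 2) ^ n)
      + ∑ j ∈ Finset.range n, 2 * (1 / 2) ^ j * (U ∩ {i | 1 ≤ 2 ^ j * u i}).indicator m i := by
    have hnn (j : ℕ) : 0 ≤ 2 * (1 / 2) ^ j * (U ∩ {i | 1 ≤ 2 ^ j * u i}).indicator m i :=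
      mul_nonneg (by positivity) (Set.indicator_nonneg (fun i _ => hm i) i)
    by_cases hi : i ∈ U
    swap
    · rw [Set.indicator_of_notMem hi]
      exact add_nonneg (mul_nonneg (hm i) (by positivity)) (Finset.sum_nonneg fun j _ => hnn j)
    rw [Set.indicator_of_mem hi]
    by_cases hex : ∃ j, j < n ∧ 1 ≤ 2 ^ j * u i
    · classical
      set j := Nat.find hex
      obtain ⟨hjn, hj⟩ := Nat.find_spec hex
      have hle : u i ≤ 2 * (1 / 2) ^ j := by
        rcases Nat.eq_zero_or_pos j with h0 | h0
        · rw [h0]; simpa using hu2 i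
        · have h1 := Nat.find_min hex (show j - 1 < j by omega)
          push Not at h1
          have h2 := h1 (by omega)
          have h3 : (2 : ℝ) ^ j = 2 * 2 ^ (j - 1) := by
            rw [← pow_succ']; congr 1; omega
          rw [one_div, inv_pow, h3, mul_inv, mul_inv_cancel_left₀ (by norm_num)]
          rw [← one_div, le_div_iff₀ (by positivity)]
          linarith
      calc m i * u i ≤ 2 * (1 / 2) ^ j * (U ∩ {i | 1 ≤ 2 ^ j * u i}).indicator m i := by
            rw [Set.indicator_of_mem (show i ∈ U ∩ {i | 1 ≤ 2 ^ j * u i} from ⟨hi, hj⟩), mul_comm]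
            exact mul_le_mul_of_nonneg_right hle (hm i)
        _ ≤ ∑ j ∈ Finset.range n, 2 * (1 / 2) ^ j * (U ∩ {i | 1 ≤ 2 ^ j * u i}).indicator m i :=
            Finset.single_le_sum (f := fun j : ℕ => 2 * (1 / 2 : ℝ) ^ j *
              (U ∩ {i | 1 ≤ 2 ^ j * u i}).indicator m i) (fun j _ => hnn j)
              (Finset.mem_range.2 hjn)
        _ ≤ _ := le_add_of_nonneg_left (mul_nonneg (hm i) (by positivity))
    · push Not at hex
      have h1 := hex (n - 1) (by omega)
      have h3 : (2 : ℝ) ^ n = 2 * 2 ^ (n - 1) := by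
        rw [← pow_succ']; congr 1; omega
      have hle : u i ≤ 2 * (1 / 2) ^ n := by
        rw [one_div, inv_pow, h3, mul_inv, mul_inv_cancel_left₀ (by norm_num), ← one_div,
          le_div_iff₀ (by positivity)]
        linarith
      refine le_trans (mul_le_mul_of_nonneg_left hle (hm i)) ?_
      exact le_add_of_nonneg_right (Finset.sum_nonneg fun j _ => hnn j)
  have hs1 : Summable fun i => m i * (2 * (1 / 2 : ℝ) ^ n) := hms.mul_right _
  have hs2 : Summable fun i => ∑ j ∈ Finset.range n,
      2 * (1 / 2 : ℝ) ^ j * (U ∩ {i | 1 ≤ 2 ^ j * u i}).indicator m i :=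
    summable_sum fun j _ => (hsum _).mul_left _
  have hs0 : Summable (U.indicator fun i => m i * u i) := by
    refine Summable.of_nonneg_of_le (fun i => ?_) hpt (hs1.add hs2)
    exact Set.indicator_nonneg (fun i _ => mul_nonneg (hm i) (hu i)) i
  have h1 : ∑' i, U.indicator (fun i => m i * u i) i ≤ A * (2 * (1 / 2) ^ n)
      + ∑ j ∈ Finset.range n, 2 * (1 / 2) ^ j *
        ∑' i, (U ∩ {i | 1 ≤ 2 ^ j * u i}).indicator m i := by
    refine (Summable.tsum_le_tsum hpt hs0 (hs1.add hs2)).trans ?_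
    rw [hs1.tsum_add hs2, tsum_mul_right,
      Summable.tsum_finsetSum fun j _ => (hsum _).mul_left _]
    simp_rw [tsum_mul_left]
    gcongr
  have h2 : ∑ j ∈ Finset.range n, 2 * (1 / 2 : ℝ) ^ j *
        ∑' i, (U ∩ {i | 1 ≤ 2 ^ j * u i}).indicator m i
      < ∑ j ∈ Finset.range n, 2 * (1 / 2 : ℝ) ^ j * (e / 12 * (2 ^ j / n + 1)) := by
    refine Finset.sum_lt_sum_of_nonempty (Finset.nonempty_range_iff.2 hn.ne') fun j hj => ?_
    exact mul_lt_mul_of_pos_left (hcon j (Finset.mem_range.1 hj)) (by positivity)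
  have h3 : ∑ j ∈ Finset.range n, 2 * (1 / 2 : ℝ) ^ j * (e / 12 * (2 ^ j / n + 1))
      = e / 6 * (1 + ∑ j ∈ Finset.range n, (1 / 2 : ℝ) ^ j) := by
    have hn' : (n : ℝ) ≠ 0 := by exact_mod_cast hn.ne'
    have : ∀ j ∈ Finset.range n, 2 * (1 / 2 : ℝ) ^ j * (e / 12 * (2 ^ j / n + 1))
        = e / 6 * (1 / n) + e / 6 * (1 / 2) ^ j := by
      intro j _
      have : (1 / 2 : ℝ) ^ j * 2 ^ j = 1 := by rw [← mul_pow]; norm_num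
      linear_combination (e / 6 / n) * this
    rw [Finset.sum_congr rfl this, Finset.sum_add_distrib, Finset.sum_const,
      Finset.card_range, nsmul_eq_mul, ← Finset.mul_sum]
    field_simp
  have h4 : ∑ j ∈ Finset.range n, (1 / 2 : ℝ) ^ j ≤ 2 := sum_geometric_two_le n
  have h5 : A * (2 * (1 / 2) ^ n) ≤ e / 2 := by
    rw [one_div, inv_pow, ← mul_assoc, ← div_eq_mul_inv, div_le_iff₀ (by positivity)]
    linarith
  have h6 : e / 6 * (1 + ∑ j ∈ Finset.range n, (1 / 2 : ℝ) ^ j) ≤ e / 2 := by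
    have : e / 6 * (1 + ∑ j ∈ Finset.range n, (1 / 2 : ℝ) ^ j) ≤ e / 6 * (1 + 2) := by gcongr
    linarith
  linarith

/-! ### Maximal dissociated sets -/

section Maximal

variable {G : Type*} [CommGroup G] [TopologicalSpace G] [IsTopologicalGroup G] [CompactSpace G]

/-- If the dissociated subsets of `S` with at most `L` elements have at most `K < L` elements, then
a maximal one exists, and every element of `S` is a product of powers `λ ^ m`, `m ∈ {-1, 0, 1}`,
of its elements, up to inversion and up to a character at which `s` is large. -/
lemma exists_maximal_dissociated {s : PontryaginDual G → ℝ} {τ : ℝ} {S : Set (PontryaginDual G)}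
    {K : ℝ} {L : ℕ} (hKL : K + 1 ≤ L)
    (hbound : ∀ Λ : Finset (PontryaginDual G), (Λ : Set (PontryaginDual G)) ⊆ S →
      Dissociated s τ Λ → Λ.card ≤ L → (Λ.card : ℝ) ≤ K) :
    ∃ Λ : Finset (PontryaginDual G), (Λ.card : ℝ) ≤ K ∧ ∀ γ ∈ S,
      γ ∈ Λ ∨ ∃ (e : ℤ) (m : PontryaginDual G → ℤ), |e| = 1 ∧ (∀ l, |m l| ≤ 1) ∧
        τ < s (γ ^ e * ∏ l ∈ Λ, l ^ m l) := by
  classical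
  have hbound' : ∀ Λ : Finset (PontryaginDual G), (Λ : Set (PontryaginDual G)) ⊆ S →
      Dissociated s τ Λ → (Λ.card : ℝ) ≤ K := by
    intro Λ hΛS hΛ
    by_cases hc : Λ.card ≤ L
    · exact hbound Λ hΛS hΛ hc
    · obtain ⟨Λ', hΛ', hcard⟩ := Finset.exists_subset_card_eq (not_le.1 hc).le
      have := hbound Λ' ((Finset.coe_subset.2 hΛ').trans hΛS) (hΛ.subset hΛ') hcard.le
      rw [hcard] at this
      linarith
  let P : ℕ → Prop := fun n => ∃ Λ : Finset (PontryaginDual G),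
    (Λ : Set (PontryaginDual G)) ⊆ S ∧ Dissociated s τ Λ ∧ Λ.card = n
  have hP0 : P 0 := ⟨∅, by simp, fun m _ ⟨l, hl, _⟩ => absurd hl (Finset.notMem_empty l), rfl⟩
  obtain ⟨Λ, hΛS, hΛ, hcard⟩ := Nat.findGreatest_spec (P := P) (Nat.zero_le ⌊K⌋₊) hP0
  refine ⟨Λ, hbound' Λ hΛS hΛ, fun γ hγ => ?_⟩
  by_contra! hcon
  obtain ⟨hγΛ, hcon⟩ := hcon
  have hins : Dissociated s τ (insert γ Λ) := by
    intro m hm ⟨l, hl, hml⟩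
    rw [Finset.prod_insert hγΛ]
    by_cases h0 : m γ = 0
    · rw [h0, zpow_zero, one_mul]
      refine hΛ m hm ⟨l, ?_, hml⟩
      rcases Finset.mem_insert.1 hl with rfl | h
      · exact absurd h0 hml
      · exact h
    · exact hcon (m γ) m (le_antisymm (hm γ) (Int.one_le_abs h0)) hm
  have hinsS : ((insert γ Λ : Finset (PontryaginDual G)) : Set (PontryaginDual G)) ⊆ S := by
    rw [Finset.coe_insert]
    exact Set.insert_subset hγ hΛS
  have hle : (insert γ Λ).card ≤ ⌊K⌋₊ := Nat.le_floor (hbound' _ hinsS hins)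
  have := Nat.le_findGreatest hle (show P _ from ⟨_, hinsS, hins, rfl⟩)
  rw [Finset.card_insert_of_notMem hγΛ] at this
  omega

lemma norm_one_sub_mul_le {z w : ℂ} (hz : ‖z‖ = 1) : ‖1 - z * w‖ ≤ ‖1 - z‖ + ‖1 - w‖ := by
  calc ‖1 - z * w‖ = ‖(1 - z) + z * (1 - w)‖ := by congr 1; ring
    _ ≤ ‖1 - z‖ + ‖z * (1 - w)‖ := norm_add_le _ _
    _ = ‖1 - z‖ + ‖1 - w‖ := by rw [norm_mul, hz, one_mul]

lemma norm_one_sub_chi_inv (γ : PontryaginDual G) (x : G) :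
    ‖1 - chi γ⁻¹ x‖ = ‖1 - chi γ x‖ := by
  rw [chi_inv, ContinuousMap.star_apply, Complex.star_def, ← RCLike.norm_conj, map_sub, map_one,
    Complex.conj_conj]

lemma norm_one_sub_chi_mul_le (γ γ' : PontryaginDual G) (x : G) :
    ‖1 - chi (γ * γ') x‖ ≤ ‖1 - chi γ x‖ + ‖1 - chi γ' x‖ := by
  rw [chi_mul, ContinuousMap.mul_apply]
  exact norm_one_sub_mul_le (norm_chi_apply γ x)

lemma norm_one_sub_chi_zpow_le {e : ℤ} (he : |e| ≤ 1) (γ : PontryaginDual G) (x : G) :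
    ‖1 - chi (γ ^ e) x‖ ≤ ‖1 - chi γ x‖ := by
  obtain rfl | rfl | rfl : e = -1 ∨ e = 0 ∨ e = 1 := by
    rw [abs_le] at he; omega
  · rw [zpow_neg_one, norm_one_sub_chi_inv]
  · rw [zpow_zero, chi_one]; simp
  · rw [zpow_one]

lemma norm_one_sub_chi_prod_le {m : PontryaginDual G → ℤ} (hm : ∀ l, |m l| ≤ 1)
    (Λ : Finset (PontryaginDual G)) (x : G) :
    ‖1 - chi (∏ l ∈ Λ, l ^ m l) x‖ ≤ ∑ l ∈ Λ, ‖1 - chi l x‖ := by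
  classical
  induction Λ using Finset.induction_on with
  | empty => rw [Finset.prod_empty, chi_one]; simp
  | insert l Λ hl ih =>
    rw [Finset.prod_insert hl, Finset.sum_insert hl]
    exact (norm_one_sub_chi_mul_le _ _ x).trans
      (add_le_add (norm_one_sub_chi_zpow_le (hm l) l x) ih)

/-- A character is nearly trivial wherever the elements of `Λ` and a product of it with powers of
elements of `Λ` are. -/
lemma norm_one_sub_chi_le_of_combination {e : ℤ} (he : |e| = 1) {m : PontryaginDual G → ℤ}
    (hm : ∀ l, |m l| ≤ 1) (Λ : Finset (PontryaginDual G)) (γ : PontryaginDual G) (x : G) :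
    ‖1 - chi γ x‖ ≤ ‖1 - chi (γ ^ e * ∏ l ∈ Λ, l ^ m l) x‖ + ∑ l ∈ Λ, ‖1 - chi l x‖ := by
  have h1 : γ = (γ ^ e) ^ e := by
    rw [← zpow_mul]
    obtain rfl | rfl : e = 1 ∨ e = -1 := by
      rcases abs_eq (by norm_num : (0 : ℤ) ≤ 1) |>.1 he with h | h <;> simp [h]
    · simp
    · simp
  have h2 : γ ^ e = (γ ^ e * ∏ l ∈ Λ, l ^ m l) * (∏ l ∈ Λ, l ^ m l)⁻¹ := by
    rw [mul_inv_cancel_right]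
  calc ‖1 - chi γ x‖ ≤ ‖1 - chi (γ ^ e) x‖ := by
        conv_lhs => rw [h1]
        exact norm_one_sub_chi_zpow_le he.le _ x
    _ ≤ ‖1 - chi (γ ^ e * ∏ l ∈ Λ, l ^ m l) x‖ + ‖1 - chi (∏ l ∈ Λ, l ^ m l)⁻¹ x‖ := by
        conv_lhs => rw [h2]
        exact norm_one_sub_chi_mul_le _ _ x
    _ ≤ _ := by
        rw [norm_one_sub_chi_inv]
        gcongr
        exact norm_one_sub_chi_prod_le hm Λ x

end Maximal

/-! ### Absolutely convergent Fourier series -/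

section ASeries

variable {G : Type*} [CommGroup G] [TopologicalSpace G] [IsTopologicalGroup G] [CompactSpace G]
  [MeasurableSpace G] [BorelSpace G]
  {f : C(G, ℂ)} {a : PontryaginDual G → ℂ} {A : ℝ}

lemma aNormLE_of_hasSum (ha : Summable fun γ => ‖a γ‖) (hf : HasSum (fun γ => a γ • chi γ) f)
    (hA : ∑' γ, ‖a γ‖ ≤ A) : ANormLE f A := by
  intro ℓ b hb
  have hb0 : 0 ≤ b := (norm_nonneg _).trans (hb 1)
  have h1 : HasSum (fun γ => a γ * ℓ (chi γ)) (ℓ f) := by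
    simpa using hf.mapL ℓ
  have h2 : Summable fun γ => ‖a γ‖ * b := ha.mul_right b
  have h3 := tsum_of_norm_bounded (f := fun γ => a γ * ℓ (chi γ)) h2.hasSum fun γ => by
    rw [norm_mul]
    exact mul_le_mul_of_nonneg_left (hb γ) (norm_nonneg _)
  rw [h1.tsum_eq, tsum_mul_right] at h3
  exact h3.trans (mul_le_mul_of_nonneg_right hA hb0)

lemma ANormLE.star {h : C(G, ℂ)} (hh : ANormLE h A) : ANormLE (star h) A := by
  intro ℓ b hb
  let ℓ' : C(G, ℂ) →L[ℂ] ℂ := LinearMap.mkContinuous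
    { toFun := fun φ => conj (ℓ (Star.star φ))
      map_add' := fun φ ψ => by simp
      map_smul' := fun c φ => by simp } ‖ℓ‖ fun φ => by
        change ‖conj (ℓ (Star.star φ))‖ ≤ _
        rw [RCLike.norm_conj, ← norm_star φ]
        exact ℓ.le_opNorm _
  have hℓ (φ : C(G, ℂ)) : ‖ℓ' φ‖ = ‖ℓ (Star.star φ)‖ := RCLike.norm_conj _
  have := hh ℓ' b fun γ => by
    rw [hℓ, ← chi_inv]
    exact hb _
  rwa [hℓ] at this

lemma ANormLE.sub_avg {h : C(G, ℂ)} (hh : ANormLE h A) (ν : Measure G) [IsProbabilityMeasure ν] :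
    ANormLE (h - avg ν h) (2 * A) := by
  intro ℓ b hb
  have hb0 : 0 ≤ b := (norm_nonneg _).trans (hb 1)
  have := hh (ℓ.comp (ContinuousLinearMap.id ℂ C(G, ℂ) - avg ν)) (2 * b) fun γ => by
    have h1 : (ℓ.comp (ContinuousLinearMap.id ℂ C(G, ℂ) - avg ν)) (chi γ)
        = (1 - avg ν (chi γ) 1) * ℓ (chi γ) := by
      simp only [ContinuousLinearMap.comp_apply, sub_apply,
        ContinuousLinearMap.id_apply, map_sub]
      rw [avg_chi, map_smul, smul_eq_mul, ← avg_chi]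
      ring
    rw [h1, norm_mul]
    have h2 : ‖avg ν (chi γ) 1‖ ≤ 1 := norm_avg_apply_le ν (fun x => (norm_chi_apply γ x).le) 1
    have h3 : ‖1 - avg ν (chi γ) 1‖ ≤ 2 := by
      refine (norm_sub_le _ _).trans ?_
      rw [norm_one]
      linarith
    exact mul_le_mul h3 (hb γ) (norm_nonneg _) (by norm_num)
  calc ‖ℓ (h - avg ν h)‖ ≤ A * (2 * b) := this
    _ = 2 * A * b := by ring

end ASeries

/-! ### The increment step -/

section Step

variable {G : Type*} [CommGroup G] [TopologicalSpace G] [IsTopologicalGroup G] [CompactSpace G]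
  [MeasurableSpace G] [BorelSpace G]

/-- The characters which are constant up to `ν` on the Bohr set `B(Γ, r)`. -/
def captured (ν : ℝ) (Γ : Finset (PontryaginDual G)) (r : ℝ) : Set (PontryaginDual G) :=
  {γ | ∀ x ∈ bohrSet Γ r, ‖1 - chi γ x‖ ≤ ν}

/-- The part of the `ℓ¹` norm of `a` carried by characters which are not captured by `B(Γ, r)`. -/
noncomputable def uncapturedMass (a : PontryaginDual G → ℂ) (ν : ℝ)
    (Γ : Finset (PontryaginDual G)) (r : ℝ) : ℝ :=
  ∑' γ, (captured ν Γ r)ᶜ.indicator (fun γ => ‖a γ‖) γ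

lemma uncapturedMass_nonneg (a : PontryaginDual G → ℂ) (ν : ℝ)
    (Γ : Finset (PontryaginDual G)) (r : ℝ) : 0 ≤ uncapturedMass a ν Γ r :=
  tsum_nonneg fun γ => Set.indicator_nonneg (fun _ _ => norm_nonneg _) γ

lemma captured_mono {ν : ℝ} {Γ Γ' : Finset (PontryaginDual G)} {r r' : ℝ} (hΓ : Γ ⊆ Γ')
    (hr : r' ≤ r) : captured ν Γ r ⊆ captured ν Γ' r' :=
  fun _ h x hx => h x (bohrSet_mono hΓ hr hx)

lemma uncapturedMass_le_sub {a : PontryaginDual G → ℂ} (ha : Summable fun γ => ‖a γ‖) {ν : ℝ}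
    {Γ Γ' : Finset (PontryaginDual G)} {r r' : ℝ} (hΓ : Γ ⊆ Γ') (hr : r' ≤ r)
    {S : Set (PontryaginDual G)} (hS : S ⊆ captured ν Γ' r') :
    uncapturedMass a ν Γ' r' ≤ uncapturedMass a ν Γ r
      - ∑' γ, ((captured ν Γ r)ᶜ ∩ S).indicator (fun γ => ‖a γ‖) γ := by
  rw [le_sub_iff_add_le, uncapturedMass, uncapturedMass,
    ← (ha.indicator _).tsum_add (ha.indicator _)]
  refine Summable.tsum_le_tsum (fun γ => ?_) ((ha.indicator _).add (ha.indicator _))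
    (ha.indicator _)
  by_cases h1 : γ ∈ captured ν Γ' r'
  · rw [Set.indicator_of_notMem (show γ ∉ (captured ν Γ' r')ᶜ from fun h => h h1), zero_add]
    exact Set.indicator_le_indicator_of_subset Set.inter_subset_left (fun _ => norm_nonneg _) γ
  · have h2 : γ ∉ captured ν Γ r := fun h => h1 (captured_mono hΓ hr h)
    rw [Set.indicator_of_notMem (show γ ∉ (captured ν Γ r)ᶜ ∩ S from fun h => h1 (hS h.2)),
      Set.indicator_of_mem (show γ ∈ (captured ν Γ' r')ᶜ from h1),
      Set.indicator_of_mem (show γ ∈ (captured ν Γ r)ᶜ from h2), add_zero]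

variable {f : C(G, ℂ)} {a : PontryaginDual G → ℂ} {A ε ν : ℝ}

/-- A large local `L²` norm of `g = f - f ∗ β` forces correlation of `g`, with respect to the
functional `I`, with uncaptured characters: expand one of the two factors of `|g|²`. -/
lemma le_tsum_uncaptured (ha : Summable fun γ => ‖a γ‖) (hf : HasSum (fun γ => a γ • chi γ) f)
    (hA : ∑' γ, ‖a γ‖ ≤ A) (hν : 0 ≤ ν) (hνA : 32 * (ν * A) ≤ ε ^ 2)
    {I : C(G, ℂ) →L[ℂ] ℂ} {β : Measure G} [IsProbabilityMeasure β]
    (hu2 : ∀ γ : PontryaginDual G, ‖I (star (f - avg β f) * chi γ)‖ ≤ 2)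
    {S : Set (PontryaginDual G)} (hS : ∀ γ ∈ S, ‖1 - avg β (chi γ) 1‖ ≤ ν)
    (hI : ε ^ 2 / 2 ≤ ‖I (star (f - avg β f) * (f - avg β f))‖) :
    ε ^ 2 / 5 ≤ ∑' γ, Sᶜ.indicator
      (fun γ => ‖a γ‖ * ‖I (star (f - avg β f) * chi γ)‖) γ := by
  set g := f - avg β f with hg
  set u : PontryaginDual G → ℝ := fun γ => ‖I (star g * chi γ)‖ with hu
  let ℓ : C(G, ℂ) →L[ℂ] ℂ := (I.comp (ContinuousLinearMap.mul ℂ C(G, ℂ) (star g))).comp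
    (ContinuousLinearMap.id ℂ C(G, ℂ) - avg β)
  have hℓ (φ : C(G, ℂ)) : ℓ φ = I (star g * (φ - avg β φ)) := by simp [ℓ, mul_sub]
  have hℓχ (γ : PontryaginDual G) :
      ℓ (chi γ) = (1 - avg β (chi γ) 1) * I (star g * chi γ) := by
    rw [hℓ, avg_chi, mul_sub, map_sub, mul_smul_comm, map_smul, smul_eq_mul]
    rw [← avg_chi]
    ring
  have h1 : HasSum (fun γ => a γ * ℓ (chi γ)) (ℓ f) := by simpa using hf.mapL ℓ
  have hs1 : Summable (Sᶜ.indicator fun γ => ‖a γ‖ * u γ) := by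
    refine Summable.indicator (Summable.of_nonneg_of_le (fun γ => by positivity)
      (fun γ => ?_) (ha.mul_right 2)) _
    exact mul_le_mul_of_nonneg_left (hu2 γ) (norm_nonneg _)
  have h3 := tsum_of_norm_bounded (f := fun γ => a γ * ℓ (chi γ))
    ((ha.mul_right (2 * ν)).add (hs1.mul_left 2)).hasSum fun γ => by
      rw [norm_mul, hℓχ, norm_mul]
      have hu0 : 0 ≤ u γ := norm_nonneg _
      by_cases hγ : γ ∈ S
      · rw [Set.indicator_of_notMem (show γ ∉ Sᶜ from fun h => h hγ), mul_zero, add_zero]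
        calc ‖a γ‖ * (‖1 - avg β (chi γ) 1‖ * u γ) ≤ ‖a γ‖ * (ν * 2) := by
              gcongr
              · exact hS γ hγ
              · exact hu2 γ
          _ = _ := by ring
      · rw [Set.indicator_of_mem (show γ ∈ Sᶜ from hγ)]
        have h4 : ‖1 - avg β (chi γ) 1‖ ≤ 2 := by
          refine (norm_sub_le _ _).trans ?_
          rw [norm_one]
          linarith [norm_avg_apply_le β (fun x => (norm_chi_apply γ x).le) 1]
        calc ‖a γ‖ * (‖1 - avg β (chi γ) 1‖ * u γ) ≤ ‖a γ‖ * (2 * u γ) := by gcongr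
          _ = 0 + 2 * (‖a γ‖ * u γ) := by ring
          _ ≤ _ := by gcongr; positivity
  rw [h1.tsum_eq, hℓ, (ha.mul_right _).tsum_add (hs1.mul_left 2), tsum_mul_right,
    tsum_mul_left] at h3
  have h5 : (∑' γ, ‖a γ‖) * (2 * ν) ≤ A * (2 * ν) := by gcongr
  have := hI.trans h3
  nlinarith [sq_nonneg ε]

variable (μ : Measure G) [μ.IsHaarMeasure] [IsProbabilityMeasure μ]

set_option maxHeartbeats 400000 in
/-- One step of the iteration. Either the required `L²` approximation holds for a Bohr
set of width comparable to `δ₀`, or adjoining few characters and shrinking the width by a factor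
polynomial in all parameters captures a definite amount of the mass of the Fourier transform. -/
theorem approx_or_increment (ha : Summable fun γ => ‖a γ‖)
    (hf : HasSum (fun γ => a γ • chi γ) f) (hf1 : ∀ x, ‖f x‖ ≤ 1) (hA : ∑' γ, ‖a γ‖ ≤ A)
    (hA1 : 1 ≤ A) (hε : 0 < ε) (hε1 : ε ≤ 1) (hν : 0 < ν) (hν1 : ν ≤ 1)
    (hνA : 32 * (ν * A) ≤ ε ^ 2) {n L : ℕ} (hn : 0 < n) (hnA : 20 * A ≤ ε ^ 2 * 2 ^ n)
    (hL : Even L) (hLn : 2 ^ n * (240 * (1 + Real.log (4 * A))) + 1 ≤ L)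
    {Γ : Finset (PontryaginDual G)} (hΓ : Γ.Nonempty) {δ₀ : ℝ} (hδ₀ : 0 < δ₀) (hδ₀1 : δ₀ ≤ 1) :
    (∃ δ δ' : ℝ, δ₀ / 2 ≤ δ ∧ δ ≤ δ₀ ∧ ε * δ₀ / (128 * Γ.card) ≤ δ' ∧ δ' < δ ∧
      ∃ _ : IsProbabilityMeasure (bohrMeasure μ Γ δ),
      (∀ x, ∀ y ∈ bohrSet Γ δ',
        ‖avg (bohrMeasure μ Γ δ) f (x * y) - avg (bohrMeasure μ Γ δ) f x‖ ≤ ε) ∧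
      ∀ x, ∫ y, ‖f (x * y) - avg (bohrMeasure μ Γ δ) f (x * y)‖ ^ 2 ∂(bohrMeasure μ Γ δ')
        ≤ ε ^ 2) ∨
    ∃ Γ' : Finset (PontryaginDual G), ∃ j : ℕ, Γ ⊆ Γ' ∧
      (Γ'.card : ℝ) ≤ Γ.card + 2 ^ j * (240 * (1 + Real.log (4 * A))) ∧
      uncapturedMass a ν Γ' (ν * ε * δ₀ / (32768 * Γ.card ^ 3 * L)) ≤
        uncapturedMass a ν Γ δ₀ - ε ^ 2 / 60 * (2 ^ j / n + 1) := by
  classical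
  have hd : (1 : ℝ) ≤ Γ.card := by exact_mod_cast hΓ.card_pos
  set d : ℝ := (Γ.card : ℝ) with hd_def
  have hlog : 0 ≤ Real.log (4 * A) := Real.log_nonneg (by linarith)
  have hL1 : (1 : ℝ) ≤ L := by
    have : 0 ≤ 2 ^ n * (240 * (1 + Real.log (4 * A))) := by positivity
    linarith
  -- the width of the Bohr set used for the averaging
  obtain ⟨δ, hδ_lo, hδ_hi, hδreg⟩ := exists_regular_width μ hΓ hδ₀ (κ := ε / 8) (by linarith)
    (by linarith)
  set s₁ := ε * δ₀ / (64 * d) with hs₁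
  have hs₁' : ε / 8 * δ₀ / (8 * d) = s₁ := by rw [hs₁]; field_simp; norm_num
  rw [hs₁'] at hδ_hi hδreg
  have hs₁0 : 0 < s₁ := by positivity
  have hs₁1 : s₁ ≤ δ₀ / 64 := by
    rw [hs₁, div_le_div_iff₀ (by positivity) (by norm_num)]
    nlinarith
  have hδ0 : 0 < δ := by linarith
  -- the width of the Bohr neighbourhoods
  obtain ⟨δ', hδ'_lo, hδ'_hi, hδ'reg⟩ := exists_regular_width μ hΓ hs₁0 (κ := 1) one_pos le_rfl
  set ρ := s₁ / (8 * d) with hρ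
  rw [one_mul] at hδ'_hi hδ'reg
  rw [one_add_one_eq_two] at hδ'reg
  have hρ0 : 0 < ρ := by positivity
  have hδ'0 : 0 < δ' := by linarith
  -- the width of the Bohr set used for smoothing
  obtain ⟨t, ht_lo, ht_hi, htreg⟩ := exists_regular_width μ hΓ (r := ρ / L) (by positivity)
    (κ := ν / 8) (by linarith) (by linarith)
  set τ := ν * ε * δ₀ / (32768 * d ^ 3 * L) with hτ
  have hτ' : ν / 8 * (ρ / L) / (8 * d) = τ := by
    rw [hτ, hρ, hs₁]; field_simp; norm_num
  rw [hτ'] at ht_hi htreg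
  have hτ0 : 0 < τ := by positivity
  have ht0 : 0 < t := by
    have : 0 < ρ / L := by positivity
    linarith
  have iβ : IsProbabilityMeasure (bohrMeasure μ Γ δ) := isProbabilityMeasure_bohrMeasure μ Γ hδ0
  have iσ : IsProbabilityMeasure (bohrMeasure μ Γ t) := isProbabilityMeasure_bohrMeasure μ Γ ht0
  have iν : IsProbabilityMeasure (bohrMeasure μ Γ (δ' + ρ)) :=
    isProbabilityMeasure_bohrMeasure μ Γ (by linarith)
  set β := bohrMeasure μ Γ δ with hβ
  set σ := bohrMeasure μ Γ t with hσ
  by_cases hcase : ∀ x, ∫ y, ‖f (x * y) - avg β f (x * y)‖ ^ 2 ∂(bohrMeasure μ Γ δ') ≤ ε ^ 2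
  · refine Or.inl ⟨δ, δ', hδ_lo, by linarith, ?_, by linarith, iβ, ?_, hcase⟩
    · refine le_trans (le_of_eq ?_) hδ'_lo
      rw [hs₁]; field_simp; norm_num
    · intro x y hy
      have := norm_avg_mul_sub_le μ Γ hδ0 hδreg
        (bohrSet_mono subset_rfl (by linarith) hy) hf1 x
      linarith
  right
  push Not at hcase
  obtain ⟨x, hx⟩ := hcase
  set g := f - avg β f with hg
  have hg2 : ∀ y, ‖g y‖ ≤ 2 := fun y => by
    refine (norm_sub_le _ _).trans ?_
    linarith [hf1 y, norm_avg_apply_le β hf1 y]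
  -- the smoothed averaging functional at `x` and its positive definite majorant
  let I : C(G, ℂ) →L[ℂ] ℂ := (ContinuousMap.evalCLM ℂ x).comp
    ((avg σ ^ L).comp (avg (bohrMeasure μ Γ (δ' + ρ))))
  let J : C(G, ℂ) →L[ℂ] ℂ := (ContinuousMap.evalCLM ℂ (1 : G)).comp (avg σ ^ L)
  have hIapp (φ : C(G, ℂ)) : I φ = (avg σ ^ L) (avg (bohrMeasure μ Γ (δ' + ρ)) φ) x := rfl
  have hJapp (φ : C(G, ℂ)) : J φ = (avg σ ^ L) φ 1 := rfl
  have hIdom : Dominating I := fun φ ψ h =>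
    norm_avg_pow_le_re σ L (fun y => norm_avg_le_re_avg _ h y) x
  have hJdom : Dominating J := fun φ ψ h => norm_avg_pow_le_re σ L h 1
  set c : PontryaginDual G → ℝ := fun γ => (avg σ (chi γ) 1).re with hc
  have hcc (γ : PontryaginDual G) : (c γ : ℂ) = avg σ (chi γ) 1 :=
    avg_bohrMeasure_chi_real μ Γ γ
  set s : PontryaginDual G → ℝ := fun γ => |c γ| with hs
  have hJχ (γ : PontryaginDual G) : (J (chi γ)).re = s γ ^ L := by
    rw [hJapp, avg_pow_chi, ContinuousMap.smul_apply, ← hcc, chi_apply, map_one, Circle.coe_one,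
      smul_eq_mul, mul_one, ← Complex.ofReal_pow, Complex.ofReal_re, hL.pow_abs]
  have hIχ (γ : PontryaginDual G) : ‖I (chi γ)‖ ≤ (J (chi γ)).re := by
    rw [hIapp, avg_chi, map_smul, avg_pow_chi, hJχ, ContinuousMap.smul_apply,
      ContinuousMap.smul_apply, ← hcc, norm_smul, norm_smul, norm_pow, norm_chi_apply, mul_one,
      Complex.norm_real, Real.norm_eq_abs]
    refine mul_le_of_le_one_left (by positivity) ?_
    exact norm_avg_apply_le _ (fun y => (norm_chi_apply γ y).le) 1
  have hI1 : I 1 = 1 := by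
    rw [hIapp, avg_one, ← chi_one, avg_pow_chi, chi_one, avg_one]
    simp
  have hJ1 : s 1 ^ L = 1 := by
    have : c 1 = 1 := by simp only [hc, chi_one, avg_one]; simp
    simp [hs, this]
  have hu2 : ∀ γ : PontryaginDual G, ‖I (star g * chi γ)‖ ≤ 2 := fun γ => by
    have := hIdom (star g * chi γ) ((2 : ℂ) • 1) fun y => by
      rw [ContinuousMap.mul_apply, norm_mul, norm_chi_apply, mul_one, ContinuousMap.star_apply,
        norm_star]
      simpa using hg2 y
    rw [map_smul, hI1] at this
    simpa using this
  -- the energy of `g` at `x`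
  have henergy : ε ^ 2 / 2 ≤ ‖I (star g * g)‖ := by
    refine le_trans ?_ (Complex.re_le_norm _)
    rw [hIapp]
    refine le_re_avg_pow μ Γ L fun u hu => ?_
    have hu' : u ∈ bohrSet Γ ρ := bohrSet_mono subset_rfl (by
      have : t ≤ ρ / L := by linarith
      rw [le_div_iff₀ (by linarith)] at this
      linarith) hu
    have h1 := integral_bohrMeasure_le_two_mul μ Γ hδ'0 hρ0.le hδ'reg
      (F := fun z => ‖g (x * z)‖ ^ 2) (by fun_prop) (fun z => by positivity) hu'
    have h2 : (avg (bohrMeasure μ Γ (δ' + ρ)) (star g * g) (x * u)).re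
        = ∫ z, ‖g (x * (u * z))‖ ^ 2 ∂(bohrMeasure μ Γ (δ' + ρ)) := by
      have h3 : ∀ z, (star g * g) (x * u * z) = ((‖g (x * (u * z))‖ ^ 2 : ℝ) : ℂ) := fun z => by
        rw [ContinuousMap.mul_apply, ContinuousMap.star_apply, Complex.star_def, Complex.conj_mul',
          mul_assoc]
        push_cast
        rfl
      rw [avg_apply]
      simp_rw [h3]
      rw [integral_complex_ofReal, Complex.ofReal_re]
    rw [h2]
    have h4 : ∫ y, ‖f (x * y) - avg β f (x * y)‖ ^ 2 ∂(bohrMeasure μ Γ δ')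
        = ∫ z, ‖g (x * z)‖ ^ 2 ∂(bohrMeasure μ Γ δ') := rfl
    rw [h4] at hx
    linarith
  have hcap : ∀ γ ∈ captured ν Γ δ₀, ‖1 - avg β (chi γ) 1‖ ≤ ν := by
    intro γ hγ
    have h1 : 1 - avg β (chi γ) 1 = ∫ z, (1 - chi γ z) ∂β := by
      rw [integral_sub (integrable_const _) (integrable_of_continuousMap β (map_continuous _)),
        avg_apply]
      simp
    rw [h1]
    have := norm_integral_le_of_norm_le_const (μ := β) (C := ν) (f := fun z => 1 - chi γ z) (by
      filter_upwards [bohrMeasure_ae_mem μ Γ δ] with z hz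
      exact hγ z (bohrSet_mono subset_rfl (by linarith) hz))
    simpa using this
  have hsum := le_tsum_uncaptured ha hf hA hν.le hνA hu2 hcap henergy
  obtain ⟨j, hjn, hj⟩ := exists_dyadic_scale hn (fun γ => norm_nonneg (a γ)) ha hA
    (fun γ => norm_nonneg _) hu2 (by positivity) (by linarith) hsum
  -- the large spectrum, and a maximal dissociated subset of it
  set S : Set (PontryaginDual G) := {γ | 1 ≤ 2 ^ j * ‖I (star g * chi γ)‖} with hS
  have hANorm : ANormLE (star g) (2 * A) := ((aNormLE_of_hasSum ha hf hA).sub_avg β).star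
  have hbound : ∀ Λ : Finset (PontryaginDual G), (Λ : Set (PontryaginDual G)) ⊆ S →
      Dissociated s (1 / 2) Λ → Λ.card ≤ L →
      (Λ.card : ℝ) ≤ 2 ^ j * (240 * (1 + Real.log (4 * A))) := by
    intro Λ hΛS hΛ hΛL
    have hΛ' : Dissociated (fun γ => s γ ^ L) ((1 / 2) ^ Λ.card) Λ := fun m hm hex => by
      calc s (∏ l ∈ Λ, l ^ m l) ^ L ≤ (1 / 2) ^ L :=
            pow_le_pow_left₀ (abs_nonneg _) (hΛ m hm hex) L
        _ ≤ (1 / 2) ^ Λ.card := pow_le_pow_of_le_one (by norm_num) (by norm_num) hΛL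
    have h1 := re_apply_prod_one_add_cosChi_le hJχ hJ1 Λ hΛ'
    have h2 : (1 : ℝ) + (2 ^ Λ.card - 1) * (1 / 2) ^ Λ.card ≤ 2 := by
      have h3 : (2 : ℝ) ^ Λ.card * (1 / 2) ^ Λ.card = 1 := by rw [← mul_pow]; norm_num
      have h4 : (0 : ℝ) < (1 / 2) ^ Λ.card := by positivity
      linarith
    have h5 := sum_norm_apply_mul_chi_le hIdom hJdom hIχ (h1.trans h2) (h := star g)
      (fun y => by rw [ContinuousMap.star_apply, norm_star]; exact hg2 y) (by linarith) hANorm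
    rw [show 2 * (2 * A) = 4 * A by ring] at h5
    calc (Λ.card : ℝ) = ∑ l ∈ Λ, (1 : ℝ) := by simp
      _ ≤ ∑ l ∈ Λ, 2 ^ j * ‖I (star g * chi l)‖ := Finset.sum_le_sum fun l hl => hΛS hl
      _ = 2 ^ j * ∑ l ∈ Λ, ‖I (star g * chi l)‖ := by rw [Finset.mul_sum]
      _ ≤ _ := by gcongr
  have hKL : 2 ^ j * (240 * (1 + Real.log (4 * A))) + 1 ≤ (L : ℝ) := by
    refine le_trans ?_ hLn
    gcongr
    norm_num
  obtain ⟨Λ, hΛcard, hΛmax⟩ := exists_maximal_dissociated hKL hbound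
  have hτδ₀ : τ ≤ δ₀ := by
    have h1 : t + τ ≤ ρ := ht_hi.trans (div_le_self hρ0.le hL1)
    linarith
  refine ⟨Γ ∪ Λ, j, Finset.subset_union_left, ?_, ?_⟩
  · have : ((Γ ∪ Λ).card : ℝ) ≤ Γ.card + Λ.card := by exact_mod_cast Finset.card_union_le Γ Λ
    linarith
  · have hScap : S ⊆ captured ν (Γ ∪ Λ) τ := by
      intro γ hγ y hy
      have hyΛ : ∀ l ∈ Λ, ‖1 - chi l y‖ ≤ 2 * Real.pi * τ := fun l hl =>
        (norm_one_sub_le_circleVal (l y)).trans (by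
          have := hy l (Finset.mem_union_right _ hl)
          gcongr)
      have hτs : L * (2 * Real.pi * τ) ≤ ν / 2 := by
        have h1 : L * (2 * Real.pi * τ) = Real.pi / 4 * (ν * ε * δ₀) / (4096 * d ^ 3) := by
          rw [hτ]; field_simp; norm_num
        rw [h1, div_le_div_iff₀ (by positivity) (by norm_num)]
        have h2 : Real.pi / 4 ≤ 1 := by linarith [Real.pi_le_four]
        have h3 : 1 ≤ d ^ 3 := one_le_pow₀ hd
        have h4 : ε * δ₀ ≤ 1 := mul_le_one₀ hε1 hδ₀.le hδ₀1
        have h5 : ν * ε * δ₀ ≤ ν := by rw [mul_assoc]; exact mul_le_of_le_one_right hν.le h4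
        have h6 : Real.pi / 4 * (ν * ε * δ₀) ≤ 1 * ν := by gcongr
        calc Real.pi / 4 * (ν * ε * δ₀) * 2 ≤ ν * 2 := by linarith
          _ ≤ ν * (4096 * d ^ 3) := mul_le_mul_of_nonneg_left (by linarith) hν.le
      have hL1' : 2 * Real.pi * τ ≤ L * (2 * Real.pi * τ) :=
        le_mul_of_one_le_left (by positivity) hL1
      rcases hΛmax γ hγ with h | ⟨e, m, he, hm, hlarge⟩
      · linarith [hyΛ γ h]
      · set γ' := γ ^ e * ∏ l ∈ Λ, l ^ m l with hγ'
        have h1 := norm_one_sub_chi_le_of_combination he hm Λ γ y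
        rw [← hγ'] at h1
        have hΛL : (Λ.card : ℝ) ≤ L := by linarith
        have h2 : ∑ l ∈ Λ, ‖1 - chi l y‖ ≤ ν / 2 := by
          calc _ ≤ ∑ _l ∈ Λ, 2 * Real.pi * τ := Finset.sum_le_sum hyΛ
            _ = Λ.card * (2 * Real.pi * τ) := by simp
            _ ≤ L * (2 * Real.pi * τ) := by gcongr
            _ ≤ ν / 2 := hτs
        -- a character with a large coefficient is nearly constant on the narrow Bohr set
        have h3 : ‖1 - chi γ' y‖ ≤ ν / 2 := by
          have h4 := norm_avg_mul_sub_le μ Γ ht0 htreg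
            (bohrSet_mono Finset.subset_union_left le_rfl hy)
            (fun z => (norm_chi_apply γ' z).le) 1
          rw [avg_chi, ContinuousMap.smul_apply, ContinuousMap.smul_apply, ← hcc γ', one_mul,
            ← smul_sub, norm_smul, Complex.norm_real, Real.norm_eq_abs, norm_sub_rev, chi_apply,
            map_one, Circle.coe_one] at h4
          have h5 : 1 / 2 * ‖1 - chi γ' y‖ ≤ |c γ'| * ‖1 - chi γ' y‖ := by
            gcongr
          have h6 : |c γ'| * ‖1 - chi γ' y‖ ≤ 2 * (ν / 8) := h4
          linarith
        linarith
    refine (uncapturedMass_le_sub ha Finset.subset_union_left hτδ₀ hScap).trans ?_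
    have : ε ^ 2 / 5 / 12 = ε ^ 2 / 60 := by ring
    rw [this] at hj
    linarith

end Step

/-! ### The iteration -/

section Iteration

variable {G : Type*} [CommGroup G] [TopologicalSpace G] [IsTopologicalGroup G] [CompactSpace G]
  [MeasurableSpace G] [BorelSpace G]
  {f : C(G, ℂ)} {a : PontryaginDual G → ℂ} {A ε ν : ℝ}
  (μ : Measure G) [μ.IsHaarMeasure] [IsProbabilityMeasure μ]

/-- The two approximation properties of `f` by `f ∗ β_{Γ, δ}` on translates of `B(Γ, δ')`. -/
def IsApprox (f : C(G, ℂ)) (ε : ℝ) (Γ : Finset (PontryaginDual G)) (δ δ' : ℝ) : Prop :=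
  ∃ _ : IsProbabilityMeasure (bohrMeasure μ Γ δ),
    (∀ x, ∀ y ∈ bohrSet Γ δ',
      ‖avg (bohrMeasure μ Γ δ) f (x * y) - avg (bohrMeasure μ Γ δ) f x‖ ≤ ε) ∧
    ∀ x, ∫ y, ‖f (x * y) - avg (bohrMeasure μ Γ δ) f (x * y)‖ ^ 2 ∂(bohrMeasure μ Γ δ') ≤ ε ^ 2

/-- The increment step is iterated. The rank and the logarithm of the width are paid for by
the uncaptured mass, at the rates `K₁` and `K₂`, so that `D` and `E` stay valid bounds. Each step
uses up mass `ε ^ 2 / 60`, so that `N` bounds the number of steps. -/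
lemma exists_isApprox_of_budget (ha : Summable fun γ => ‖a γ‖)
    (hf : HasSum (fun γ => a γ • chi γ) f) (hf1 : ∀ x, ‖f x‖ ≤ 1) (hA : ∑' γ, ‖a γ‖ ≤ A)
    (hA1 : 1 ≤ A) (hε : 0 < ε) (hε1 : ε ≤ 1) (hν : 0 < ν) (hν1 : ν ≤ 1)
    (hνA : 32 * (ν * A) ≤ ε ^ 2) {n L : ℕ} (hn : 0 < n) (hnA : 20 * A ≤ ε ^ 2 * 2 ^ n)
    (hL : Even L) (hLn : 2 ^ n * (240 * (1 + Real.log (4 * A))) + 1 ≤ L)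
    {K₁ K₂ D E : ℝ} (hK₁ : K₁ = 60 * n * (240 * (1 + Real.log (4 * A))) / ε ^ 2)
    (hK₂0 : 0 ≤ K₂) (hK₂ : Real.log (32768 * D ^ 3 * L / (ν * ε)) ≤ K₂ * (ε ^ 2 / 60)) (N : ℕ) :
    ∀ (Γ : Finset (PontryaginDual G)) (δ₀ : ℝ), Γ.Nonempty → 0 < δ₀ → δ₀ ≤ 1 →
      Γ.card + K₁ * uncapturedMass a ν Γ δ₀ ≤ D →
      Real.log δ₀⁻¹ + K₂ * uncapturedMass a ν Γ δ₀ ≤ E →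
      uncapturedMass a ν Γ δ₀ ≤ N * (ε ^ 2 / 60) →
      ∃ (Γ' : Finset (PontryaginDual G)) (δ δ' : ℝ), Γ'.Nonempty ∧ 0 < δ ∧ δ ≤ 1 ∧
        (Γ'.card : ℝ) ≤ D ∧ Real.log δ⁻¹ ≤ E + 1 ∧ ε * δ / (128 * Γ'.card) ≤ δ' ∧ δ' < δ ∧
        IsApprox μ f ε Γ' δ δ' := by
  have hlog : 0 ≤ Real.log (4 * A) := Real.log_nonneg (by linarith)
  have hn' : (0 : ℝ) < n := by exact_mod_cast hn
  have hK₁0 : 0 ≤ K₁ := by rw [hK₁]; positivity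
  have hLpos : (1 : ℝ) ≤ L := by
    have : 0 ≤ 2 ^ n * (240 * (1 + Real.log (4 * A))) := by positivity
    linarith
  have hterm (Γ : Finset (PontryaginDual G)) (δ₀ δ δ' : ℝ) (hΓ : Γ.Nonempty) (hδ₀ : 0 < δ₀)
      (hδ₀1 : δ₀ ≤ 1) (hD : Γ.card + K₁ * uncapturedMass a ν Γ δ₀ ≤ D)
      (hE : Real.log δ₀⁻¹ + K₂ * uncapturedMass a ν Γ δ₀ ≤ E) (hδ1 : δ₀ / 2 ≤ δ) (hδ2 : δ ≤ δ₀)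
      (hδ' : ε * δ₀ / (128 * Γ.card) ≤ δ') (hδ'δ : δ' < δ) (h : IsApprox μ f ε Γ δ δ') :
      ∃ (Γ' : Finset (PontryaginDual G)) (δ δ' : ℝ), Γ'.Nonempty ∧ 0 < δ ∧ δ ≤ 1 ∧
        (Γ'.card : ℝ) ≤ D ∧ Real.log δ⁻¹ ≤ E + 1 ∧ ε * δ / (128 * Γ'.card) ≤ δ' ∧ δ' < δ ∧
        IsApprox μ f ε Γ' δ δ' := by
    have hU0 := uncapturedMass_nonneg a ν Γ δ₀
    have h1 := mul_nonneg hK₁0 hU0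
    have h2 := mul_nonneg hK₂0 hU0
    have h3 : Real.log δ⁻¹ ≤ Real.log 2 + Real.log δ₀⁻¹ := by
      rw [← Real.log_mul (by norm_num) (by positivity)]
      refine Real.log_le_log (inv_pos.2 (by linarith)) ?_
      rw [← div_eq_mul_inv, ← inv_div]
      exact inv_anti₀ (by positivity) hδ1
    refine ⟨Γ, δ, δ', hΓ, by linarith, by linarith, by linarith, ?_, ?_, hδ'δ, h⟩
    · linarith [Real.log_two_lt_d9]
    · refine le_trans ?_ hδ'
      gcongr
  induction N with
  | zero =>
    intro Γ δ₀ hΓ hδ₀ hδ₀1 hD hE hU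
    have hU0 := uncapturedMass_nonneg a ν Γ δ₀
    rcases approx_or_increment μ ha hf hf1 hA hA1 hε hε1 hν hν1 hνA hn hnA hL hLn hΓ hδ₀ hδ₀1 with
      ⟨δ, δ', hδ1, hδ2, hδ', hδ'δ, h⟩ | ⟨Γ', j, -, -, hmass⟩
    · exact hterm Γ δ₀ δ δ' hΓ hδ₀ hδ₀1 hD hE hδ1 hδ2 hδ' hδ'δ h
    · have h1 := (uncapturedMass_nonneg a ν Γ' _).trans hmass
      have h2 : 0 < ε ^ 2 / 60 * (2 ^ j / n + 1) := by positivity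
      push_cast at hU
      linarith
  | succ N ih =>
    intro Γ δ₀ hΓ hδ₀ hδ₀1 hD hE hU
    have hU0 := uncapturedMass_nonneg a ν Γ δ₀
    rcases approx_or_increment μ ha hf hf1 hA hA1 hε hε1 hν hν1 hνA hn hnA hL hLn hΓ hδ₀ hδ₀1 with
      ⟨δ, δ', hδ1, hδ2, hδ', hδ'δ, h⟩ | ⟨Γ', j, hΓΓ', hcard, hmass⟩
    · exact hterm Γ δ₀ δ δ' hΓ hδ₀ hδ₀1 hD hE hδ1 hδ2 hδ' hδ'δ h
    · have hd : (1 : ℝ) ≤ Γ.card := by exact_mod_cast hΓ.card_pos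
      have hdD : (Γ.card : ℝ) ≤ D := by
        have := mul_nonneg hK₁0 hU0
        linarith
      set δ₁ := ν * ε * δ₀ / (32768 * (Γ.card : ℝ) ^ 3 * L) with hδ₁
      have hδ₁0 : 0 < δ₁ := by positivity
      have hstep1 : ε ^ 2 / 60 ≤ ε ^ 2 / 60 * (2 ^ j / n + 1) :=
        le_mul_of_one_le_right (by positivity) (by
          have : (0 : ℝ) ≤ 2 ^ j / n := by positivity
          linarith)
      refine ih Γ' δ₁ (hΓ.mono hΓΓ') hδ₁0 ?_ ?_ ?_ ?_
      · rw [hδ₁, div_le_one (by positivity)]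
        have h1 : ν * ε * δ₀ ≤ 1 := mul_le_one₀ (mul_le_one₀ hν1 hε.le hε1) hδ₀.le hδ₀1
        have h2 : (1 : ℝ) ≤ (Γ.card : ℝ) ^ 3 := one_le_pow₀ hd
        nlinarith
      · have h1 : K₁ * uncapturedMass a ν Γ' δ₁ ≤ K₁ * (uncapturedMass a ν Γ δ₀
            - ε ^ 2 / 60 * (2 ^ j / n + 1)) := by gcongr
        have h2 : K₁ * (ε ^ 2 / 60 * (2 ^ j / n + 1))
            = 2 ^ j * (240 * (1 + Real.log (4 * A))) + K₁ * (ε ^ 2 / 60) := by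
          rw [hK₁]; field_simp
        have h3 : 0 ≤ K₁ * (ε ^ 2 / 60) := by positivity
        linarith
      · have h1 : K₂ * uncapturedMass a ν Γ' δ₁ ≤ K₂ * (uncapturedMass a ν Γ δ₀
            - ε ^ 2 / 60) := by gcongr; linarith
        have h2 : Real.log δ₁⁻¹ ≤ Real.log δ₀⁻¹ + Real.log (32768 * D ^ 3 * L / (ν * ε)) := by
          have hD0 : 0 < D := by linarith
          rw [← Real.log_mul (by positivity) (by positivity)]
          refine Real.log_le_log (by positivity) ?_
          rw [hδ₁, inv_div, div_le_iff₀ (by positivity)]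
          have h3 : δ₀⁻¹ * (32768 * D ^ 3 * L / (ν * ε)) * (ν * ε * δ₀) = 32768 * D ^ 3 * L := by
            field_simp
          rw [h3]
          gcongr
        linarith
      · push_cast at hU
        linarith

lemma le_exp_pow {k : ℕ} {c : ℝ} (hc : c ≤ 2.7 ^ k) {ℓ : ℝ} (hℓ : 1 ≤ ℓ) :
    c ≤ Real.exp ℓ ^ k := by
  refine hc.trans (pow_le_pow_left₀ (by norm_num) ?_ k)
  linarith [Real.exp_one_gt_d9, Real.exp_le_exp.2 hℓ]

/-- The approximation theorem for a function bounded by `1` with an absolutely convergent Fourier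
series. -/
theorem exists_isApprox (ha : Summable fun γ => ‖a γ‖)
    (hf : HasSum (fun γ => a γ • chi γ) f) (hf1 : ∀ x, ‖f x‖ ≤ 1) (hA : ∑' γ, ‖a γ‖ ≤ A)
    (hA1 : 1 ≤ A) (hε : 0 < ε) (hε1 : ε ≤ 1) :
    ∃ (Γ : Finset (PontryaginDual G)) (δ δ' : ℝ), Γ.Nonempty ∧ 0 < δ ∧ δ ≤ 1 ∧
      (Γ.card : ℝ) ≤ 1000000 * (ε⁻¹ ^ 2 * A * (1 + Real.log A) * (1 + Real.log (ε⁻¹ * A))) ∧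
      Real.log δ⁻¹ ≤ 1000000 * (ε⁻¹ ^ 2 * A * (1 + Real.log (ε⁻¹ * A))) ∧
      ε * δ / (128 * Γ.card) ≤ δ' ∧ δ' < δ ∧ IsApprox μ f ε Γ δ δ' := by
  set ℓ := 1 + Real.log (ε⁻¹ * A) with hℓ
  have hε' : 1 ≤ ε⁻¹ := (one_le_inv₀ hε).2 hε1
  have hlogA : 0 ≤ Real.log A := Real.log_nonneg hA1
  have hlogε : 0 ≤ Real.log ε⁻¹ := Real.log_nonneg hε'
  have hℓ_eq : ℓ = 1 + Real.log ε⁻¹ + Real.log A := by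
    rw [hℓ, Real.log_mul (by positivity) (by positivity), add_assoc]
  have hℓ1 : 1 ≤ ℓ := by linarith
  -- everything is measured in powers of `y`
  set y := Real.exp ℓ with hy
  have hy1 : 1 ≤ y := Real.one_le_exp (by linarith)
  have hℓy : ℓ ≤ y := by linarith [Real.add_one_le_exp ℓ]
  have hAy : A ≤ y := by
    calc A = Real.exp (Real.log A) := (Real.exp_log (by linarith)).symm
      _ ≤ y := Real.exp_le_exp.2 (by linarith)
  have hεy : ε⁻¹ ≤ y := by
    calc ε⁻¹ = Real.exp (Real.log ε⁻¹) := (Real.exp_log (by positivity)).symm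
      _ ≤ y := Real.exp_le_exp.2 (by linarith)
  -- the number of scales
  set n := ⌈6 * ℓ⌉₊ with hn_def
  have hn1 : 6 * ℓ ≤ n := Nat.le_ceil _
  have hn2 : (n : ℝ) ≤ 7 * ℓ := by linarith [Nat.ceil_lt_add_one (show 0 ≤ 6 * ℓ by linarith)]
  have hn0 : 0 < n := by
    have : (0 : ℝ) < n := by linarith
    exact_mod_cast this
  have hny : (n : ℝ) ≤ y ^ 3 := by
    have h7 : (7 : ℝ) ≤ y ^ 2 := le_exp_pow (by norm_num) hℓ1
    calc (n : ℝ) ≤ 7 * ℓ := hn2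
      _ ≤ y ^ 2 * y := by gcongr
      _ = y ^ 3 := by ring
  have h2n : y ^ 3 ≤ 2 ^ n := by
    have h1 : (2 : ℝ) ^ n = Real.exp (n * Real.log 2) := by
      rw [mul_comm, Real.exp_mul, Real.exp_log (by norm_num), Real.rpow_natCast]
    rw [h1, hy, ← Real.exp_nat_mul]
    refine Real.exp_le_exp.2 ?_
    have h2 : (1 / 2 : ℝ) ≤ Real.log 2 := by linarith [Real.log_two_gt_d9]
    calc ((3 : ℕ) : ℝ) * ℓ = 6 * ℓ * (1 / 2) := by push_cast; ring
      _ ≤ n * Real.log 2 := by gcongr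
  have h2n' : (2 : ℝ) ^ n ≤ y ^ 7 := by
    calc (2 : ℝ) ^ n ≤ Real.exp 1 ^ n := by
          gcongr; linarith [Real.exp_one_gt_d9]
      _ = Real.exp n := by rw [← Real.exp_nat_mul, mul_one]
      _ ≤ Real.exp ((7 : ℕ) * ℓ) := Real.exp_le_exp.2 (by push_cast; exact hn2)
      _ = y ^ 7 := by rw [Real.exp_nat_mul]
  have hnA : 20 * A ≤ ε ^ 2 * 2 ^ n := by
    have h1 : 2.718 * (ε⁻¹ * A) ≤ y := by
      rw [hy, hℓ, Real.exp_add, Real.exp_log (by positivity)]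
      gcongr
      linarith [Real.exp_one_gt_d9]
    have h2 : 1 ≤ ε⁻¹ * A := one_le_mul_of_one_le_of_one_le hε' hA1
    have h3 : 20 * (ε⁻¹ ^ 2 * A) ≤ 2 ^ n := by
      calc 20 * (ε⁻¹ ^ 2 * A) ≤ 20 * (ε⁻¹ ^ 2 * A ^ 2) := by
            gcongr; exact le_self_pow₀ hA1 two_ne_zero
        _ = 20 * (ε⁻¹ * A) ^ 2 := by ring
        _ ≤ 2.718 ^ 3 * (ε⁻¹ * A) ^ 3 := by
            rw [pow_succ (ε⁻¹ * A) 2]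
            nlinarith [sq_nonneg (ε⁻¹ * A)]
        _ = (2.718 * (ε⁻¹ * A)) ^ 3 := by ring
        _ ≤ y ^ 3 := by gcongr
        _ ≤ 2 ^ n := h2n
    calc 20 * A = ε ^ 2 * (20 * (ε⁻¹ ^ 2 * A)) := by field_simp
      _ ≤ ε ^ 2 * 2 ^ n := by gcongr
  -- the bound for the size of dissociated sets, relative to the threshold
  set K := 240 * (1 + Real.log (4 * A)) with hK
  have hlog4 : Real.log (4 * A) ≤ 2 + Real.log A := by
    rw [Real.log_mul (by norm_num) (by linarith), show (4 : ℝ) = 2 ^ 2 by norm_num, Real.log_pow]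
    push_cast
    linarith [Real.log_two_lt_d9]
  have hlog4' : 0 ≤ Real.log (4 * A) := Real.log_nonneg (by linarith)
  have hK1 : K ≤ 720 * (1 + Real.log A) := by linarith
  have hK0 : 1 ≤ K := by linarith
  have hKy : K ≤ y ^ 8 := by
    have h1 : (720 : ℝ) ≤ y ^ 7 := le_exp_pow (by norm_num) hℓ1
    calc K ≤ 720 * (1 + Real.log A) := hK1
      _ ≤ y ^ 7 * y := by gcongr; linarith
      _ = y ^ 8 := by ring
  have h2n1 : (1 : ℝ) ≤ 2 ^ n := one_le_pow₀ (by norm_num)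
  set L := 2 * ⌈2 ^ n * K + 1⌉₊ with hL_def
  have hL : Even L := even_two_mul _
  have h2nK : 1 ≤ 2 ^ n * K := one_le_mul_of_one_le_of_one_le h2n1 hK0
  have hLn : 2 ^ n * K + 1 ≤ L := by
    rw [hL_def]; push_cast
    linarith [Nat.le_ceil (2 ^ n * K + 1)]
  have hLy : (L : ℝ) ≤ y ^ 17 := by
    have h6 : (6 : ℝ) ≤ y ^ 2 := le_exp_pow (by norm_num) hℓ1
    calc (L : ℝ) ≤ 6 * (2 ^ n * K) := by
          rw [hL_def]; push_cast
          linarith [Nat.ceil_lt_add_one (show 0 ≤ 2 ^ n * K + 1 by linarith)]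
      _ ≤ y ^ 2 * (y ^ 7 * y ^ 8) := by gcongr
      _ = y ^ 17 := by ring
  set ν := ε ^ 2 / (32 * A) with hν_def
  have hν : 0 < ν := by positivity
  have hν1 : ν ≤ 1 := by
    rw [hν_def, div_le_one (by positivity)]
    nlinarith
  have hνA : 32 * (ν * A) ≤ ε ^ 2 := by
    rw [hν_def]; apply le_of_eq; field_simp
  set K₁ := 60 * n * K / ε ^ 2 with hK₁
  have hK₁' : K₁ * A = 60 * (n * K * (ε⁻¹ ^ 2 * A)) := by
    rw [hK₁, inv_pow]; field_simp
  set D := 1 + K₁ * A with hD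
  have hn1' : (1 : ℝ) ≤ n := by exact_mod_cast hn0
  have hε2 : 1 ≤ ε⁻¹ ^ 2 * A := one_le_mul_of_one_le_of_one_le (one_le_pow₀ hε') hA1
  have hDy : D ≤ y ^ 19 := by
    have h61 : (61 : ℝ) ≤ y ^ 5 := le_exp_pow (by norm_num) hℓ1
    have h1 : 1 ≤ n * K * (ε⁻¹ ^ 2 * A) :=
      one_le_mul_of_one_le_of_one_le (one_le_mul_of_one_le_of_one_le hn1' hK0) hε2
    calc D ≤ 61 * (n * K * (ε⁻¹ ^ 2 * A)) := by rw [hD, hK₁']; linarith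
      _ ≤ y ^ 5 * (y ^ 3 * y ^ 8 * (y ^ 2 * y)) := by gcongr
      _ = y ^ 19 := by ring
  have hD0 : 0 < D := by
    have : 0 ≤ K₁ * A := by rw [hK₁']; positivity
    linarith
  have hL0 : (0 : ℝ) < L := by linarith
  set K₂ := 5520 * ℓ / ε ^ 2 with hK₂_def
  have hK₂0 : 0 ≤ K₂ := by positivity
  have hK₂ : Real.log (32768 * D ^ 3 * L / (ν * ε)) ≤ K₂ * (ε ^ 2 / 60) := by
    have h1 : K₂ * (ε ^ 2 / 60) = Real.log (y ^ 92) := by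
      rw [Real.log_pow, hy, Real.log_exp, hK₂_def]; field_simp; norm_num
    rw [h1]
    refine Real.log_le_log (by positivity) ?_
    have h2 : (1048576 : ℝ) ≤ y ^ 14 := le_exp_pow (by norm_num) hℓ1
    calc 32768 * D ^ 3 * L / (ν * ε) = 1048576 * (D ^ 3 * L * (ε⁻¹ ^ 3 * A)) := by
          rw [hν_def, inv_pow]; field_simp; norm_num
      _ ≤ y ^ 14 * ((y ^ 19) ^ 3 * y ^ 17 * (y ^ 3 * y)) := by gcongr
      _ = y ^ 92 := by ring
  have hU : uncapturedMass a ν {(1 : PontryaginDual G)} 1 ≤ A := by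
    refine le_trans (Summable.tsum_le_tsum (fun γ => ?_) (ha.indicator _) ha) hA
    exact Set.indicator_le_self' (fun _ _ => norm_nonneg _) γ
  have hK₁0 : 0 ≤ K₁ := by rw [hK₁]; positivity
  obtain ⟨Γ, δ, δ', hΓ, hδ0, hδ1, hcard, hlogδ, hδ', hδ'δ, happ⟩ :=
    exists_isApprox_of_budget μ ha hf hf1 hA hA1 hε hε1 hν hν1 hνA hn0 hnA hL hLn hK₁ hK₂0 hK₂
      (D := D) (E := K₂ * A) ⌈A / (ε ^ 2 / 60)⌉₊ {1} 1 (Finset.singleton_nonempty _) one_pos le_rfl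
      (by
        rw [Finset.card_singleton, Nat.cast_one, hD]
        gcongr)
      (by
        rw [inv_one, Real.log_one, zero_add]
        gcongr)
      (by
        refine hU.trans ?_
        rw [← div_le_iff₀ (by positivity)]
        exact Nat.le_ceil _)
  refine ⟨Γ, δ, δ', hΓ, hδ0, hδ1, hcard.trans ?_, hlogδ.trans ?_, hδ', hδ'δ, happ⟩
  · have h1 : n * K * (ε⁻¹ ^ 2 * A) ≤ 7 * ℓ * (720 * (1 + Real.log A)) * (ε⁻¹ ^ 2 * A) := by
      gcongr
    have h2 : 1 ≤ ε⁻¹ ^ 2 * A * (1 + Real.log A) * ℓ :=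
      one_le_mul_of_one_le_of_one_le
        (one_le_mul_of_one_le_of_one_le hε2 (by linarith)) hℓ1
    rw [hD, hK₁']
    linarith
  · have h2 : 1 ≤ ε⁻¹ ^ 2 * A * ℓ := one_le_mul_of_one_le_of_one_le hε2 hℓ1
    have h3 : K₂ * A = 5520 * (ε⁻¹ ^ 2 * A * ℓ) := by
      rw [hK₂_def, inv_pow]; field_simp
    rw [h3]
    linarith

end Iteration

/-! ### Characters of a compact abelian group separate points -/

section Gelfand

/-- In a commutative Banach algebra, an element whose powers do not decay faster than geometrically
is not killed by every character. -/
lemma exists_character_ne_zero {R : Type*} [NormedCommRing R] [NormedAlgebra ℂ R]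
    [CompleteSpace R] {x : R} {c q : ℝ} (hc : 0 < c) (hq : 0 < q)
    (h : ∀ k : ℕ, c * q ^ (2 ^ k) ≤ ‖x ^ (2 ^ k)‖) :
    ∃ χ : WeakDual.characterSpace ℂ R, χ x ≠ 0 := by
  have hnt : Nontrivial R := by
    refine ⟨⟨x ^ (2 ^ 0), 0, fun h0 => ?_⟩⟩
    have := h 0
    rw [h0, norm_zero] at this
    have : 0 < c * q ^ (2 ^ 0) := by positivity
    linarith
  have hlim := (spectrum.pow_nnnorm_pow_one_div_tendsto_nhds_spectralRadius x).comp
    (tendsto_pow_atTop_atTop_of_one_lt (one_lt_two : 1 < 2))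
  have hclim : Filter.Tendsto (fun k : ℕ => ENNReal.ofReal (c ^ (1 / ((2 ^ k : ℕ) : ℝ)) * q))
      Filter.atTop (nhds (ENNReal.ofReal q)) := by
    refine ENNReal.tendsto_ofReal ?_
    have h1 : Filter.Tendsto (fun k : ℕ => 1 / ((2 ^ k : ℕ) : ℝ)) Filter.atTop (nhds 0) :=
      tendsto_one_div_atTop_nhds_zero_nat.comp
        (tendsto_pow_atTop_atTop_of_one_lt (one_lt_two : 1 < 2))
    have h2 := (tendsto_const_nhds (x := c)).rpow h1 (Or.inl hc.ne')
    rw [Real.rpow_zero] at h2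
    simpa using h2.mul_const q
  have hle : ENNReal.ofReal q ≤ spectralRadius ℂ x := by
    refine le_of_tendsto_of_tendsto' hclim hlim fun k => ?_
    have h1 : c ^ (1 / ((2 ^ k : ℕ) : ℝ)) * q ≤ ‖x ^ (2 ^ k)‖ ^ (1 / ((2 ^ k : ℕ) : ℝ)) := by
      have h2 : (q ^ (2 ^ k)) ^ (1 / ((2 ^ k : ℕ) : ℝ)) = q := by
        rw [one_div]
        exact Real.pow_rpow_inv_natCast hq.le (by positivity)
      calc c ^ (1 / ((2 ^ k : ℕ) : ℝ)) * q
          = (c * q ^ (2 ^ k)) ^ (1 / ((2 ^ k : ℕ) : ℝ)) := by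
            rw [Real.mul_rpow hc.le (by positivity), h2]
        _ ≤ _ := by
            gcongr
            exact h k
    refine (ENNReal.ofReal_le_ofReal h1).trans (le_of_eq ?_)
    rw [← ENNReal.ofReal_rpow_of_nonneg (norm_nonneg _) (by positivity), ofReal_norm]
    rfl
  obtain ⟨z, hz, hzr⟩ := spectrum.exists_nnnorm_eq_spectralRadius x
  obtain ⟨χ, hχ⟩ := WeakDual.CharacterSpace.mem_spectrum_iff_exists.1 hz
  refine ⟨χ, fun h0 => ?_⟩
  rw [← hχ, h0, nnnorm_zero, ENNReal.coe_zero] at hzr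
  rw [← hzr] at hle
  exact absurd hle (not_le.2 (by simpa using hq))

/-- A version of `exists_character_ne_zero` for an operator in the algebra generated by a
commuting set `S`. The character is defined on the double centralizer of `S`, a closed commutative
subalgebra. -/
lemma exists_algHom_of_commuting {E : Type*} [NormedAddCommGroup E] [NormedSpace ℂ E]
    [CompleteSpace E] [Nontrivial E] {S : Set (E →L[ℂ] E)}
    (hS : ∀ s ∈ S, ∀ t ∈ S, s * t = t * s) {x : E →L[ℂ] E} (hx : x ∈ Algebra.adjoin ℂ S)
    {c q : ℝ} (hc : 0 < c) (hq : 0 < q) (h : ∀ k : ℕ, c * q ^ (2 ^ k) ≤ ‖x ^ (2 ^ k)‖) :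
    ∃ (B : Subalgebra ℂ (E →L[ℂ] E)) (χ : B →ₐ[ℂ] ℂ), Algebra.adjoin ℂ S ≤ B ∧
      (∀ y : B, ‖χ y‖ ≤ ‖(y : E →L[ℂ] E)‖) ∧ ∀ y : B, (y : E →L[ℂ] E) = x → χ y ≠ 0 := by
  set B : Subalgebra ℂ (E →L[ℂ] E) := Subalgebra.centralizer ℂ (Set.centralizer S) with hB
  have hSB : S ⊆ B := Set.subset_centralizer_centralizer
  have hSC : S ⊆ Set.centralizer S := fun s hs t ht => hS t ht s hs
  have hBcomm (y z : B) : y * z = z * y := by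
    have hy : (y : E →L[ℂ] E) ∈ Set.centralizer S := fun t ht => y.2 t (hSC ht)
    exact Subtype.ext (z.2 _ hy)
  let _ : NormedCommRing B := { (inferInstance : NormedRing B) with mul_comm := hBcomm }
  have hclosed : IsClosed (B : Set (E →L[ℂ] E)) := Set.isClosed_centralizer _
  have : CompleteSpace B := hclosed.completeSpace_coe
  have hxB : x ∈ B := Algebra.adjoin_le hSB hx
  obtain ⟨χ, hχ⟩ := exists_character_ne_zero (x := (⟨x, hxB⟩ : B)) hc hq h
  refine ⟨B, WeakDual.CharacterSpace.toAlgHom χ, Algebra.adjoin_le hSB, fun y => ?_, ?_⟩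
  · refine (AlgHom.norm_apply_le_self_mul_norm_one (WeakDual.CharacterSpace.toAlgHom χ) y).trans ?_
    have h1 : ‖(1 : B)‖ = 1 := norm_one (α := E →L[ℂ] E)
    rw [h1, mul_one]
    exact le_rfl
  · rintro ⟨y, hy⟩ rfl
    exact hχ

/-- Powers of a symmetric operator grow at least geometrically along `2 ^ k`. -/
lemma norm_pow_two_pow_ge {H : Type*} [NormedAddCommGroup H] [InnerProductSpace ℂ H] {E : Type*}
    [NormedAddCommGroup E] [NormedSpace ℂ E] (Φ : E →L[ℂ] H) {N : E →L[ℂ] E}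
    (hN : ∀ v w, inner ℂ (Φ (N v)) (Φ w) = inner ℂ (Φ v) (Φ (N w))) {v : E} (hv : Φ (N v) ≠ 0) :
    ∃ c q : ℝ, 0 < c ∧ 0 < q ∧ ∀ k : ℕ, c * q ^ (2 ^ k) ≤ ‖N ^ (2 ^ k)‖ := by
  have hpow (n : ℕ) : ∀ v w, inner ℂ (Φ ((N ^ n) v)) (Φ w) = inner ℂ (Φ v) (Φ ((N ^ n) w)) := by
    induction n with
    | zero => intro v w; rfl
    | succ n ih =>
      intro v w
      rw [pow_succ, mul_apply_eq_comp, ih, hN, ← mul_apply_eq_comp, ← pow_succ', pow_succ]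
  have hsq (n : ℕ) : ‖Φ ((N ^ n) v)‖ ^ 2 ≤ ‖Φ v‖ * ‖Φ ((N ^ (2 * n)) v)‖ := by
    have h1 : inner ℂ (Φ ((N ^ n) v)) (Φ ((N ^ n) v)) = inner ℂ (Φ v) (Φ ((N ^ (2 * n)) v)) := by
      rw [hpow n, two_mul, pow_add, mul_apply_eq_comp]
    calc ‖Φ ((N ^ n) v)‖ ^ 2 = ‖(inner ℂ (Φ ((N ^ n) v)) (Φ ((N ^ n) v)) : ℂ)‖ := by
          rw [inner_self_eq_norm_sq_to_K]; simp
      _ ≤ _ := by rw [h1]; exact norm_inner_le_norm _ _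
  have hv0 : 0 < ‖Φ v‖ := by
    rw [norm_pos_iff]
    intro h0
    have h1 := hsq 1
    rw [h0, norm_zero, zero_mul, pow_one] at h1
    exact hv (norm_eq_zero.1 (pow_eq_zero_iff two_ne_zero |>.1 (le_antisymm h1 (sq_nonneg _))))
  set q := ‖Φ (N v)‖ / ‖Φ v‖ with hq
  have hq0 : 0 < q := div_pos (norm_pos_iff.2 hv) hv0
  have hgrow (k : ℕ) : ‖Φ v‖ * q ^ (2 ^ k) ≤ ‖Φ ((N ^ (2 ^ k)) v)‖ := by
    induction k with
    | zero =>
      rw [pow_zero, pow_one, pow_one, hq, mul_div_cancel₀ _ hv0.ne']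
    | succ k ih =>
      have h1 := hsq (2 ^ k)
      rw [← pow_succ'] at h1
      have h2 : (‖Φ v‖ * q ^ (2 ^ k)) ^ 2 ≤ ‖Φ ((N ^ (2 ^ k)) v)‖ ^ 2 := by gcongr
      have h3 : ‖Φ v‖ * (‖Φ v‖ * q ^ (2 ^ (k + 1))) ≤ ‖Φ v‖ * ‖Φ ((N ^ (2 ^ (k + 1))) v)‖ := by
        refine le_trans (le_of_eq ?_) (h2.trans h1)
        rw [pow_succ 2 k, pow_mul]; ring
      exact le_of_mul_le_mul_left h3 hv0
  have hC : 0 < ‖Φ‖ * ‖v‖ := hv0.trans_le (Φ.le_opNorm v)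
  refine ⟨‖Φ v‖ / (‖Φ‖ * ‖v‖), q, div_pos hv0 hC, hq0, fun k => ?_⟩
  rw [div_mul_eq_mul_div, div_le_iff₀ hC]
  calc ‖Φ v‖ * q ^ (2 ^ k) ≤ ‖Φ ((N ^ (2 ^ k)) v)‖ := hgrow k
    _ ≤ ‖Φ‖ * (‖N ^ (2 ^ k)‖ * ‖v‖) :=
        (Φ.le_opNorm _).trans (by gcongr; exact ContinuousLinearMap.le_opNorm _ _)
    _ = ‖N ^ (2 ^ k)‖ * (‖Φ‖ * ‖v‖) := by ring

/-- The product of a pair of adjoint operators satisfies the hypothesis of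
`exists_character_ne_zero`. -/
lemma norm_mul_pow_two_pow_ge {H : Type*} [NormedAddCommGroup H] [InnerProductSpace ℂ H]
    {E : Type*} [NormedAddCommGroup E] [NormedSpace ℂ E] (Φ : E →L[ℂ] H) {D D' : E →L[ℂ] E}
    (hD : ∀ v w, inner ℂ (Φ (D v)) (Φ w) = inner ℂ (Φ v) (Φ (D' w))) {v : E}
    (hv : Φ (D' v) ≠ 0) :
    ∃ c q : ℝ, 0 < c ∧ 0 < q ∧ ∀ k : ℕ, c * q ^ (2 ^ k) ≤ ‖(D * D') ^ (2 ^ k)‖ := by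
  refine norm_pow_two_pow_ge Φ (fun v w => ?_) (v := v) fun h0 => ?_
  · rw [mul_apply_eq_comp, mul_apply_eq_comp, hD, ← inner_conj_symm, ← hD, inner_conj_symm]
  · have h1 := hD (D' v) v
    rw [← mul_apply_eq_comp, h0, inner_zero_left] at h1
    exact hv (inner_self_eq_zero.1 h1.symm)

variable {G : Type*} [CommGroup G] [TopologicalSpace G] [IsTopologicalGroup G] [CompactSpace G]

/-- The translation operator `h ↦ h (· y)` on `C(G, ℂ)`. -/
noncomputable def translation (y : G) : C(G, ℂ) →L[ℂ] C(G, ℂ) :=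
  LinearMap.mkContinuous
    { toFun := fun h => ⟨fun x => h (x * y), by fun_prop⟩
      map_add' := fun _ _ => rfl
      map_smul' := fun _ _ => rfl } 1 fun h => by
    rw [one_mul, ContinuousMap.norm_le _ (norm_nonneg _)]
    exact fun x => h.norm_coe_le_norm _

@[simp]
lemma translation_apply (y : G) (h : C(G, ℂ)) (x : G) : translation y h x = h (x * y) := rfl

lemma translation_one : translation (1 : G) = 1 := by
  ext h x; simp

lemma translation_mul (y z : G) : translation (y * z) = translation y * translation z := by
  ext h x; simp [mul_assoc]

lemma norm_translation_le (y : G) : ‖translation y‖ ≤ 1 :=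
  LinearMap.mkContinuous_norm_le _ zero_le_one _

lemma continuous_translation (h : C(G, ℂ)) : Continuous fun y : G => translation y h := by
  let F : C(G × G, ℂ) := ⟨fun p => h (p.2 * p.1), by fun_prop⟩
  exact F.curry.continuous

variable [MeasurableSpace G] [BorelSpace G] (μ : Measure G) [IsProbabilityMeasure μ]

/-- The operator `h ↦ (x ↦ ∫ u(z) h(x z) dμ(z))`, as a bounded bilinear map in `u` and `h`. -/
noncomputable def convOp : C(G, ℂ) →L[ℂ] C(G, ℂ) →L[ℂ] C(G, ℂ) :=
  LinearMap.mkContinuous₂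
    (LinearMap.mk₂ ℂ (fun u h => ⟨fun x => ∫ z, u z * h (x * z) ∂μ, by
        rw [← continuousOn_univ]
        refine continuousOn_integral_of_compact_support (k := Set.univ) isCompact_univ ?_ ?_
        · exact Continuous.continuousOn (by fun_prop)
        · intro p x _ hx
          exact absurd (Set.mem_univ x) hx⟩)
      (fun u u' h => by
        ext x
        simp only [ContinuousMap.coe_mk, ContinuousMap.add_apply, add_mul]
        exact integral_add (integrable_of_continuousMap μ (by fun_prop))
          (integrable_of_continuousMap μ (by fun_prop)))
      (fun c u h => by
        ext x
        simp only [ContinuousMap.coe_mk, ContinuousMap.smul_apply, smul_eq_mul, mul_assoc]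
        exact integral_const_mul _ _)
      (fun u h h' => by
        ext x
        simp only [ContinuousMap.coe_mk, ContinuousMap.add_apply, mul_add]
        exact integral_add (integrable_of_continuousMap μ (by fun_prop))
          (integrable_of_continuousMap μ (by fun_prop)))
      (fun c u h => by
        ext x
        simp only [ContinuousMap.coe_mk, ContinuousMap.smul_apply, smul_eq_mul, mul_left_comm _ c]
        exact integral_const_mul _ _))
    1 (fun u h => by
      rw [one_mul, ContinuousMap.norm_le _ (by positivity)]
      intro x
      refine (norm_integral_le_of_norm_le_const (C := ‖u‖ * ‖h‖) (ae_of_all _ fun z => ?_)).trans ?_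
      · rw [norm_mul]
        exact mul_le_mul (u.norm_coe_le_norm _) (h.norm_coe_le_norm _) (norm_nonneg _)
          (norm_nonneg _)
      · simp)

lemma convOp_apply (u h : C(G, ℂ)) (x : G) : convOp μ u h x = ∫ z, u z * h (x * z) ∂μ := rfl

variable [μ.IsHaarMeasure]

lemma translation_mul_convOp (y : G) (u : C(G, ℂ)) :
    translation y * convOp μ u = convOp μ (translation y⁻¹ u) := by
  ext h x
  simp only [mul_apply_eq_comp, translation_apply, convOp_apply]
  rw [← integral_mul_left_eq_self (μ := μ) (fun z => u (z * y⁻¹) * h (x * z)) y]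
  congr 1
  funext z
  rw [mul_assoc, mul_comm y z, mul_inv_cancel_right]

lemma translation_commute_convOp (y : G) (u : C(G, ℂ)) :
    translation y * convOp μ u = convOp μ u * translation y := by
  ext h x
  simp only [mul_apply_eq_comp, translation_apply, convOp_apply]
  congr 1
  funext z
  rw [mul_right_comm]

lemma inner_toLp_translation (y : G) (h k : C(G, ℂ)) :
    inner ℂ (ContinuousMap.toLp 2 μ ℂ (translation y h)) (ContinuousMap.toLp 2 μ ℂ k)
      = inner ℂ (ContinuousMap.toLp 2 μ ℂ h) (ContinuousMap.toLp 2 μ ℂ (translation y⁻¹ k)) := by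
  rw [ContinuousMap.inner_toLp, ContinuousMap.inner_toLp,
    ← integral_mul_right_eq_self (μ := μ) (fun x => translation y⁻¹ k x * conj (h x)) y]
  simp

lemma inner_toLp_convOp {u : C(G, ℂ)} (hu : ∀ z, conj (u z) = u z) (hu' : ∀ z, u z⁻¹ = u z)
    (h k : C(G, ℂ)) :
    inner ℂ (ContinuousMap.toLp 2 μ ℂ (convOp μ u h)) (ContinuousMap.toLp 2 μ ℂ k)
      = inner ℂ (ContinuousMap.toLp 2 μ ℂ h) (ContinuousMap.toLp 2 μ ℂ (convOp μ u k)) := by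
  rw [ContinuousMap.inner_toLp, ContinuousMap.inner_toLp]
  have h1 : ∀ x, k x * conj (convOp μ u h x) = ∫ z, k x * (u z * conj (h (x * z))) ∂μ := by
    intro x
    rw [convOp_apply, ← integral_conj, ← integral_const_mul]
    simp [hu]
  have h2 : ∀ x, convOp μ u k x * conj (h x) = ∫ z, u z * k (x * z) * conj (h x) ∂μ := by
    intro x
    rw [convOp_apply, ← integral_mul_const]
  simp_rw [h1, h2]
  rw [integral_integral_swap_of_hasCompactSupport
      (f := fun x z => k x * (u z * conj (h (x * z)))) (by fun_prop)
      (HasCompactSupport.of_compactSpace _),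
    integral_integral_swap_of_hasCompactSupport
      (f := fun x z => u z * k (x * z) * conj (h x)) (by fun_prop)
      (HasCompactSupport.of_compactSpace _),
    ← integral_inv_eq_self (μ := μ) (fun z => ∫ x, u z * k (x * z) * conj (h x) ∂μ)]
  congr 1
  funext z
  rw [← integral_mul_right_eq_self (μ := μ) (fun x => u z⁻¹ * k (x * z⁻¹) * conj (h x)) z]
  congr 1
  funext x
  rw [mul_inv_cancel_right, hu']
  ring

/-- A symmetric continuous bump function at the identity, supported in a given neighbourhood. -/
lemma exists_symmetric_bump [T2Space G] {V : Set G} (hV : V ∈ nhds (1 : G)) :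
    ∃ u : C(G, ℂ), (∀ z, conj (u z) = u z) ∧ (∀ z, u z⁻¹ = u z) ∧ u 1 = 1 ∧
      ∀ z, u z ≠ 0 → z ∈ V := by
  obtain ⟨W, hWV, hW, h1W⟩ := mem_nhds_iff.1 hV
  obtain ⟨w, hw0, hw1, -⟩ := exists_continuous_zero_one_of_isClosed (X := G)
    (s := Wᶜ) (t := {1}) hW.isClosed_compl isClosed_singleton
    (Set.disjoint_singleton_right.2 fun h => h h1W)
  refine ⟨⟨fun z => ((w z * w z⁻¹ : ℝ) : ℂ), by fun_prop⟩, fun z => Complex.conj_ofReal _,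
    fun z => ?_, ?_, fun z hz => ?_⟩
  · simp [mul_comm]
  · have : w 1 = 1 := hw1 rfl
    simp [this]
  · by_contra hzV
    have : w z = 0 := hw0 fun h => hzV (hWV h)
    exact hz (by simp [this])

/-- A character of an operator algebra containing all translations and a convolution operator which
it does not kill gives a character of `G`. -/
lemma exists_pontryaginDual_of_algHom {B : Subalgebra ℂ (C(G, ℂ) →L[ℂ] C(G, ℂ))} (χ : B →ₐ[ℂ] ℂ)
    (hχle : ∀ y : B, ‖χ y‖ ≤ ‖(y : C(G, ℂ) →L[ℂ] C(G, ℂ))‖) (hτB : ∀ y, translation y ∈ B)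
    {u : C(G, ℂ)} (hT : convOp μ u ∈ B) (hχt : χ ⟨convOp μ u, hT⟩ ≠ 0) :
    ∃ γ : PontryaginDual G, ∀ y, ((γ y : Circle) : ℂ) = χ ⟨translation y, hτB y⟩ := by
  let τ (y : G) : B := ⟨translation y, hτB y⟩
  let t : B := ⟨convOp μ u, hT⟩
  have hτmul (y z : G) : χ (τ (y * z)) = χ (τ y) * χ (τ z) := by
    rw [← map_mul]
    exact congrArg χ (Subtype.ext (translation_mul y z))
  have hτone : χ (τ 1) = 1 := by
    rw [← map_one χ]
    exact congrArg χ (Subtype.ext translation_one)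
  have hτle (y : G) : ‖χ (τ y)‖ ≤ 1 := (hχle _).trans (norm_translation_le y)
  have hτnorm (y : G) : ‖χ (τ y)‖ = 1 := by
    refine le_antisymm (hτle y) ?_
    have h1 : ‖χ (τ y)‖ * ‖χ (τ y⁻¹)‖ = 1 := by
      rw [← norm_mul, ← hτmul, mul_inv_cancel, hτone, norm_one]
    nlinarith [hτle y⁻¹, norm_nonneg (χ (τ y)), norm_nonneg (χ (τ y⁻¹))]
  have hcont : Continuous fun y => χ (τ y) := by
    have hχc : Continuous χ :=
      AddMonoidHomClass.continuous_of_bound χ 1 fun y => by rw [one_mul]; exact hχle y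
    have h1 : Continuous fun y : G => τ y * t := by
      refine Continuous.subtype_mk (p := (· ∈ B))
        (f := fun y : G => translation y * convOp μ u) ?_ _
      simp_rw [translation_mul_convOp]
      exact (convOp μ).continuous.comp ((continuous_translation u).comp continuous_inv)
    have h2 : (fun y => χ (τ y)) = fun y => χ (τ y * t) / χ t := by
      funext y
      rw [map_mul, mul_div_cancel_right₀ _ hχt]
    rw [h2]
    exact (hχc.comp h1).div_const _
  let γ : G →ₜ* Circle :=
    { toFun := fun y => ⟨χ (τ y), mem_sphere_zero_iff_norm.2 (hτnorm y)⟩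
      map_one' := Subtype.ext hτone
      map_mul' := fun y z => Subtype.ext (hτmul y z)
      continuous_toFun := hcont.subtype_mk _ }
  exact ⟨γ, fun y => rfl⟩

/-- For a suitable bump function `u`, the operator `(1 - translation a) * convOp u` and its adjoint
have a product whose powers do not decay too fast. -/
lemma exists_convOp_growth [T2Space G] {a : G} (ha : a ≠ 1) :
    ∃ u : C(G, ℂ), ∃ c q : ℝ, 0 < c ∧ 0 < q ∧ ∀ k : ℕ, c * q ^ (2 ^ k) ≤
      ‖(((1 - translation a) * convOp μ u) * ((1 - translation a⁻¹) * convOp μ u)) ^ (2 ^ k)‖ := by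
  obtain ⟨V, hV, hVa⟩ := exists_nhds_split_inv (s := {a}ᶜ) (isOpen_compl_singleton.mem_nhds ha.symm)
  obtain ⟨u, hu, hu', hu1, huV⟩ := exists_symmetric_bump hV
  set Φ : C(G, ℂ) →L[ℂ] Lp ℂ 2 μ := ContinuousMap.toLp 2 μ ℂ with hΦ
  set T := convOp μ u with hT
  have hTsymm := inner_toLp_convOp μ hu hu'
  have hτsymm := inner_toLp_translation μ
  have hcomm := translation_commute_convOp μ
  have hadj (h k : C(G, ℂ)) : inner ℂ (Φ (((1 - translation a) * T) h)) (Φ k)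
      = inner ℂ (Φ h) (Φ (((1 - translation a⁻¹) * T) k)) := by
    have e1 : (1 - translation a⁻¹) * T = T * (1 - translation a⁻¹) := by
      rw [sub_mul, mul_sub, one_mul, mul_one, hT, hcomm]
    rw [e1, mul_apply_eq_comp, mul_apply_eq_comp, ← hTsymm]
    simp only [sub_apply, one_apply_eq_self, map_sub, inner_sub_left, inner_sub_right]
    rw [← hτsymm]
  -- the support `V` of `u` satisfies `a ∉ V / V`, so that `T u` vanishes at `a⁻¹` but not at `1`
  have hTu1 : T u 1 ≠ 0 := by
    have e : ∀ z, u z * u (1 * z) = ((‖u z‖ ^ 2 : ℝ) : ℂ) := by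
      intro z
      have := Complex.mul_conj' (u z)
      rw [hu] at this
      rw [one_mul, this]; push_cast; rfl
    rw [hT, convOp_apply]
    simp_rw [e]
    rw [integral_complex_ofReal, Complex.ofReal_ne_zero]
    refine ne_of_gt ?_
    refine Continuous.integral_pos_of_hasCompactSupport_nonneg_nonzero (x := 1) (by fun_prop)
      (HasCompactSupport.of_compactSpace _) (fun z => sq_nonneg _) ?_
    simp [hu1]
  have hTua : T u a⁻¹ = 0 := by
    rw [hT, convOp_apply]
    refine integral_eq_zero_of_ae (ae_of_all _ fun z => ?_)
    by_contra hz
    have hz1 := huV z (left_ne_zero_of_mul hz)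
    have hz2 := huV _ (right_ne_zero_of_mul hz)
    refine hVa z hz1 _ hz2 ?_
    simp [div_eq_mul_inv]
  have hPu : Φ (((1 - translation a⁻¹) * T) u) ≠ 0 := by
    intro h0
    have h2 := ContinuousMap.toLp_injective (𝕜 := ℂ) μ (h0.trans (map_zero Φ).symm)
    have h1 := congrArg (fun g : C(G, ℂ) => g 1) h2
    simp only [mul_apply_eq_comp, sub_apply, one_apply_eq_self,
      ContinuousMap.sub_apply, translation_apply, one_mul, hTua, sub_zero,
      ContinuousMap.zero_apply] at h1
    exact hTu1 h1
  exact ⟨u, norm_mul_pow_two_pow_ge Φ hadj hPu⟩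

/-- The characters of a compact abelian group separate points. Translations and convolution with a
bump function `u` lie in a commutative Banach algebra of operators on `C(G, ℂ)`. If `χ`
is a character of the algebra with `χ (convOp u) ≠ 0`, then `y ↦ χ (translation y)` is a character
of `G`; it is continuous since `y ↦ translation y * convOp u` is continuous in norm. -/
theorem exists_character_apply_ne_one (μ : Measure G) [IsProbabilityMeasure μ] [μ.IsHaarMeasure]
    [T2Space G] {a : G} (ha : a ≠ 1) :
    ∃ γ : PontryaginDual G, γ a ≠ 1 := by
  obtain ⟨u, c, q, hc, hq, hgrow⟩ := exists_convOp_growth μ ha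
  have hcomm := translation_commute_convOp μ
  have hττ (y z : G) : translation y * translation z = translation z * translation y := by
    rw [← translation_mul, ← translation_mul, mul_comm]
  set T := convOp μ u with hT
  set S : Set (C(G, ℂ) →L[ℂ] C(G, ℂ)) := insert T (Set.range translation) with hSdef
  have hScomm : ∀ s ∈ S, ∀ t ∈ S, s * t = t * s := by
    rintro s (rfl | ⟨y, rfl⟩) t (rfl | ⟨z, rfl⟩)
    · rfl
    · exact (hcomm z u).symm
    · exact hcomm y u
    · exact hττ y z
  have hTS : T ∈ Algebra.adjoin ℂ S := Algebra.subset_adjoin (Set.mem_insert _ _)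
  have hτS (y : G) : translation y ∈ Algebra.adjoin ℂ S :=
    Algebra.subset_adjoin (Set.mem_insert_of_mem _ ⟨y, rfl⟩)
  have hNS : ((1 - translation a) * T) * ((1 - translation a⁻¹) * T) ∈ Algebra.adjoin ℂ S :=
    mul_mem (mul_mem (sub_mem (one_mem _) (hτS _)) hTS)
      (mul_mem (sub_mem (one_mem _) (hτS _)) hTS)
  obtain ⟨B, χ, hSB, hχle, hχN⟩ := exists_algHom_of_commuting hScomm hNS hc hq hgrow
  let τ (y : G) : B := ⟨translation y, hSB (hτS y)⟩
  let t : B := ⟨T, hSB hTS⟩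
  have hne : χ (((1 - τ a) * t) * ((1 - τ a⁻¹) * t)) ≠ 0 := hχN _ rfl
  rw [map_mul, map_mul, map_sub, map_one] at hne
  have hχa : χ (τ a) ≠ 1 := by
    intro h
    exact hne (by simp [h])
  have hχt : χ t ≠ 0 := right_ne_zero_of_mul (left_ne_zero_of_mul hne)
  obtain ⟨γ, hγ⟩ := exists_pontryaginDual_of_algHom μ χ hχle (fun y => hSB (hτS y)) (hSB hTS) hχt
  refine ⟨γ, fun h => hχa ?_⟩
  rw [← hγ, h]
  rfl

end Gelfand

/-! ### Uniqueness of Fourier coefficients and absolutely convergent Fourier series -/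

section Fourier

variable {G : Type*} [CommGroup G] [TopologicalSpace G] [IsTopologicalGroup G] [CompactSpace G]

/-- The trigonometric polynomials, that is, the linear combinations of characters. -/
noncomputable def trigPoly (G : Type*) [CommGroup G] [TopologicalSpace G] [IsTopologicalGroup G]
    [CompactSpace G] : StarSubalgebra ℂ C(G, ℂ) where
  toSubalgebra := (Submodule.span ℂ (Set.range (chi (G := G)))).toSubalgebra
    (Submodule.subset_span ⟨1, chi_one⟩) (by
      intro φ ψ hφ hψ
      have h := Submodule.mul_mem_mul hφ hψ
      rw [Submodule.span_mul_span] at h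
      refine Submodule.span_mono ?_ h
      rintro _ ⟨_, ⟨γ, rfl⟩, _, ⟨γ', rfl⟩, rfl⟩
      exact ⟨γ * γ', chi_mul γ γ'⟩)
  star_mem' := by
    intro φ hφ
    induction hφ using Submodule.span_induction with
    | mem φ h =>
      obtain ⟨γ, rfl⟩ := h
      rw [← chi_inv]
      exact Submodule.subset_span ⟨γ⁻¹, rfl⟩
    | zero => rw [star_zero]; exact Submodule.zero_mem _
    | add φ ψ _ _ h1 h2 => rw [star_add]; exact Submodule.add_mem _ h1 h2
    | smul c φ _ h => rw [star_smul]; exact Submodule.smul_mem _ _ h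

variable [MeasurableSpace G] [BorelSpace G] (μ : Measure G) [μ.IsHaarMeasure]
  [IsProbabilityMeasure μ]

/-- Density of the trigonometric polynomials, by the Stone–Weierstrass theorem. -/
lemma dense_span_chi (μ : Measure G) [μ.IsHaarMeasure] [IsProbabilityMeasure μ] [T2Space G] :
    Dense (Submodule.span ℂ (Set.range (chi (G := G))) : Set C(G, ℂ)) := by
  have hsep : (trigPoly G).SeparatesPoints := by
    intro x y hxy
    obtain ⟨γ, hγ⟩ := exists_character_apply_ne_one μ (a := x / y) (div_ne_one.2 hxy)
    refine ⟨chi γ, ⟨chi γ, Submodule.subset_span ⟨γ, rfl⟩, rfl⟩, fun h => hγ ?_⟩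
    rw [map_div, div_eq_one]
    exact Subtype.ext h
  have h := ContinuousMap.starSubalgebra_topologicalClosure_eq_top_of_separatesPoints _ hsep
  intro φ
  have h1 : φ ∈ (trigPoly G).topologicalClosure := by rw [h]; trivial
  exact h1

/-- Integration against an integrable function, as a functional on continuous functions. -/
noncomputable def pairing {F : G → ℂ} (hF : Integrable F μ) : C(G, ℂ) →L[ℂ] ℂ :=
  have hint (φ : C(G, ℂ)) : Integrable (fun x => F x * φ x) μ :=
    hF.mul_bdd (c := ‖φ‖) φ.continuous.aestronglyMeasurable
      (ae_of_all _ fun x => φ.norm_coe_le_norm x)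
  LinearMap.mkContinuous
    { toFun := fun φ => ∫ x, F x * φ x ∂μ
      map_add' := fun φ ψ => by
        simp only [ContinuousMap.add_apply, mul_add]
        exact integral_add (hint φ) (hint ψ)
      map_smul' := fun c φ => by
        simp only [ContinuousMap.smul_apply, smul_eq_mul, mul_left_comm _ c]
        exact integral_const_mul c _ } (∫ x, ‖F x‖ ∂μ) fun φ => by
    rw [← integral_mul_const]
    refine norm_integral_le_of_norm_le (hF.norm.mul_const _) (ae_of_all _ fun x => ?_)
    rw [norm_mul]
    exact mul_le_mul_of_nonneg_left (φ.norm_coe_le_norm x) (norm_nonneg _)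

lemma pairing_apply {F : G → ℂ} (hF : Integrable F μ) (φ : C(G, ℂ)) :
    pairing μ hF φ = ∫ x, F x * φ x ∂μ := rfl

lemma conj_chi_apply (γ : PontryaginDual G) (x : G) : conj (chi γ x) = chi γ⁻¹ x := by
  rw [chi_inv]; rfl

/-- An integrable function all of whose Fourier coefficients vanish is zero almost everywhere. -/
theorem ae_eq_zero_of_fourierCoeff_eq_zero [T2Space G] [μ.Regular] {F : G → ℂ}
    (hF : Integrable F μ) (h : ∀ γ, fourierCoeff μ F γ = 0) : F =ᵐ[μ] 0 := by
  have hL : pairing μ hF = 0 := by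
    refine ContinuousLinearMap.ext_on (dense_span_chi μ) ?_
    rintro _ ⟨γ, rfl⟩
    rw [pairing_apply, zero_apply, ← h γ⁻¹, fourierCoeff]
    congr 1
    funext x
    rw [← chi_apply γ⁻¹, conj_chi_apply, inv_inv]
  have hle : ∀ η : ℝ, 0 < η → ∫ x, ‖F x‖ ∂μ ≤ 3 * η := by
    intro η hη
    obtain ⟨g, -, hg, hgc, hgi⟩ := hF.exists_hasCompactSupport_integral_sub_le hη
    have hpos (x : G) : 0 < ‖g x‖ + η := by positivity
    -- a continuous approximation to the conjugate sign of `g`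
    let φ : C(G, ℂ) := ⟨fun x => conj (g x) / ((‖g x‖ + η : ℝ) : ℂ), by
      refine Continuous.div (by fun_prop) (by fun_prop) fun x => ?_
      exact_mod_cast (hpos x).ne'⟩
    have hφ (x : G) : ‖φ x‖ ≤ 1 := by
      show ‖conj (g x) / ((‖g x‖ + η : ℝ) : ℂ)‖ ≤ 1
      rw [norm_div, RCLike.norm_conj, Complex.norm_real, Real.norm_of_nonneg (hpos x).le,
        div_le_one (hpos x)]
      linarith
    have h1 : ∫ x, (g x - F x) * φ x ∂μ = ∫ x, g x * φ x ∂μ := by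
      have hFφ : ∫ x, F x * φ x ∂μ = 0 := by
        rw [← pairing_apply μ hF, hL, zero_apply]
      have hint (F' : G → ℂ) (hF' : Integrable F' μ) : Integrable (fun x => F' x * φ x) μ :=
        hF'.mul_bdd (c := 1) φ.continuous.aestronglyMeasurable (ae_of_all _ hφ)
      simp_rw [sub_mul]
      rw [integral_sub (hint g hgi) (hint F hF), hFφ, sub_zero]
    have h2 : ‖∫ x, g x * φ x ∂μ‖ ≤ η := by
      rw [← h1]
      refine le_trans ?_ hg
      refine norm_integral_le_of_norm_le (hF.sub hgi).norm (ae_of_all _ fun x => ?_)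
      rw [norm_mul, norm_sub_rev]
      exact mul_le_of_le_one_right (norm_nonneg _) (hφ x)
    have h3 (x : G) : g x * φ x = ((‖g x‖ ^ 2 / (‖g x‖ + η) : ℝ) : ℂ) := by
      show g x * (conj (g x) / ((‖g x‖ + η : ℝ) : ℂ)) = _
      rw [← mul_div_assoc, Complex.mul_conj']
      push_cast; rfl
    have h4 : ∫ x, (‖g x‖ - η) ∂μ ≤ η := by
      simp_rw [h3] at h2
      rw [integral_complex_ofReal, Complex.norm_real] at h2
      refine le_trans (integral_mono (hgi.norm.sub (integrable_const _)) ?_ fun x => ?_)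
        ((le_abs_self _).trans h2)
      · refine Continuous.integrable_of_hasCompactSupport ?_ (HasCompactSupport.of_compactSpace _)
        exact Continuous.div (by fun_prop) (by fun_prop) fun x => (hpos x).ne'
      · show ‖g x‖ - η ≤ ‖g x‖ ^ 2 / (‖g x‖ + η)
        rw [le_div_iff₀ (hpos x)]
        nlinarith [sq_nonneg η]
    rw [integral_sub hgi.norm (integrable_const _), integral_const, probReal_univ, one_smul] at h4
    have h5 : ∫ x, ‖F x‖ ∂μ ≤ ∫ x, (‖F x - g x‖ + ‖g x‖) ∂μ := by
      refine integral_mono hF.norm ((hF.sub hgi).norm.add hgi.norm) fun x => ?_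
      show ‖F x‖ ≤ ‖F x - g x‖ + ‖g x‖
      simpa using norm_add_le (F x - g x) (g x)
    have h6 : ∫ x, (‖F x - g x‖ + ‖g x‖) ∂μ = ∫ x, ‖F x - g x‖ ∂μ + ∫ x, ‖g x‖ ∂μ :=
      integral_add (hF.sub hgi).norm hgi.norm
    linarith
  have h0 : ∫ x, ‖F x‖ ∂μ = 0 := by
    refine le_antisymm (le_of_forall_pos_le_add fun η hη => ?_)
      (integral_nonneg fun x => norm_nonneg _)
    have := hle (η / 3) (by positivity)
    linarith
  rw [integral_eq_zero_iff_of_nonneg (fun x => norm_nonneg _) hF.norm] at h0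
  filter_upwards [h0] with x hx
  exact norm_eq_zero.1 hx

lemma integral_chi_eq_zero {γ : PontryaginDual G} (hγ : γ ≠ 1) : ∫ x, chi γ x ∂μ = 0 := by
  obtain ⟨y, hy⟩ : ∃ y, γ y ≠ 1 := by
    by_contra! h
    exact hγ (DFunLike.ext _ _ h)
  have h1 : ∫ x, chi γ (y * x) ∂μ = ∫ x, chi γ x ∂μ := integral_mul_left_eq_self _ y
  have h2 : ∫ x, chi γ (y * x) ∂μ = chi γ y * ∫ x, chi γ x ∂μ := by
    rw [← integral_const_mul]
    congr 1
    funext x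
    simp
  have h3 : (chi γ y - 1) * ∫ x, chi γ x ∂μ = 0 := by rw [sub_mul, ← h2, h1]; ring
  refine (mul_eq_zero.1 h3).resolve_left fun h => hy ?_
  exact Subtype.ext (sub_eq_zero.1 h)

lemma norm_chi_le_one (γ : PontryaginDual G) : ‖chi γ‖ ≤ 1 :=
  (ContinuousMap.norm_le _ zero_le_one).2 fun x => (norm_chi_apply γ x).le

/-- The Fourier coefficients of an absolutely convergent Fourier series. -/
lemma fourierCoeff_of_hasSum {a : PontryaginDual G → ℂ} {φ : C(G, ℂ)}
    (h : HasSum (fun γ => a γ • chi γ) φ) (γ : PontryaginDual G) :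
    fourierCoeff μ φ γ = a γ := by
  classical
  have hint : Integrable (fun x => chi γ⁻¹ x) μ := integrable_of_continuousMap μ (map_continuous _)
  have h1 := h.mapL (pairing μ hint)
  have h2 (γ' : PontryaginDual G) :
      pairing μ hint (a γ' • chi γ') = if γ' = γ then a γ else 0 := by
    have e : pairing μ hint (chi γ') = ∫ x, chi (γ⁻¹ * γ') x ∂μ := by
      rw [pairing_apply, chi_mul]; rfl
    rw [map_smul, e]
    split_ifs with hγ
    · rw [hγ, inv_mul_cancel, chi_one]
      simp
    · rw [integral_chi_eq_zero μ fun h => hγ (inv_mul_eq_one.1 h).symm, smul_zero]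
  simp_rw [h2] at h1
  have h3 := h1.unique (hasSum_ite_eq γ (a γ))
  rw [← h3, pairing_apply, fourierCoeff]
  congr 1
  funext x
  rw [← chi_apply γ, conj_chi_apply, mul_comm]

/-- A function in `A(G)` agrees almost everywhere with the sum of its uniformly convergent Fourier
series. -/
theorem exists_continuousMap_ae_eq [T2Space G] [μ.Regular] {f : G → ℂ} (hf : MemA μ f) :
    ∃ φ : C(G, ℂ), HasSum (fun γ => fourierCoeff μ f γ • chi γ) φ ∧ f =ᵐ[μ] φ := by
  have hsum : Summable fun γ => fourierCoeff μ f γ • chi γ := by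
    refine Summable.of_norm_bounded hf.2 fun γ => ?_
    rw [norm_smul]
    exact mul_le_of_le_one_right (norm_nonneg _) (norm_chi_le_one γ)
  obtain ⟨φ, hφ⟩ := hsum
  refine ⟨φ, hφ, ?_⟩
  have hφi : Integrable φ μ := integrable_of_continuousMap μ (map_continuous φ)
  have h0 := ae_eq_zero_of_fourierCoeff_eq_zero μ (hf.1.sub hφi) fun γ => by
    have hc (F : G → ℂ) (hF : Integrable F μ) :
        Integrable (fun x => F x * conj ((γ x : Circle) : ℂ)) μ :=
      hF.mul_bdd (c := 1) (Continuous.aestronglyMeasurable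
        (Complex.continuous_conj.comp (map_continuous (chi γ)))) (ae_of_all _ fun x => by
          rw [RCLike.norm_conj, Circle.norm_coe])
    have h1 := fourierCoeff_of_hasSum μ hφ γ
    rw [fourierCoeff] at h1 ⊢
    simp only [Pi.sub_apply, sub_mul]
    rw [integral_sub (hc f hf.1) (hc φ hφi), h1, fourierCoeff, sub_self]
  filter_upwards [h0] with x hx
  exact sub_eq_zero.1 hx

end Fourier

/-! ### Passage from continuous functions to `A(G)` -/

section Transfer

variable {G : Type*} [CommGroup G] [TopologicalSpace G] [IsTopologicalGroup G] [CompactSpace G]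
  [MeasurableSpace G] [BorelSpace G] (μ : Measure G) [μ.IsHaarMeasure] [IsProbabilityMeasure μ]

lemma integral_bohrMeasure_inv (Γ : Finset (PontryaginDual G)) (r : ℝ) (g : G → ℂ) :
    ∫ z, g z⁻¹ ∂(bohrMeasure μ Γ r) = ∫ z, g z ∂(bohrMeasure μ Γ r) := by
  have hB : MeasurableSet (bohrSet Γ r) := measurableSet_bohrSet Γ r
  have hinv (z : G) : z⁻¹ ∈ bohrSet Γ r ↔ z ∈ bohrSet Γ r :=
    ⟨fun h => by simpa using inv_mem_bohrSet h, inv_mem_bohrSet⟩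
  rw [integral_bohrMeasure, integral_bohrMeasure, ← integral_indicator hB,
    ← integral_indicator hB, ← integral_inv_eq_self ((bohrSet Γ r).indicator g)]
  congr 2
  funext z
  by_cases hz : z ∈ bohrSet Γ r
  · rw [Set.indicator_of_mem hz, Set.indicator_of_mem ((hinv z).2 hz)]
  · rw [Set.indicator_of_notMem hz, Set.indicator_of_notMem fun h => hz ((hinv z).1 h)]

/-- Convolution with the Bohr cutoff does not see null sets, and agrees with the averaging
operator since Bohr sets are symmetric. -/
lemma convMeasure_bohrMeasure_eq_avg {f : G → ℂ} {φ : C(G, ℂ)} (hfφ : f =ᵐ[μ] φ)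
    (Γ : Finset (PontryaginDual G)) (r : ℝ) [IsProbabilityMeasure (bohrMeasure μ Γ r)] (y : G) :
    convMeasure f (bohrMeasure μ Γ r) y = avg (bohrMeasure μ Γ r) φ y := by
  have h1 : ∀ᵐ z ∂(bohrMeasure μ Γ r), f (y / z) = φ (y / z) :=
    (bohrMeasure_absolutelyContinuous μ Γ r).ae_le
      ((μ.measurePreserving_div_left y).quasiMeasurePreserving.ae hfφ)
  rw [convMeasure, integral_congr_ae h1, avg_apply,
    ← integral_bohrMeasure_inv μ Γ r fun z => φ (y * z)]
  simp_rw [div_eq_mul_inv]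

lemma bohrNhdMeasure_absolutelyContinuous (x : G) (Γ : Finset (PontryaginDual G)) (r : ℝ) :
    bohrNhdMeasure μ x Γ r ≪ μ := by
  have h := (bohrMeasure_absolutelyContinuous μ Γ r).map (f := fun y => x * y)
    (measurable_const_mul x)
  rwa [map_mul_left_eq_self μ x] at h

lemma normLinfty_eq_of_ae_eq {f g : G → ℂ} (h : f =ᵐ[μ] g) : normLinfty μ f = normLinfty μ g := by
  rw [normLinfty, normLinfty, eLpNorm_congr_ae h]

lemma norm_apply_le_normLinfty (φ : C(G, ℂ)) (x : G) : ‖φ x‖ ≤ normLinfty μ φ := by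
  have hfin : eLpNorm φ ∞ μ ≠ ∞ := by
    rw [eLpNorm_exponent_top]
    exact (eLpNormEssSup_lt_top_of_ae_bound (C := ‖φ‖)
      (ae_of_all _ fun x => φ.norm_coe_le_norm x)).ne
  have hae : ∀ᵐ x ∂μ, ‖φ x‖ ≤ normLinfty μ φ := by
    filter_upwards [ae_le_eLpNormEssSup (f := φ) (μ := μ)] with x hx
    rw [← eLpNorm_exponent_top] at hx
    have := ENNReal.toReal_mono hfin hx
    rwa [toReal_enorm] at this
  by_contra! hx
  have hopen : IsOpen {x | normLinfty μ φ < ‖φ x‖} := isOpen_lt continuous_const (by fun_prop)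
  have h0 : μ {x | normLinfty μ φ < ‖φ x‖} = 0 := by
    simpa only [not_le] using ae_iff.1 hae
  rw [hopen.measure_eq_zero_iff μ] at h0
  exact Set.notMem_empty x (h0 ▸ hx)

lemma normLinfty_le {φ : C(G, ℂ)} {C : ℝ} (hC : 0 ≤ C) (h : ∀ x, ‖φ x‖ ≤ C) :
    normLinfty μ φ ≤ C := by
  refine ENNReal.toReal_le_of_le_ofReal hC ?_
  rw [eLpNorm_exponent_top]
  exact eLpNormEssSup_le_of_ae_bound (ae_of_all _ h)

lemma eLpNorm_top_bohrNhdMeasure_le {φ : C(G, ℂ)} {C : ℝ} {Γ : Finset (PontryaginDual G)}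
    {r : ℝ} {x : G} (h : ∀ y ∈ bohrSet Γ r, ‖φ (x * y)‖ ≤ C) :
    eLpNorm φ ∞ (bohrNhdMeasure μ x Γ r) ≤ ENNReal.ofReal C := by
  rw [eLpNorm_exponent_top]
  refine eLpNormEssSup_le_of_ae_bound ?_
  rw [bohrNhdMeasure, ae_map_iff (by fun_prop) (measurableSet_le (by fun_prop) measurable_const)]
  filter_upwards [bohrMeasure_ae_mem μ Γ r] with y hy
  exact h y hy

lemma eLpNorm_two_bohrNhdMeasure_le {φ : C(G, ℂ)} {C : ℝ} (hC : 0 ≤ C)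
    {Γ : Finset (PontryaginDual G)} {r : ℝ} [IsProbabilityMeasure (bohrMeasure μ Γ r)] {x : G}
    (h : ∫ y, ‖φ (x * y)‖ ^ 2 ∂(bohrMeasure μ Γ r) ≤ C ^ 2) :
    eLpNorm φ 2 (bohrNhdMeasure μ x Γ r) ≤ ENNReal.ofReal C := by
  rw [bohrNhdMeasure, eLpNorm_map_measure φ.continuous.aestronglyMeasurable (by fun_prop)]
  have hmem : MemLp (φ ∘ fun y => x * y) 2 (bohrMeasure μ Γ r) :=
    MemLp.of_bound (Continuous.aestronglyMeasurable (by fun_prop)) ‖φ‖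
      (ae_of_all _ fun y => φ.norm_coe_le_norm _)
  rw [hmem.eLpNorm_eq_integral_rpow_norm two_ne_zero ENNReal.ofNat_ne_top]
  refine ENNReal.ofReal_le_ofReal ?_
  simp only [ENNReal.toReal_ofNat, Real.rpow_two, Function.comp_apply]
  calc _ ≤ (C ^ 2) ^ ((2 : ℝ)⁻¹) :=
        Real.rpow_le_rpow (integral_nonneg fun y => by positivity) h (by norm_num)
    _ = C := by
        rw [← Real.rpow_natCast C 2, ← Real.rpow_mul hC]
        norm_num

end Transfer

end BohrApprox

theorem theorem7p3 :
    ∃ C : ℝ, 0 < C ∧ ∃ c : ℝ, 0 < c ∧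
      ∀ (G : Type*) [CommGroup G] [TopologicalSpace G] [IsTopologicalGroup G]
        [CompactSpace G] [T2Space G] [MeasurableSpace G] [BorelSpace G]
        (μ : Measure G) [μ.IsHaarMeasure] [μ.Regular] [IsProbabilityMeasure μ]
        (f : G → ℂ) (ε : ℝ),
        BohrApprox.MemA μ f → ¬ (f =ᵐ[μ] 0) → 0 < ε → ε ≤ 1 →
        ∃ (Γ : Finset (PontryaginDual G)) (δ δ' : ℝ),
          Γ.Nonempty ∧ 0 < δ ∧ δ ≤ 1 ∧
          (Γ.card : ℝ) ≤ C * (ε⁻¹ ^ 2 * BohrApprox.ratioA μ f *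
            (1 + Real.log (BohrApprox.ratioA μ f)) *
            (1 + Real.log (ε⁻¹ * BohrApprox.ratioA μ f))) ∧
          Real.log δ⁻¹ ≤ C * (ε⁻¹ ^ 2 * BohrApprox.ratioA μ f *
            (1 + Real.log (ε⁻¹ * BohrApprox.ratioA μ f))) ∧
          0 < δ' ∧ δ' < δ ∧ c * (ε * δ / (Γ.card : ℝ)) ≤ δ' ∧
          (∀ x : G,
            eLpNorm (fun y => BohrApprox.convMeasure f (BohrApprox.bohrMeasure μ Γ δ) y -
                BohrApprox.convMeasure f (BohrApprox.bohrMeasure μ Γ δ) x) ∞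
              (BohrApprox.bohrNhdMeasure μ x Γ δ') ≤
            ENNReal.ofReal (ε * BohrApprox.normLinfty μ f)) ∧
          (∀ x : G,
            eLpNorm (fun y => f y -
                BohrApprox.convMeasure f (BohrApprox.bohrMeasure μ Γ δ) y) 2
              (BohrApprox.bohrNhdMeasure μ x Γ δ') ≤
            ENNReal.ofReal (ε * BohrApprox.normLinfty μ f)) := by
  refine ⟨1000000, by norm_num, 1 / 128, by norm_num, ?_⟩
  intro G _ _ _ _ _ _ _ μ _ _ _ f ε hf hf0 hε hε1
  obtain ⟨φ, hφ, hfφ⟩ := BohrApprox.exists_continuousMap_ae_eq μ hf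
  set M := BohrApprox.normLinfty μ f with hM
  have hMφ : M = BohrApprox.normLinfty μ φ := BohrApprox.normLinfty_eq_of_ae_eq μ hfφ
  have hφM (x : G) : ‖φ x‖ ≤ M := hMφ ▸ BohrApprox.norm_apply_le_normLinfty μ φ x
  have hM0 : 0 < M := by
    refine lt_of_le_of_ne ENNReal.toReal_nonneg fun h0 => hf0 ?_
    filter_upwards [hfφ] with x hx
    rw [hx]
    exact norm_le_zero_iff.1 (h0 ▸ hφM x)
  have hMA : M ≤ BohrApprox.normA μ f := by
    rw [hMφ]
    refine BohrApprox.normLinfty_le μ (tsum_nonneg fun γ => norm_nonneg _) fun x => ?_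
    refine (φ.norm_coe_le_norm x).trans ?_
    rw [← hφ.tsum_eq]
    refine tsum_of_norm_bounded hf.2.hasSum fun γ => ?_
    rw [norm_smul]
    exact mul_le_of_le_one_right (norm_nonneg _) (BohrApprox.norm_chi_le_one γ)
  have hMc : ‖((M : ℂ)⁻¹)‖ = M⁻¹ := by
    rw [norm_inv, Complex.norm_real, Real.norm_of_nonneg hM0.le]
  -- the theorem for continuous functions, applied after normalising the supremum norm
  obtain ⟨Γ, δ, δ', hΓ, hδ, hδ1, hcard, hlog, hδ'c, hδ'δ, hP, hunif, hL2⟩ :=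
    BohrApprox.exists_isApprox (f := (M : ℂ)⁻¹ • φ)
      (a := fun γ => (M : ℂ)⁻¹ * BohrApprox.fourierCoeff μ f γ) (A := BohrApprox.ratioA μ f) μ
      (by simp_rw [norm_mul]; exact hf.2.mul_left _)
      (by simp_rw [mul_smul]; exact hφ.const_smul _)
      (fun x => by
        rw [ContinuousMap.smul_apply, norm_smul, hMc, inv_mul_le_one₀ hM0]
        exact hφM x)
      (by
        simp_rw [norm_mul, hMc]
        rw [tsum_mul_left, BohrApprox.ratioA, div_eq_inv_mul]
        exact le_rfl)
      ((one_le_div hM0).2 hMA) hε hε1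
  have hδ' : 0 < δ' := lt_of_lt_of_le (by
    have : 0 < Γ.card := hΓ.card_pos
    positivity) hδ'c
  have hconv : BohrApprox.convMeasure f (BohrApprox.bohrMeasure μ Γ δ)
      = BohrApprox.avg (BohrApprox.bohrMeasure μ Γ δ) φ :=
    funext fun y => BohrApprox.convMeasure_bohrMeasure_eq_avg μ hfφ Γ δ y
  have hscale (w : ℂ) (t : ℝ) : ‖(M : ℂ)⁻¹ * w‖ ≤ t ↔ ‖w‖ ≤ t * M := by
    rw [norm_mul, hMc, inv_mul_le_iff₀ hM0, mul_comm]
  refine ⟨Γ, δ, δ', hΓ, hδ, hδ1, hcard, hlog, hδ', hδ'δ, ?_, fun x => ?_, fun x => ?_⟩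
  · refine le_trans (le_of_eq ?_) hδ'c
    field_simp
  · rw [hconv]
    refine BohrApprox.eLpNorm_top_bohrNhdMeasure_le μ
      (φ := BohrApprox.avg (BohrApprox.bohrMeasure μ Γ δ) φ
        - ContinuousMap.const G (BohrApprox.avg (BohrApprox.bohrMeasure μ Γ δ) φ x))
      fun y hy => ?_
    have h := hunif x y hy
    rw [map_smul, ContinuousMap.smul_apply, ContinuousMap.smul_apply, smul_eq_mul, smul_eq_mul,
      ← mul_sub, hscale] at h
    exact h
  · have : IsProbabilityMeasure (BohrApprox.bohrMeasure μ Γ δ') :=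
      BohrApprox.isProbabilityMeasure_bohrMeasure μ Γ hδ'
    rw [hconv, eLpNorm_congr_ae (g := φ - BohrApprox.avg (BohrApprox.bohrMeasure μ Γ δ) φ)]
    · refine BohrApprox.eLpNorm_two_bohrNhdMeasure_le μ
        (φ := φ - BohrApprox.avg (BohrApprox.bohrMeasure μ Γ δ) φ) (by positivity) ?_
      have h := hL2 x
      simp_rw [map_smul, ContinuousMap.smul_apply, smul_eq_mul, ← mul_sub, norm_mul, hMc,
        mul_pow] at h
      rw [integral_const_mul, inv_pow, inv_mul_le_iff₀ (by positivity)] at h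
      rw [mul_pow, mul_comm]
      exact h
    · filter_upwards [(BohrApprox.bohrNhdMeasure_absolutelyContinuous μ x Γ δ').ae_le hfφ] with y hy
      simp [hy]
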